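/- Let $(M,\sigma)$ be a connected symplectic manifold with a smooth and proper action of a finite-dimensional connected Lie group $G$ with Lie algebra $\mathfrak g$ by symplectomorphisms, and let $J\colon M\to\mathfrak g^*$ be an $\mathrm{Ad}^*$-equivariant momentum map. Assume that $0$ is a value and a regular value of $J$ and that $G$ acts freely and properly on $C=J^{-1}(0)$. Let $\iota\colon C\hookrightarrow M$ be the inclusion and $\pi\colon C\to M_{\mathrm{red}}=C/G$ the projection onto the quotient manifold. For a $G$-manifold $N$ let $\Omega_{\mathfrak g}^k(N)=\bigoplus_{2i+j=k}[\mathrm{Sym}^i(\mathfrak g^*)\otimes\Omega^j(N)]^G$ be the (Cartan) equivariant forms, i.e. equivariant polynomial maps $\alpha\colon\mathfrak g\to\Omega(N)$, with differential $(d_{\mathfrak g}\alpha)(\xi)=d(\alpha(\xi))+i_{X_\xi}(\alpha(\xi))$, where $X_\xi$ is the fundamental vector field of $\xi$; let $Z_{\mathfrak g}^k(N)$ be the closed ones and $H_{\mathfrak g}^k(N)$ the cohomology. Pullbacks act by $f^*(p\otimes\beta)=p\otimes f^*\beta$, and forms on $M_{\mathrm{red}}$ are pulled back by $\pi$ into symmetric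 degree $0$. Let $\omega\in\Omega^1(C)\otimes\mathfrak g$ be any principal connection on $C$, that is, $\mathrm{Ad}_g((g^{-1})^*\omega)=\omega$ for $g\in G$ and $\omega(X_\xi)=\xi$ for $\xi\in\mathfrak g$. It splits $TC$ into vertical and horizontal parts and hence splits forms on $C$ by vertical degree. Let $h'_\omega$ be the operator $$h'_\omega\Big(\prod_{i=1}^l p_i\otimes\alpha\Big)=\sum_{j=1}^l\prod_{i\ne j}p_i\otimes p_j(\omega)\wedge\alpha$$ (zero for $l=0$), and let $h_\omega=\frac1{l+q}h'_\omega$ on elements of symmetric degree $l\ge1$ and vertical degree $q$, $h_\omega=0$ on symmetric degree $0$. Put $\phi(\alpha)=\alpha-d_{\mathfrak g}h_\omega\alpha$. Then the following holds for every $k\ge0$. 1. For every $\alpha\in Z_{\mathfrak g}^k(M)$ the pullback $\iota^*\alpha$ lies in $Z_{\mathfrak g}^k(C)$, and the sequence $\phi^n(\iota^*\alpha)$ is constant for $n\ge\lfloor k/2\rfloor$; denote its final value by $\Phi(\iota^*\alpha)$. The map $\pi^*\colon Z^k(M_{\mathrm{red}})\to Z^k_{\mathfrak g}(C)$ is well defined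 and injective, $\Phi(\iota^*\alpha)$ lies in its image, and therefore $$K=(\pi^*)^{-1}\circ\Phi\circ\iota^*\colon Z_{\mathfrak g}^k(M)\to Z^k(M_{\mathrm{red}})$$ is a well-defined linear map. 2. $\iota^*$ and $\pi^*$ induce linear maps $\iota^*\colon H_{\mathfrak g}^k(M)\to H_{\mathfrak g}^k(C)$ and $\pi^*\colon H_{\mathrm{dR}}^k(M_{\mathrm{red}})\to H_{\mathfrak g}^k(C)$ on cohomology, the latter is an isomorphism, and $K$ induces the map $$K=(\pi^*)^{-1}\circ\iota^*\colon H_{\mathfrak g}^k(M)\to H_{\mathrm{dR}}^k(M_{\mathrm{red}}),$$ in particular for $k=2$. Moreover, on equivariant forms on $C$ of total degree $k\le2$ one has $h_\omega=h'_\omega$. -/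

import Mathlib

open scoped Manifold ContDiff Topology

noncomputable section

namespace Kirwan

/-! ## Differential forms on manifolds

Manifolds are modelled on finite-dimensional real normed spaces. The tangent space at a point `x` of
a manifold modelled on `E` is, by Mathlib's definition of `TangentSpace`, the space `E`, through the
preferred chart at `x`. -/

section Forms

variable {E E' : Type*} [NormedAddCommGroup E] [NormedSpace ℝ E]
  [NormedAddCommGroup E'] [NormedSpace ℝ E']
  {M : Type*} [TopologicalSpace M] [ChartedSpace E M]
  {N : Type*} [TopologicalSpace N] [ChartedSpace E' N]

/-- The tangent map `T_x f : T_x M → T_{f x} N`. -/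
def tmap (E E' : Type*) [NormedAddCommGroup E] [NormedSpace ℝ E]
    [NormedAddCommGroup E'] [NormedSpace ℝ E']
    {M : Type*} [TopologicalSpace M] [ChartedSpace E M]
    {N : Type*} [TopologicalSpace N] [ChartedSpace E' N] (f : M → N) (x : M) : E →L[ℝ] E' :=
  mfderiv 𝓘(ℝ, E) 𝓘(ℝ, E') f x

/-- Fields of alternating `k`-forms on `M` (no regularity): at each `x` an alternating form on
`T_x M`. -/
def FormField (E : Type*) [NormedAddCommGroup E] [NormedSpace ℝ E] (M : Type*) (k : ℕ) :
    Type _ :=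
  M → E [⋀^Fin k]→L[ℝ] ℝ

instance (E : Type*) [NormedAddCommGroup E] [NormedSpace ℝ E] (M : Type*) (k : ℕ) :
    AddCommGroup (FormField E M k) :=
  inferInstanceAs (AddCommGroup (M → E [⋀^Fin k]→L[ℝ] ℝ))

instance (E : Type*) [NormedAddCommGroup E] [NormedSpace ℝ E] (M : Type*) (k : ℕ) :
    Module ℝ (FormField E M k) :=
  inferInstanceAs (Module ℝ (M → E [⋀^Fin k]→L[ℝ] ℝ))

theorem FormField.zero_apply (E : Type*) [NormedAddCommGroup E] [NormedSpace ℝ E] (M : Type*)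
    (k : ℕ) (x : M) : (0 : FormField E M k) x = 0 := rfl

theorem FormField.add_apply {E : Type*} [NormedAddCommGroup E] [NormedSpace ℝ E] {M : Type*}
    {k : ℕ} (a b : FormField E M k) (x : M) : (a + b) x = a x + b x := rfl

theorem FormField.smul_apply {E : Type*} [NormedAddCommGroup E] [NormedSpace ℝ E] {M : Type*}
    {k : ℕ} (c : ℝ) (a : FormField E M k) (x : M) : (c • a) x = c • a x := rfl

/-- Pullback `f^* β`. -/
def pullback (f : M → N) {k : ℕ} (β : FormField E' N k) : FormField E M k :=
  fun x => (β (f x)).compContinuousLinearMap (tmap E E' f x)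

/-- The coordinate representation of `β` in the preferred chart at `x₀`, i.e. the pullback of `β`
under the inverse of that chart. -/
def chartRep {k : ℕ} (β : FormField E M k) (x₀ : M) : E → E [⋀^Fin k]→L[ℝ] ℝ :=
  pullback (extChartAt 𝓘(ℝ, E) x₀).symm β

/-- `β` is a smooth differential form: it is smooth in all charts. -/
def IsSmoothForm {k : ℕ} (β : FormField E M k) : Prop :=
  ∀ x₀ : M, ContDiffOn ℝ ∞ (chartRep β x₀) (extChartAt 𝓘(ℝ, E) x₀).target

/-- The exterior derivative, computed at `x` in the preferred chart at `x` (whose derivative at `x`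
is the identity of `T_x M = E`). -/
def extD {k : ℕ} (β : FormField E M k) : FormField E M (k + 1) :=
  fun x => extDeriv (chartRep β x) (extChartAt 𝓘(ℝ, E) x x)

/-- Insertion of a vector field in the first argument. -/
def insertion {E M : Type*} [NormedAddCommGroup E] [NormedSpace ℝ E] (X : M → E) {k : ℕ}
    (β : FormField E M (k + 1)) : FormField E M k :=
  fun x => (β x).curryLeft (X x)

theorem pullback_add (f : M → N) {k : ℕ} (a b : FormField E' N k) :
    pullback (E := E) f (a + b) = pullback f a + pullback f b := by
  funext x; ext v
  simp [pullback, FormField.add_apply]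

theorem pullback_smul (f : M → N) {k : ℕ} (c : ℝ) (a : FormField E' N k) :
    pullback (E := E) f (c • a) = c • pullback f a := by
  funext x; ext v
  simp [pullback, FormField.smul_apply]

theorem pullback_zero (f : M → N) {k : ℕ} :
    pullback (E := E) f (0 : FormField E' N k) = 0 := by
  funext x; ext v
  simp [pullback, FormField.zero_apply]

theorem IsSmoothForm.zero {k : ℕ} : IsSmoothForm (0 : FormField E M k) := fun x₀ => by
  unfold chartRep; rw [pullback_zero]; exact contDiffOn_const

theorem IsSmoothForm.add {k : ℕ} {a b : FormField E M k} (ha : IsSmoothForm a)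
    (hb : IsSmoothForm b) : IsSmoothForm (a + b) := fun x₀ => by
  unfold chartRep; rw [pullback_add]; exact (ha x₀).add (hb x₀)

theorem IsSmoothForm.smul {k : ℕ} (c : ℝ) {a : FormField E M k} (ha : IsSmoothForm a) :
    IsSmoothForm (c • a) := fun x₀ => by
  unfold chartRep; rw [pullback_smul]; exact (ha x₀).const_smul c

theorem IsSmoothForm.differentiableAt {k : ℕ} {a : FormField E M k} (ha : IsSmoothForm a) (x : M) :
    DifferentiableAt ℝ (chartRep a x) (extChartAt 𝓘(ℝ, E) x x) :=
  ((ha x).contDiffAt (extChartAt_target_mem_nhds x)).differentiableAt (by simp)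

theorem extD_add {k : ℕ} {a b : FormField E M k} (ha : IsSmoothForm a) (hb : IsSmoothForm b) :
    extD (a + b) = extD a + extD b := by
  funext x
  have h : chartRep (a + b) x = chartRep a x + chartRep b x := pullback_add _ _ _
  simp only [extD, FormField.add_apply, h]
  exact extDeriv_add (ha.differentiableAt x) (hb.differentiableAt x)

theorem extD_smul {k : ℕ} (c : ℝ) (a : FormField E M k) : extD (c • a) = c • extD a := by
  funext x
  have h : chartRep (c • a) x = c • chartRep a x := pullback_smul _ _ _
  simp only [extD, FormField.smul_apply, h]
  exact extDeriv_smul c _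

theorem extD_zero {k : ℕ} : extD (0 : FormField E M k) = 0 := by
  simpa using extD_smul (0 : ℝ) (0 : FormField E M k)

theorem insertion_add {E M : Type*} [NormedAddCommGroup E] [NormedSpace ℝ E]
    (X : M → E) {k : ℕ} (a b : FormField E M (k + 1)) :
    insertion X (a + b) = insertion X a + insertion X b := by
  funext x; ext v
  simp [insertion, FormField.add_apply]

theorem insertion_smul {E M : Type*} [NormedAddCommGroup E] [NormedSpace ℝ E]
    (X : M → E) {k : ℕ} (c : ℝ) (a : FormField E M (k + 1)) :
    insertion X (c • a) = c • insertion X a := by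
  funext x; ext v
  simp [insertion, FormField.smul_apply]

/-- `Ω^k(M)`. -/
def smoothForms (E : Type*) [NormedAddCommGroup E] [NormedSpace ℝ E] (M : Type*)
    [TopologicalSpace M] [ChartedSpace E M] (k : ℕ) : Submodule ℝ (FormField E M k) where
  carrier := {β | IsSmoothForm β}
  zero_mem' := IsSmoothForm.zero
  add_mem' := IsSmoothForm.add
  smul_mem' c _ h := h.smul c

/-- The closed forms `Z^k(M)`. -/
def closedForms (E : Type*) [NormedAddCommGroup E] [NormedSpace ℝ E] (M : Type*)
    [TopologicalSpace M] [ChartedSpace E M] (k : ℕ) : Submodule ℝ (FormField E M k) where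
  carrier := {β | IsSmoothForm β ∧ extD β = 0}
  zero_mem' := ⟨IsSmoothForm.zero, extD_zero⟩
  add_mem' ha hb := ⟨ha.1.add hb.1, by rw [extD_add ha.1 hb.1, ha.2, hb.2, add_zero]⟩
  smul_mem' c _ h := ⟨h.1.smul c, by rw [extD_smul, h.2, smul_zero]⟩

/-- The exact forms `d Ω^{k-1}(M)` (zero for `k = 0`). -/
def exactForms (E : Type*) [NormedAddCommGroup E] [NormedSpace ℝ E] (M : Type*)
    [TopologicalSpace M] [ChartedSpace E M] : (k : ℕ) → Submodule ℝ (FormField E M k)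
  | 0 => ⊥
  | k + 1 =>
    { carrier := {β | ∃ γ : FormField E M k, IsSmoothForm γ ∧ extD γ = β}
      zero_mem' := ⟨0, IsSmoothForm.zero, extD_zero⟩
      add_mem' := by
        rintro _ _ ⟨a, ha, rfl⟩ ⟨b, hb, rfl⟩
        exact ⟨a + b, ha.add hb, extD_add ha hb⟩
      smul_mem' := by
        rintro c _ ⟨a, ha, rfl⟩
        exact ⟨c • a, ha.smul c, extD_smul c a⟩ }

/-- De Rham cohomology `H_dR^k(M)`. -/
abbrev DeRham (E : Type*) [NormedAddCommGroup E] [NormedSpace ℝ E] (M : Type*)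
    [TopologicalSpace M] [ChartedSpace E M] (k : ℕ) : Type _ :=
  closedForms E M k ⧸ (exactForms E M k).comap (closedForms E M k).subtype

end Forms

/-! ## Lie group actions and the Cartan complex

The Lie algebra `𝔤 = T_1 G` of a Lie group `G` modelled on `EG` is the vector space `EG`. -/

section Cartan

variable {EG E : Type*} [NormedAddCommGroup EG] [NormedSpace ℝ EG]
  [NormedAddCommGroup E] [NormedSpace ℝ E]
  {G : Type*} [TopologicalSpace G] [ChartedSpace EG G] [Group G]
  {M : Type*} [TopologicalSpace M] [ChartedSpace E M] [MulAction G M]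

/-- The adjoint representation: the derivative at `1` of conjugation by `g`. -/
def Ad (EG : Type*) [NormedAddCommGroup EG] [NormedSpace ℝ EG]
    {G : Type*} [TopologicalSpace G] [ChartedSpace EG G] [Group G] (g : G) : EG →L[ℝ] EG :=
  tmap EG EG (fun h : G => g * h * g⁻¹) 1

/-- The infinitesimal action at `x`: the derivative at `1` of the orbit map `g ↦ g • x`. It sends
`ξ ∈ 𝔤` to the value at `x` of the fundamental vector field `X_ξ`. -/
def fundamental (EG E G : Type*) [NormedAddCommGroup EG] [NormedSpace ℝ EG]
    [NormedAddCommGroup E] [NormedSpace ℝ E]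
    [TopologicalSpace G] [ChartedSpace EG G] [Group G]
    {M : Type*} [TopologicalSpace M] [ChartedSpace E M] [MulAction G M] (x : M) : EG →L[ℝ] E :=
  tmap EG E (fun g : G => g • x) 1

/-- Families `α i j : 𝔤 → {fields of j-forms on M}` indexed by a symmetric degree `i` and an
exterior degree `j` (no regularity). -/
abbrev CartanField (EG E : Type*) [NormedAddCommGroup E] [NormedSpace ℝ E] (M : Type*) : Type _ :=
  ∀ _i j : ℕ, EG → FormField E M j

/-- `Sym^i(𝔤^*) ⊗ Ω^j(M)`, viewed as the space of homogeneous polynomial maps `𝔤 → Ω^j(M)` of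
degree `i`: the product `p_1 ⋯ p_i ⊗ β` is the map `ξ ↦ p_1(ξ) ⋯ p_i(ξ) β`. -/
def polyForms (EG E : Type*) [NormedAddCommGroup EG] [NormedSpace ℝ EG]
    [NormedAddCommGroup E] [NormedSpace ℝ E]
    (M : Type*) [TopologicalSpace M] [ChartedSpace E M] (i j : ℕ) :
    Submodule ℝ (EG → FormField E M j) :=
  Submodule.span ℝ {f | ∃ (p : Fin i → EG →L[ℝ] ℝ) (β : FormField E M j),
    IsSmoothForm β ∧ f = fun ξ => (∏ s, p s ξ) • β}

theorem polyForms.isSmoothForm {i j : ℕ} {f : EG → FormField E M j}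
    (hf : f ∈ polyForms EG E M i j) (ξ : EG) : IsSmoothForm (f ξ) := by
  induction hf using Submodule.span_induction with
  | mem f h => obtain ⟨p, β, hβ, rfl⟩ := h; exact hβ.smul _
  | zero => exact IsSmoothForm.zero
  | add f g _ _ hf hg => exact hf.add hg
  | smul c f _ hf => exact hf.smul c

/-- The equivariant differential forms `Ω_𝔤^k(M) = ⨁_{2i+j=k} [Sym^i(𝔤^*) ⊗ Ω^j(M)]^G`. Invariance
of a polynomial map `α` means `α(Ad_g ξ) = (g⁻¹)^* α(ξ)`. -/
def cartanForms (EG E G : Type*) [NormedAddCommGroup EG] [NormedSpace ℝ EG]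
    [NormedAddCommGroup E] [NormedSpace ℝ E]
    [TopologicalSpace G] [ChartedSpace EG G] [Group G]
    (M : Type*) [TopologicalSpace M] [ChartedSpace E M] [MulAction G M] (k : ℕ) :
    Submodule ℝ (CartanField EG E M) where
  carrier := {α | (∀ i j, α i j ∈ polyForms EG E M i j) ∧
    (∀ i j, 2 * i + j ≠ k → α i j = 0) ∧
    ∀ i j (g : G) (ξ : EG),
      α i j (Ad EG g ξ) = pullback (fun x : M => g⁻¹ • x) (α i j ξ)}
  zero_mem' := ⟨fun _ _ => Submodule.zero_mem _, fun _ _ _ => rfl, fun _ _ _ _ =>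
    (pullback_zero _).symm⟩
  add_mem' := by
    rintro a b ⟨ha1, ha2, ha3⟩ ⟨hb1, hb2, hb3⟩
    refine ⟨fun i j => Submodule.add_mem _ (ha1 i j) (hb1 i j), fun i j h => ?_,
      fun i j g ξ => ?_⟩
    · simp [ha2 i j h, hb2 i j h]
    · simp only [Pi.add_apply, pullback_add, ha3, hb3]
  smul_mem' := by
    rintro c a ⟨ha1, ha2, ha3⟩
    refine ⟨fun i j => Submodule.smul_mem _ c (ha1 i j), fun i j h => ?_, fun i j g ξ => ?_⟩
    · simp [ha2 i j h]
    · simp only [Pi.smul_apply, pullback_smul, ha3]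

/-- The part of the Cartan differential coming from the de Rham differential. -/
def cartanDeRham (α : CartanField EG E M) : CartanField EG E M
  | _, 0 => 0
  | i, j + 1 => fun ξ => extD (α i j ξ)

/-- The part `i_•` of the Cartan differential: insertion of fundamental vector fields,
`(i_• α)(ξ) = i_{X_ξ} (α(ξ))`. -/
def cartanInsertion (G : Type*) [TopologicalSpace G] [ChartedSpace EG G] [Group G] [MulAction G M]
    (α : CartanField EG E M) : CartanField EG E M
  | 0, _ => 0
  | i + 1, j => fun ξ => insertion (fun x => fundamental EG E G x ξ) (α i (j + 1) ξ)

/-- The Cartan differential `d_𝔤 = d + i_•`. -/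
def cartanD (G : Type*) [TopologicalSpace G] [ChartedSpace EG G] [Group G] [MulAction G M]
    (α : CartanField EG E M) : CartanField EG E M :=
  cartanDeRham α + cartanInsertion G α

theorem cartanD_add {k : ℕ} {a b : CartanField EG E M} (ha : a ∈ cartanForms EG E G M k)
    (hb : b ∈ cartanForms EG E G M k) : cartanD G (a + b) = cartanD G a + cartanD G b := by
  have h1 : cartanDeRham (a + b) = cartanDeRham a + cartanDeRham b := by
    funext i j ξ
    cases j with
    | zero => simp [cartanDeRham]
    | succ j =>
      exact extD_add (polyForms.isSmoothForm (ha.1 i j) ξ) (polyForms.isSmoothForm (hb.1 i j) ξ)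
  have h2 : cartanInsertion G (a + b) = cartanInsertion G a + cartanInsertion G b := by
    funext i j ξ
    cases i with
    | zero => simp [cartanInsertion]
    | succ i => exact insertion_add _ _ _
  rw [cartanD, h1, h2, cartanD, cartanD]; abel

theorem cartanD_smul (c : ℝ) (a : CartanField EG E M) :
    cartanD G (c • a) = c • cartanD G a := by
  have h1 : cartanDeRham (c • a) = c • cartanDeRham a := by
    funext i j ξ
    cases j with
    | zero => simp [cartanDeRham]
    | succ j => exact extD_smul _ _
  have h2 : cartanInsertion G (c • a) = c • cartanInsertion G a := by
    funext i j ξ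
    cases i with
    | zero => simp [cartanInsertion]
    | succ i => exact insertion_smul _ _ _
  rw [cartanD, h1, h2, cartanD, smul_add]

theorem cartanD_zero : cartanD G (0 : CartanField EG E M) = 0 := by
  simpa using cartanD_smul (G := G) (0 : ℝ) (0 : CartanField EG E M)

/-- The closed equivariant forms `Z_𝔤^k(M)`. -/
def closedCartan (EG E G : Type*) [NormedAddCommGroup EG] [NormedSpace ℝ EG]
    [NormedAddCommGroup E] [NormedSpace ℝ E]
    [TopologicalSpace G] [ChartedSpace EG G] [Group G]
    (M : Type*) [TopologicalSpace M] [ChartedSpace E M] [MulAction G M] (k : ℕ) :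
    Submodule ℝ (CartanField EG E M) where
  carrier := {α | α ∈ cartanForms EG E G M k ∧ cartanD G α = 0}
  zero_mem' := ⟨Submodule.zero_mem _, cartanD_zero⟩
  add_mem' ha hb := ⟨Submodule.add_mem _ ha.1 hb.1, by
    rw [cartanD_add ha.1 hb.1, ha.2, hb.2, add_zero]⟩
  smul_mem' c _ h := ⟨Submodule.smul_mem _ c h.1, by rw [cartanD_smul, h.2, smul_zero]⟩

/-- The exact equivariant forms `d_𝔤 Ω_𝔤^{k-1}(M)` (zero for `k = 0`). -/
def exactCartan (EG E G : Type*) [NormedAddCommGroup EG] [NormedSpace ℝ EG]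
    [NormedAddCommGroup E] [NormedSpace ℝ E]
    [TopologicalSpace G] [ChartedSpace EG G] [Group G]
    (M : Type*) [TopologicalSpace M] [ChartedSpace E M] [MulAction G M] :
    ℕ → Submodule ℝ (CartanField EG E M)
  | 0 => ⊥
  | k + 1 =>
    { carrier := {α | ∃ γ, γ ∈ cartanForms EG E G M k ∧ cartanD G γ = α}
      zero_mem' := ⟨0, Submodule.zero_mem _, cartanD_zero⟩
      add_mem' := by
        rintro _ _ ⟨a, ha, rfl⟩ ⟨b, hb, rfl⟩
        exact ⟨a + b, Submodule.add_mem _ ha hb, cartanD_add ha hb⟩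
      smul_mem' := by
        rintro c _ ⟨a, ha, rfl⟩
        exact ⟨c • a, Submodule.smul_mem _ c ha, cartanD_smul c a⟩ }

/-- Equivariant cohomology in the Cartan model, `H_𝔤^k(M)`. -/
abbrev EquivariantCohomology (EG E G : Type*) [NormedAddCommGroup EG] [NormedSpace ℝ EG]
    [NormedAddCommGroup E] [NormedSpace ℝ E]
    [TopologicalSpace G] [ChartedSpace EG G] [Group G]
    (M : Type*) [TopologicalSpace M] [ChartedSpace E M] [MulAction G M] (k : ℕ) : Type _ :=
  closedCartan EG E G M k ⧸ (exactCartan EG E G M k).comap (closedCartan EG E G M k).subtype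

/-- Pullback of equivariant forms, `f^*(p ⊗ β) = p ⊗ f^* β`. -/
def cartanPullback {E' : Type*} [NormedAddCommGroup E'] [NormedSpace ℝ E']
    {N : Type*} [TopologicalSpace N] [ChartedSpace E' N] (f : M → N)
    (α : CartanField EG E' N) : CartanField EG E M :=
  fun i j ξ => pullback f (α i j ξ)

/-- A `k`-form regarded as an element `1 ⊗ β` of symmetric degree `0`. -/
def ofForm (EG : Type*) {k : ℕ} (β : FormField E M k) : CartanField EG E M :=
  fun i j _ => if i = 0 then Pi.single (M := fun j => FormField E M j) k β j else 0

/-! ## Principal connections and the vertical homotopy -/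

/-- A principal connection for the action of `G` on `M`: a smooth `𝔤`-valued `1`-form `θ` with
`Ad_g ((g⁻¹)^* θ) = θ` and `θ(X_ξ) = ξ`. -/
structure PrincipalConnection (EG E G : Type*) [NormedAddCommGroup EG] [NormedSpace ℝ EG]
    [NormedAddCommGroup E] [NormedSpace ℝ E]
    [TopologicalSpace G] [ChartedSpace EG G] [Group G]
    (M : Type*) [TopologicalSpace M] [ChartedSpace E M] [MulAction G M] where
  /-- the connection form -/
  form : M → E →L[ℝ] EG
  smooth : ∀ x₀ : M, ContDiffOn ℝ ∞
    (fun y => (form ((extChartAt 𝓘(ℝ, E) x₀).symm y)).comp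
      (tmap E E (extChartAt 𝓘(ℝ, E) x₀).symm y))
    (extChartAt 𝓘(ℝ, E) x₀).target
  equivariant : ∀ (g : G) (x : M),
    (Ad EG g).comp ((form (g⁻¹ • x)).comp (tmap E E (fun y : M => g⁻¹ • y) x)) = form x
  vertical : ∀ (x : M) (ξ : EG), form x (fundamental EG E G x ξ) = ξ

namespace PrincipalConnection

variable (θ : PrincipalConnection EG E G M)

/-- The vertical projection `v ↦ X_{θ(v)}` of `T_x M`. -/
def vert (x : M) : E →L[ℝ] E := (fundamental EG E G x).comp (θ.form x)

/-- The component of vertical degree `q` of an alternating `j`-form `b` on `T_x M`: its value on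
`(v_1, …, v_j)` is the sum over all `q`-element sets `S` of indices of the value of `b` on the tuple
which has the vertical part of `v_s` for `s ∈ S` and the horizontal part of `v_s` for `s ∉ S`. (The
alternatization counts every such set `q! (j - q)!` times; the component is used for `q ≤ j`.) -/
def vertPart {j : ℕ} (q : ℕ) (x : M) (b : E [⋀^Fin j]→L[ℝ] ℝ) : E [⋀^Fin j]→L[ℝ] ℝ :=
  ((q.factorial : ℝ) * ((j - q).factorial : ℝ))⁻¹ •
    ContinuousMultilinearMap.alternatization
      (b.toContinuousMultilinearMap.compContinuousLinearMap
        (fun s : Fin j => if (s : ℕ) < q then θ.vert x else ContinuousLinearMap.id ℝ E - θ.vert x))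

/-- The derivation `p_1 ⋯ p_k ⊗ β ↦ ∑_s (∏_{r ≠ s} p_r) ⊗ p_s(θ) ∧ β`, from symmetric degree `i + 1`
and exterior degree `j` to symmetric degree `i` and exterior degree `j + 1`. On polynomial maps it
is `(h α)(ξ)(v_0, …, v_j) = ∑_s (-1)^s (D_ξ α · θ(v_s))(v_0, …, v̂_s, …, v_j)`. -/
def rawHomotopy (α : CartanField EG E M) : CartanField EG E M
  | _, 0 => 0
  | i, j + 1 => fun ξ x =>
    ContinuousAlternatingMap.alternatizeUncurryFin
      ((fderiv ℝ (fun η : EG => α (i + 1) j η x) ξ).comp (θ.form x))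

/-- The operator which divides the part of symmetric degree `i` and vertical degree `q` by
`i + q`. -/
def normalize (α : CartanField EG E M) : CartanField EG E M :=
  fun i j ξ x => ∑ q ∈ Finset.range (j + 1), ((i : ℝ) + (q : ℝ))⁻¹ • θ.vertPart q x (α i j ξ x)

/-- The contraction `h_θ`: on elements of symmetric degree `i ≥ 1` and vertical degree `q` it is
`(i + q)⁻¹` times the derivation `rawHomotopy`; it vanishes on symmetric degree `0`. -/
def homotopy (α : CartanField EG E M) : CartanField EG E M := θ.rawHomotopy (θ.normalize α)

/-- The map `φ(α) = α - d_𝔤 h_θ α`, whose iterates define `Φ`. -/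
def phi (α : CartanField EG E M) : CartanField EG E M := α - cartanD G (θ.homotopy α)

end PrincipalConnection

end Cartan

/-! ## Hamiltonian actions and Marsden–Weinstein reduction -/

section Reduction

variable {EG E : Type*} [NormedAddCommGroup EG] [NormedSpace ℝ EG]
  [NormedAddCommGroup E] [NormedSpace ℝ E]

/-- `σ` is a symplectic form. -/
structure IsSymplectic {M : Type*} [TopologicalSpace M] [ChartedSpace E M]
    (σ : FormField E M 2) : Prop where
  smooth : IsSmoothForm σ
  closed : extD σ = 0
  nondegenerate : ∀ (x : M) (v : E), (∀ w : E, σ x ![v, w] = 0) → v = 0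

/-- The action of `G` on `M` is symplectic and `J` is an `Ad^*`-equivariant momentum map for it:
`d⟨J, ξ⟩ = i_{X_ξ} σ`. -/
structure IsMomentumMap (G : Type*) [TopologicalSpace G] [ChartedSpace EG G] [Group G]
    {M : Type*} [TopologicalSpace M] [ChartedSpace E M] [MulAction G M]
    (σ : FormField E M 2) (J : M → EG →L[ℝ] ℝ) : Prop where
  symplectic : ∀ g : G, pullback (fun x : M => g • x) σ = σ
  smooth : ContMDiff 𝓘(ℝ, E) 𝓘(ℝ, EG →L[ℝ] ℝ) ∞ J
  hamiltonian : ∀ (x : M) (ξ : EG) (v : E),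
    tmap E (EG →L[ℝ] ℝ) J x v ξ = σ x ![fundamental EG E G x ξ, v]
  equivariant : ∀ (g : G) (x : M), J (g • x) = (J x).comp (Ad EG g⁻¹)

/-- `R` is Marsden–Weinstein reduced from `M` via `C`: `0` is a value and a regular value of `J`,
`ι` is the inclusion of the submanifold `C = J⁻¹(0)` with the induced `G`-action, which is free and
proper, and `π : C → R` is the projection onto the quotient manifold `R = C / G`. -/
structure IsReduction (E EC ER G : Type*) [NormedAddCommGroup E] [NormedSpace ℝ E]
    [NormedAddCommGroup EC] [NormedSpace ℝ EC] [NormedAddCommGroup ER] [NormedSpace ℝ ER]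
    [TopologicalSpace G] [Group G]
    {M : Type*} [TopologicalSpace M] [ChartedSpace E M] [MulAction G M] (J : M → EG →L[ℝ] ℝ)
    {C : Type*} [TopologicalSpace C] [ChartedSpace EC C] [MulAction G C] (ι : C → M)
    {R : Type*} [TopologicalSpace R] [ChartedSpace ER R] (π : C → R) : Prop where
  value : ∃ x, J x = 0
  regular : ∀ x, J x = 0 → Function.Surjective (tmap E (EG →L[ℝ] ℝ) J x)
  embedding : Manifold.IsSmoothEmbedding 𝓘(ℝ, EC) 𝓘(ℝ, E) ∞ ι
  level : Set.range ι = J ⁻¹' {0}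
  equivariant : ∀ (g : G) (c : C), ι (g • c) = g • ι c
  free : ∀ (g : G) (c : C), g • c = c → g = 1
  proper : ProperSMul G C
  submersion : Manifold.IsSubmersion 𝓘(ℝ, EC) 𝓘(ℝ, ER) ∞ π
  surjective : Function.Surjective π
  orbits : ∀ c c' : C, π c = π c' ↔ ∃ g : G, g • c = c'

end Reduction

end Kirwan

end

/-! The Cartan differential is d_𝔤 = d + i_•, and i_• trades one exterior degree for one symmetric
degree. On C the connection gives an operator h' in the opposite direction, and i_• h' + h' i_•
multiplies the part of symmetric degree l and vertical degree q by l + q, as in the Koszul complex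
of the vertical directions. Dividing by l + q turns h' into a contraction h of i_• in positive
symmetric degree (`cartanInsertion_homotopy_add`).

Let α be an equivariant form of symmetric degree at most m, with m ≥ 1, whose differential has
symmetric degree zero. Its top part satisfies i_• α_m = 0, so α_m = i_• h α_m, and this is exactly
the part of d_𝔤 h α in symmetric degree m. Hence φ removes α_m (`phi_apply_eq_zero`). In total
degree k the symmetric degree is at most k/2, so k/2 steps reach symmetric degree zero, where h
vanishes and φ is the identity. Each step changes the form by an exact one, so the differential is
kept, and so is the class of a closed form.

What remains is an ordinary invariant form annihilated by the vertical fields. Such a basic form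
descends to the quotient (`exists_pullback_eq`), because the kernel of Tπ consists of vertical
vectors (`vert_eq_of_tmap_eq_zero`); this is where freeness and properness of the action enter.
Applied to closed forms, the argument constructs K and shows that π^* is onto in cohomology. Applied
to a primitive γ of π^*β, whose differential has symmetric degree zero although γ need not be
closed, it shows that π^* is injective in cohomology. Since the iterates of φ preserve classes, K
induces the inverse of π^* composed with ι^*.

Two facts support this. The identity d_𝔤² = 0 needs the Lie derivative of α(ξ) along X_ξ to vanish
(`infinitesimal_invariance`), which follows from invariance because Ad fixes ξ to first order in the
direction ξ. Vertical degrees are handled through the generating function b ∘ (H + tV) = ∑ t^q b_q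
of the components of b, where V is the vertical projection and H = id - V
(`compContinuousLinearMap_eq_sum_verticalPart`). -/

set_option linter.unusedSectionVars false

namespace Kirwan

open ContinuousAlternatingMap

/-! ## Alternating forms on a normed space -/

section Alternating

variable {X E F : Type*} [NormedAddCommGroup X] [NormedSpace ℝ X]
  [NormedAddCommGroup E] [NormedSpace ℝ E] [NormedAddCommGroup F] [NormedSpace ℝ F]

/-! ### Smoothness of families of alternating forms. -/

theorem _root_.ContDiffAt.curryLeft {n : WithTop ℕ∞} {k : ℕ} {β : X → E [⋀^Fin (k + 1)]→L[ℝ] ℝ}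
    {x : X} (hβ : ContDiffAt ℝ n β x) : ContDiffAt ℝ n (fun y => (β y).curryLeft) x :=
  let L : (E [⋀^Fin (k + 1)]→L[ℝ] ℝ) →L[ℝ] (E →L[ℝ] E [⋀^Fin k]→L[ℝ] ℝ) :=
    curryLeftLI.toContinuousLinearMap
  have hL : ContDiff ℝ n L := by fun_prop
  hL.contDiffAt.comp x hβ

theorem _root_.ContDiffAt.continuousAlternatingMap_apply {n : WithTop ℕ∞} {k : ℕ}
    {β : X → E [⋀^Fin k]→L[ℝ] ℝ} {w : X → Fin k → E} {x : X} (hβ : ContDiffAt ℝ n β x)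
    (hw : ∀ i, ContDiffAt ℝ n (fun y => w y i) x) : ContDiffAt ℝ n (fun y => β y (w y)) x := by
  induction k with
  | zero =>
    have : (fun y => β y (w y)) = fun y => (constOfIsEmptyLIE ℝ E ℝ (Fin 0)).symm (β y) := by
      funext y
      rw [eq_comm, LinearIsometryEquiv.symm_apply_eq]
      ext v
      simp [Subsingleton.elim v (w y)]
    rw [this]
    exact ((constOfIsEmptyLIE ℝ E ℝ (Fin 0)).symm.toContinuousLinearEquiv.contDiff.contDiffAt).comp
      x hβ
  | succ k ih =>
    have : (fun y => β y (w y)) = fun y => ((β y).curryLeft (w y 0)) (Fin.tail (w y)) := by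
      funext y
      rw [curryLeft_apply_apply]
      exact congrArg _ (Fin.cons_self_tail (w y)).symm
    rw [this]
    exact ih (hβ.curryLeft.clm_apply (hw 0)) fun i => hw i.succ

/-- After identifying E with ℝ^d, a linear map is the tuple of its values on a basis, and smoothness
of a tuple is smoothness of its entries. -/
theorem _root_.contDiffAt_clm_iff_forall_apply {n : WithTop ℕ∞} [FiniteDimensional ℝ E]
    {f : X → E →L[ℝ] F} {x : X} :
    ContDiffAt ℝ n f x ↔ ∀ v, ContDiffAt ℝ n (fun y => f y v) x := by
  refine ⟨fun h v => h.clm_apply contDiffAt_const, fun h => ?_⟩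
  let d := Module.finrank ℝ E
  have hd : d = Module.finrank ℝ (Fin d → ℝ) := (Module.finrank_fin_fun ℝ).symm
  let e₁ := ContinuousLinearEquiv.ofFinrankEq hd
  let e₂ := (e₁.arrowCongr (1 : F ≃L[ℝ] F)).trans (ContinuousLinearEquiv.piRing (Fin d))
  rw [← Function.id_comp f, ← e₂.symm_comp_self]
  exact e₂.symm.contDiff.contDiffAt.comp x (contDiffAt_pi.mpr fun i => h _)

theorem _root_.contDiffAt_continuousAlternatingMap_iff {n : WithTop ℕ∞} [FiniteDimensional ℝ E]
    {k : ℕ} {β : X → E [⋀^Fin k]→L[ℝ] ℝ} {x : X} :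
    ContDiffAt ℝ n β x ↔ ∀ v, ContDiffAt ℝ n (fun y => β y v) x := by
  refine ⟨fun h v => h.continuousAlternatingMap_apply fun _ => contDiffAt_const, fun h => ?_⟩
  induction k with
  | zero =>
    have : β = fun y => constOfIsEmptyLIE ℝ E ℝ (Fin 0) (β y 0) := by
      funext y; ext v; simp [Subsingleton.elim v 0]
    rw [this]
    exact (constOfIsEmptyLIE ℝ E ℝ (Fin 0)).toContinuousLinearEquiv.contDiff.contDiffAt.comp x (h 0)
  | succ k ih =>
    -- Alternatizing the curried form gives back k + 1 times the form, so smoothness of β reduces to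
    -- that of its curried form and the induction lowers k.
    have : β = fun y => ((k : ℝ) + 1)⁻¹ • alternatizeUncurryFinCLM ℝ E ℝ ((β y).curryLeft) := by
      funext y
      rw [alternatizeUncurryFinCLM_apply, alternatizeUncurryFin_curryLeft,
        ← Nat.cast_smul_eq_nsmul ℝ, smul_smul]
      push_cast
      rw [inv_mul_cancel₀ (by positivity), one_smul]
    rw [this]
    let L : (E →L[ℝ] E [⋀^Fin k]→L[ℝ] ℝ) →L[ℝ] (E [⋀^Fin (k + 1)]→L[ℝ] ℝ) :=
      alternatizeUncurryFinCLM ℝ E ℝ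
    have hL : ContDiff ℝ n L := by fun_prop
    refine ContDiffAt.const_smul _ (hL.contDiffAt.comp x ?_)
    exact contDiffAt_clm_iff_forall_apply.2 fun v => ih fun u => h (Fin.cons v u)

theorem _root_.ContDiffAt.compContinuousAlternatingMap_clm {n : WithTop ℕ∞} [FiniteDimensional ℝ E]
    {k : ℕ} {β : X → F [⋀^Fin k]→L[ℝ] ℝ} {A : X → E →L[ℝ] F} {x : X}
    (hβ : ContDiffAt ℝ n β x) (hA : ContDiffAt ℝ n A x) :
    ContDiffAt ℝ n (fun y => (β y).compContinuousLinearMap (A y)) x :=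
  contDiffAt_continuousAlternatingMap_iff.2 fun v =>
    hβ.continuousAlternatingMap_apply (w := fun y i => A y (v i))
      fun _ => hA.clm_apply contDiffAt_const

/-- Insertion of a fixed vector, as a continuous linear map. -/
noncomputable def curryLeftAt (k : ℕ) (X : E) :
    (E [⋀^Fin (k + 1)]→L[ℝ] ℝ) →L[ℝ] (E [⋀^Fin k]→L[ℝ] ℝ) :=
  (ContinuousLinearMap.apply ℝ (E [⋀^Fin k]→L[ℝ] ℝ) X).comp
    (curryLeftLI (𝕜 := ℝ) (E := E) (F := ℝ) (n := k)).toContinuousLinearMap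

theorem curryLeftAt_apply {k : ℕ} (X : E) (b : E [⋀^Fin (k + 1)]→L[ℝ] ℝ) :
    curryLeftAt k X b = b.curryLeft X := rfl

/-- Insertion of a vector into `alternatizeUncurryFin T` (Leibniz rule). -/
theorem curryLeft_alternatizeUncurryFin {k : ℕ} (T : E →L[ℝ] E [⋀^Fin (k + 1)]→L[ℝ] ℝ) (X : E) :
    (alternatizeUncurryFin T).curryLeft X =
      T X - alternatizeUncurryFin ((curryLeftAt k X).comp T) := by
  ext v
  rw [curryLeft_apply_apply, alternatizeUncurryFin_apply, Fin.sum_univ_succ]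
  simp only [ContinuousAlternatingMap.sub_apply, alternatizeUncurryFin_apply]
  rw [sub_eq_add_neg, ← Finset.sum_neg_distrib]
  congr 1
  · simp
  · refine Finset.sum_congr rfl fun i _ => ?_
    simp only [Fin.val_succ, Matrix.cons_val_succ, ContinuousLinearMap.comp_apply,
      curryLeftAt_apply]
    rw [curryLeft_apply_apply, pow_succ, mul_neg_one, neg_smul]
    congr 3
    funext j
    refine Fin.cases ?_ (fun j => ?_) j
    · simp [Fin.removeNth]
    · simp [Fin.removeNth]

theorem curryLeft_alternatizeUncurryFin_zero (T : E →L[ℝ] E [⋀^Fin 0]→L[ℝ] ℝ) (X : E) :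
    (alternatizeUncurryFin T).curryLeft X = T X := by
  ext v
  rw [curryLeft_apply_apply, alternatizeUncurryFin_apply]
  refine (Fin.sum_univ_one _).trans ?_
  simp

/-- Both sides are the derivation that inserts A in one slot at a time and sums. With A the vertical
projection, it is the operator that multiplies by the vertical degree. -/
theorem alternatizeUncurryFin_comp_eq_fderivCompContinuousLinearMap {k : ℕ}
    (f : E [⋀^Fin (k + 1)]→L[ℝ] ℝ) (A : E →L[ℝ] E) :
    alternatizeUncurryFin (f.curryLeft.comp A) =
      f.fderivCompContinuousLinearMap (.id ℝ E) A := by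
  rw [fderivCompContinuousLinearMap_eq_alternatizeUncurryFin]
  simp only [ContinuousLinearMap.comp_apply, alternatizeUncurryFinCLM_apply]
  congr 1

theorem alternatizeUncurryFin_compContinuousLinearMap {k : ℕ} (T : F →L[ℝ] F [⋀^Fin k]→L[ℝ] ℝ)
    (A : E →L[ℝ] F) :
    (alternatizeUncurryFin T).compContinuousLinearMap A =
      alternatizeUncurryFin (((compContinuousLinearMapCLM A).comp T).comp A) := by
  ext v
  simp only [compContinuousLinearMap_apply, alternatizeUncurryFin_apply]
  rfl

end Alternating

/-! ## Decomposition of alternating forms by vertical degree -/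

section VerticalDegree

variable {E F : Type*} [NormedAddCommGroup E] [NormedSpace ℝ E]
  [NormedAddCommGroup F] [NormedSpace ℝ F]

/-- The component of degree `q` of an alternating form `b` with respect to a projection `V`. -/
noncomputable def verticalPart (V : E →L[ℝ] E) {j : ℕ} (q : ℕ) (b : E [⋀^Fin j]→L[ℝ] ℝ) :
    E [⋀^Fin j]→L[ℝ] ℝ :=
  ((q.factorial : ℝ) * ((j - q).factorial : ℝ))⁻¹ •
    ContinuousMultilinearMap.alternatization
      (b.toContinuousMultilinearMap.compContinuousLinearMap
        (fun s : Fin j => if (s : ℕ) < q then V else ContinuousLinearMap.id ℝ E - V))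

theorem verticalPart_apply (V : E →L[ℝ] E) {j : ℕ} (q : ℕ) (b : E [⋀^Fin j]→L[ℝ] ℝ)
    (v : Fin j → E) :
    verticalPart V q b v = ((q.factorial : ℝ) * ((j - q).factorial : ℝ))⁻¹ *
      ∑ σ : Equiv.Perm (Fin j), (Equiv.Perm.sign σ : ℤ) •
        b (fun s => (if (s : ℕ) < q then V else ContinuousLinearMap.id ℝ E - V) (v (σ s))) := by
  simp only [verticalPart, ContinuousAlternatingMap.smul_apply, smul_eq_mul,
    ContinuousMultilinearMap.alternatization_apply_apply]
  rfl

theorem verticalPart_add (V : E →L[ℝ] E) {j : ℕ} (q : ℕ) (b c : E [⋀^Fin j]→L[ℝ] ℝ) :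
    verticalPart V q (b + c) = verticalPart V q b + verticalPart V q c := by
  ext v
  simp [verticalPart_apply, Finset.sum_add_distrib, mul_add]

theorem verticalPart_smul (V : E →L[ℝ] E) {j : ℕ} (q : ℕ) (r : ℝ) (b : E [⋀^Fin j]→L[ℝ] ℝ) :
    verticalPart V q (r • b) = r • verticalPart V q b := by
  ext v
  simp only [verticalPart_apply, ContinuousAlternatingMap.smul_apply, smul_eq_mul, zsmul_eq_mul,
    Finset.mul_sum]
  exact Finset.sum_congr rfl fun σ _ => by ring

theorem verticalPart_compContinuousLinearMap (V : F →L[ℝ] F) (W : E →L[ℝ] E) (A : E →L[ℝ] F)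
    (h : V.comp A = A.comp W) {j : ℕ} (q : ℕ) (b : F [⋀^Fin j]→L[ℝ] ℝ) :
    (verticalPart V q b).compContinuousLinearMap A =
      verticalPart W q (b.compContinuousLinearMap A) := by
  ext v
  have h' : ∀ u, V (A u) = A (W u) := fun u => congrArg (fun T : E →L[ℝ] F => T u) h
  simp only [verticalPart_apply, compContinuousLinearMap_apply]
  congr 1
  refine Finset.sum_congr rfl fun σ _ => ?_
  congr 2
  funext s
  simp only [Function.comp_apply]
  split_ifs <;> simp [h']

/-! ### The generating function of the vertical components. -/

theorem card_filter_fin_lt {j q : ℕ} (hq : q ≤ j) :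
    (Finset.univ.filter fun s : Fin j => (s : ℕ) < q).card = q := by
  rw [Fin.card_filter_val_lt, min_eq_right hq]

theorem card_eq_of_perm_iff {j q : ℕ} (hq : q ≤ j) {S : Finset (Fin j)} {σ : Equiv.Perm (Fin j)}
    (h : ∀ s, ((σ⁻¹ s : Fin j) : ℕ) < q ↔ s ∈ S) : S.card = q := by
  have : S = (Finset.univ.filter fun s : Fin j => (s : ℕ) < q).map σ.toEmbedding := by
    ext s
    rw [← h s]
    simp [Finset.mem_map_equiv]
  rw [this, Finset.card_map, card_filter_fin_lt hq]

/-- The permutations carrying the first q indices onto S form a coset of the stabilizer of the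
two-colouring s < q, whose order is q! (j - q)!. This is the multiplicity that the prefactor in
`verticalPart` removes. -/
theorem card_perm_iff {j q : ℕ} (hq : q ≤ j) {S : Finset (Fin j)} (hS : S.card = q) :
    (Finset.univ.filter fun σ : Equiv.Perm (Fin j) =>
      ∀ s, ((σ⁻¹ s : Fin j) : ℕ) < q ↔ s ∈ S).card = q.factorial * (j - q).factorial := by
  classical
  let f : Fin j → Bool := fun s => decide ((s : ℕ) < q)
  have hc : Fintype.card {s : Fin j // (s : ℕ) < q} = Fintype.card {s : Fin j // s ∈ S} := by
    rw [Fintype.card_subtype, card_filter_fin_lt hq, Fintype.card_coe, hS]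
  obtain ⟨τ, hτ⟩ : ∃ τ : Equiv.Perm (Fin j), ∀ s, τ s ∈ S ↔ (s : ℕ) < q := by
    let e := Fintype.equivOfCardEq hc
    refine ⟨e.extendSubtype, fun s => ⟨fun h => ?_, fun h => e.extendSubtype_mem s h⟩⟩
    by_contra hs
    exact e.extendSubtype_not_mem s hs h
  have h1 := DomMulAct.stabilizer_card f
  rw [Fintype.prod_bool] at h1
  have ht : Fintype.card {a // f a = true} = q := by
    rw [Fintype.card_subtype]
    simpa [f] using card_filter_fin_lt hq
  have hf : Fintype.card {a // f a = false} = j - q := by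
    have := Fintype.card_subtype_compl (fun a => f a = true)
    rw [ht, Fintype.card_fin] at this
    simpa using this
  rw [ht, hf] at h1
  rw [← h1, Fintype.card_subtype]
  refine Finset.card_bij' (fun σ _ => σ⁻¹ * τ) (fun σ _ => τ * σ⁻¹) ?_ ?_ ?_ ?_
  · intro σ hσ
    simp only [Finset.mem_filter, Finset.mem_univ, true_and] at hσ ⊢
    funext s
    exact decide_eq_decide.2 (by rw [Equiv.Perm.mul_apply, hσ, hτ])
  · intro σ hσ
    simp only [Finset.mem_filter, Finset.mem_univ, true_and] at hσ ⊢
    intro s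
    have := congrFun hσ (τ⁻¹ s)
    simp only [Function.comp_apply, f, decide_eq_decide] at this
    rw [mul_inv_rev, inv_inv, Equiv.Perm.mul_apply, this, ← hτ]
    simp
  · intro σ _
    simp
  · intro σ _
    simp

/-- Multilinearity expands the left side over the sets S of slots that receive tV. The sets with q
elements contribute t^q, and alternatization counts each of them q! (j - q)! times. -/
theorem compContinuousLinearMap_eq_sum_verticalPart (V : E →L[ℝ] E) {j : ℕ}
    (b : E [⋀^Fin j]→L[ℝ] ℝ) (t : ℝ) :
    b.compContinuousLinearMap (ContinuousLinearMap.id ℝ E - V + t • V) =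
      ∑ q ∈ Finset.range (j + 1), t ^ q • verticalPart V q b := by
  classical
  set H := ContinuousLinearMap.id ℝ E - V with hH
  ext v
  have h1 : ∀ q ∈ Finset.range (j + 1), (t ^ q • verticalPart V q b) v =
      ∑ S : Finset (Fin j), if S.card = q then
        t ^ q * b (S.piecewise (fun s => V (v s)) (fun s => H (v s))) else 0 := by
    intro q hq
    have hq : q ≤ j := by simpa [Nat.lt_succ_iff] using hq
    rw [ContinuousAlternatingMap.smul_apply, verticalPart_apply, smul_eq_mul]
    -- The summand of σ is the term of the single set S onto which σ carries the first q indices;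
    -- reordering the arguments produces a second sign, which cancels the first.
    have h2 : ∀ σ : Equiv.Perm (Fin j), (Equiv.Perm.sign σ : ℤ) •
        b (fun s : Fin j => (if (s : ℕ) < q then V else H) (v (σ s))) =
        ∑ S : Finset (Fin j), if (∀ s, ((σ⁻¹ s : Fin j) : ℕ) < q ↔ s ∈ S) then
          b (S.piecewise (fun s => V (v s)) (fun s => H (v s))) else 0 := by
      intro σ
      have h3 := b.map_perm
        (fun s : Fin j => (if ((σ⁻¹ s : Fin j) : ℕ) < q then V else H) (v s)) σ
      have h4 : ((fun s : Fin j => (if ((σ⁻¹ s : Fin j) : ℕ) < q then V else H) (v s))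
          ∘ σ) = fun s : Fin j => (if (s : ℕ) < q then V else H) (v (σ s)) := by
        funext s; simp
      rw [h4] at h3
      change b _ = (Equiv.Perm.sign σ : ℤ) • b _ at h3
      rw [h3, smul_smul]
      have h5 : (Equiv.Perm.sign σ : ℤ) * (Equiv.Perm.sign σ : ℤ) = 1 := by
        rw [← Units.val_mul, Int.units_mul_self, Units.val_one]
      rw [h5, one_smul, 
          Finset.sum_eq_single (Finset.univ.filter fun s => ((σ⁻¹ s : Fin j) : ℕ) < q)]
      · rw [if_pos (by simp)]
        congr 1
        funext s
        simp only [Finset.piecewise, Finset.mem_filter, Finset.mem_univ, true_and]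
        split_ifs <;> rfl
      · intro S _ hS
        refine if_neg fun h => hS ?_
        ext s
        rw [← h s]
        simp
      · exact fun h => (h (Finset.mem_univ _)).elim
    rw [Finset.sum_congr rfl fun σ _ => h2 σ]
    rw [Finset.sum_comm, Finset.mul_sum, Finset.mul_sum]
    refine Finset.sum_congr rfl fun S _ => ?_
    rw [← Finset.sum_filter, Finset.sum_const, nsmul_eq_mul]
    split_ifs with hS
    · rw [card_perm_iff hq hS]
      push_cast
      rw [← mul_assoc _ _ (b _), inv_mul_cancel₀ (by positivity), one_mul]
    · rw [Finset.filter_eq_empty_iff.2 fun σ _ h => hS (card_eq_of_perm_iff hq h)]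
      simp
  rw [ContinuousAlternatingMap.sum_apply, Finset.sum_congr rfl h1, Finset.sum_comm]
  have h6 : (b.compContinuousLinearMap (H + t • V)) v =
      b ((fun s => t • V (v s)) + fun s => H (v s)) := by
    rw [compContinuousLinearMap_apply]
    congr 1; funext s; simp [add_comm]
  rw [h6, show b ((fun s => t • V (v s)) + fun s => H (v s)) = _ from
    b.toMultilinearMap.map_add_univ _ _]
  refine Finset.sum_congr rfl fun S _ => ?_
  rw [Finset.sum_ite_eq, if_pos (by
    simpa [Nat.lt_succ_iff] using (Finset.card_le_univ S).trans_eq (Fintype.card_fin j))]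
  have h7 := b.toMultilinearMap.map_piecewise_smul (fun _ => t)
    (S.piecewise (fun s => V (v s)) (fun s => H (v s))) S
  simp only [Finset.prod_const, smul_eq_mul] at h7
  refine Eq.trans (congrArg b ?_) h7
  funext s
  by_cases hs : s ∈ S <;> simp [hs]

/-- Evaluated on fixed vectors, the two sides are real polynomials in t that agree everywhere, so
their coefficients agree. Identities for components can therefore be checked on generating
functions. -/
theorem eq_of_sum_pow_smul_eq {j n : ℕ} {a b : ℕ → E [⋀^Fin j]→L[ℝ] ℝ}
    (h : ∀ t : ℝ, ∑ q ∈ Finset.range n, t ^ q • a q = ∑ q ∈ Finset.range n, t ^ q • b q)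
    {q : ℕ} (hq : q < n) : a q = b q := by
  ext v
  have h1 : (∑ q ∈ Finset.range n, Polynomial.C (a q v) * Polynomial.X ^ q) =
      ∑ q ∈ Finset.range n, Polynomial.C (b q v) * Polynomial.X ^ q := by
    refine Polynomial.funext fun t => ?_
    have := congrArg (fun c : E [⋀^Fin j]→L[ℝ] ℝ => c v) (h t)
    simp only [ContinuousAlternatingMap.sum_apply, ContinuousAlternatingMap.smul_apply,
      smul_eq_mul] at this
    simp only [Polynomial.eval_finsetSum, Polynomial.eval_mul, Polynomial.eval_C,
      Polynomial.eval_pow, Polynomial.eval_X]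
    simpa only [mul_comm] using this
  have h2 := congrArg (fun p : Polynomial ℝ => p.coeff q) h1
  simp only [Polynomial.finsetSum_coeff, Polynomial.coeff_C_mul_X_pow, Finset.sum_ite_eq,
    Finset.mem_range, if_pos hq] at h2
  exact h2

/-- As V is a projection, (H + sV)(H + tV) = H + stV. Comparing coefficients of s^p in the resulting
identity of generating functions gives the claim. -/
theorem compContinuousLinearMap_verticalPart {V : E →L[ℝ] E} (hV : V.comp V = V) {j p : ℕ}
    (hp : p ≤ j) (b : E [⋀^Fin j]→L[ℝ] ℝ) (t : ℝ) :
    (verticalPart V p b).compContinuousLinearMap (ContinuousLinearMap.id ℝ E - V + t • V) =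
      t ^ p • verticalPart V p b := by
  have hV' : ∀ u, V (V u) = V u := fun u => congrArg (fun T : E →L[ℝ] E => T u) hV
  refine eq_of_sum_pow_smul_eq (n := j + 1)
    (a := fun p => (verticalPart V p b).compContinuousLinearMap
      (ContinuousLinearMap.id ℝ E - V + t • V))
    (b := fun p => t ^ p • verticalPart V p b) (fun s => ?_) (Nat.lt_succ_of_le hp)
  have h1 : (b.compContinuousLinearMap (ContinuousLinearMap.id ℝ E - V + s • V)
      ).compContinuousLinearMap (ContinuousLinearMap.id ℝ E - V + t • V) =
      b.compContinuousLinearMap (ContinuousLinearMap.id ℝ E - V + (s * t) • V) := by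
    ext v
    simp only [compContinuousLinearMap_apply]
    congr 1
    funext i
    simp only [Function.comp_apply, _root_.add_apply, _root_.sub_apply,
      _root_.smul_apply, ContinuousLinearMap.id_apply, map_add, map_sub, map_smul, hV',
      mul_smul, smul_sub, smul_add]
    rw [smul_comm t s]
    simp
  rw [compContinuousLinearMap_eq_sum_verticalPart V b s,
    compContinuousLinearMap_eq_sum_verticalPart V b (s * t)] at h1
  simp only [mul_pow, mul_smul] at h1
  rw [← h1]
  ext v
  simp [ContinuousAlternatingMap.sum_apply]

/-- Differentiating the homogeneity relation of `compContinuousLinearMap_verticalPart` at t = 1,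
where H + tV is the identity, turns t^p into the factor p. -/
theorem fderivCompContinuousLinearMap_verticalPart {V : E →L[ℝ] E} (hV : V.comp V = V) {j p : ℕ}
    (hp : p ≤ j) (b : E [⋀^Fin j]→L[ℝ] ℝ) :
    (verticalPart V p b).fderivCompContinuousLinearMap (.id ℝ E) V =
      (p : ℝ) • verticalPart V p b := by
  set c := verticalPart V p b with hc
  have h1 : HasDerivAt (fun t : ℝ => ContinuousLinearMap.id ℝ E - V + t • V) V 1 := by
    simpa using ((hasDerivAt_id (1 : ℝ)).smul_const V).const_add (ContinuousLinearMap.id ℝ E - V)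
  have h2 := (HasFDerivAt.continuousAlternatingMapCompContinuousLinearMap
    (hasFDerivAt_const c (1 : ℝ)) h1.hasFDerivAt).hasDerivAt
  have h3 : HasDerivAt (fun t : ℝ => t ^ p • c) ((p : ℝ) • c) 1 := by
    simpa using (hasDerivAt_pow p (1 : ℝ)).smul_const c
  have h4 : (fun t : ℝ => c.compContinuousLinearMap (ContinuousLinearMap.id ℝ E - V + t • V)) =
      fun t => t ^ p • c := funext fun t => compContinuousLinearMap_verticalPart hV hp b t
  rw [h4] at h2
  have h5 := h2.unique h3
  rw [← h5]
  simp

/-- A vertical X satisfies (H + tV) X = tX, so inserting it multiplies the generating function by t.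
Vertical degree therefore drops by one, and the part of degree zero is annihilated. -/
theorem curryLeft_verticalPart {V : E →L[ℝ] E} {j : ℕ} (b : E [⋀^Fin (j + 1)]→L[ℝ] ℝ) {X : E}
    (hX : V X = X) : (verticalPart V 0 b).curryLeft X = 0 ∧
      ∀ q ≤ j, (verticalPart V (q + 1) b).curryLeft X = verticalPart V q (b.curryLeft X) := by
  -- The case distinction packs both claims into one coefficient sequence, shifted by one with a
  -- zero in front.
  have h : ∀ q < j + 2, (verticalPart V q b).curryLeft X =
      (fun q => Nat.casesOn q 0 fun q => verticalPart V q (b.curryLeft X) :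
        ℕ → E [⋀^Fin j]→L[ℝ] ℝ) q := by
    intro q hq
    refine eq_of_sum_pow_smul_eq (n := j + 2) (a := fun q => (verticalPart V q b).curryLeft X)
      (fun t => ?_) hq
    have h1 := congrArg (fun c => c.curryLeft X) (compContinuousLinearMap_eq_sum_verticalPart V b t)
    rw [curryLeft_compContinuousLinearMap,
      show (ContinuousLinearMap.id ℝ E - V + t • V) X = t • X by simp [hX], map_smul,
      show (t • b.curryLeft X).compContinuousLinearMap (ContinuousLinearMap.id ℝ E - V + t • V) =
        t • (b.curryLeft X).compContinuousLinearMap (ContinuousLinearMap.id ℝ E - V + t • V) from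
        rfl, compContinuousLinearMap_eq_sum_verticalPart] at h1
    have h2 : ∑ q ∈ Finset.range (j + 1), t ^ (q + 1) • verticalPart V q (b.curryLeft X) =
        t • ∑ q ∈ Finset.range (j + 1), t ^ q • verticalPart V q (b.curryLeft X) := by
      rw [Finset.smul_sum]
      exact Finset.sum_congr rfl fun q _ => by rw [smul_smul, pow_succ']
    have h3 : ∑ q ∈ Finset.range (j + 1), t ^ (q + 1) • verticalPart V q (b.curryLeft X) +
        t ^ 0 • (0 : E [⋀^Fin j]→L[ℝ] ℝ) =
        t • ∑ q ∈ Finset.range (j + 1), t ^ q • verticalPart V q (b.curryLeft X) := by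
      rw [smul_zero, add_zero, h2]
    refine Eq.trans ?_ ((Finset.sum_range_succ' _ (j + 1)).trans h3).symm
    rw [h1]
    ext v
    simp [ContinuousAlternatingMap.sum_apply]
  exact ⟨h 0 (by omega), fun q hq => h (q + 1) (by omega)⟩

/-- The operator which divides the part of vertical degree `q` by `i + q`. -/
noncomputable def divDegree (V : E →L[ℝ] E) (i : ℕ) {j : ℕ} :
    (E [⋀^Fin j]→L[ℝ] ℝ) →ₗ[ℝ] (E [⋀^Fin j]→L[ℝ] ℝ) where
  toFun b := ∑ q ∈ Finset.range (j + 1), ((i : ℝ) + (q : ℝ))⁻¹ • verticalPart V q b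
  map_add' b c := by simp [verticalPart_add, Finset.sum_add_distrib]
  map_smul' r b := by
    simp only [verticalPart_smul, Finset.smul_sum, RingHom.id_apply]
    exact Finset.sum_congr rfl fun q _ => smul_comm _ _ _

theorem divDegree_apply (V : E →L[ℝ] E) (i : ℕ) {j : ℕ} (b : E [⋀^Fin j]→L[ℝ] ℝ) :
    divDegree V i b =
      ∑ q ∈ Finset.range (j + 1), ((i : ℝ) + (q : ℝ))⁻¹ • verticalPart V q b := rfl

theorem divDegree_compContinuousLinearMap (V : F →L[ℝ] F) (W : E →L[ℝ] E) (A : E →L[ℝ] F)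
    (h : V.comp A = A.comp W) (i : ℕ) {j : ℕ} (b : F [⋀^Fin j]→L[ℝ] ℝ) :
    (divDegree V i b).compContinuousLinearMap A = divDegree W i (b.compContinuousLinearMap A) := by
  simp only [divDegree_apply, ← verticalPart_compContinuousLinearMap V W A h]
  ext v
  simp [ContinuousAlternatingMap.sum_apply]

/-- On the part of vertical degree q the left side is multiplication by (i + 1) + q following
division by the same number. This is the arithmetic behind the contraction identity. -/
theorem smul_add_fderivCompContinuousLinearMap_divDegree {V : E →L[ℝ] E} (hV : V.comp V = V)
    (i : ℕ) {j : ℕ} (b : E [⋀^Fin j]→L[ℝ] ℝ) :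
    ((i : ℝ) + 1) • divDegree V (i + 1) b +
      (divDegree V (i + 1) b).fderivCompContinuousLinearMap (.id ℝ E) V = b := by
  -- The generating function at t = 1 writes b as the sum of its components.
  have h1 : b = ∑ q ∈ Finset.range (j + 1), verticalPart V q b := by
    have := compContinuousLinearMap_eq_sum_verticalPart V b 1
    simp only [one_smul, sub_add_cancel, one_pow] at this
    rw [← this]
    ext v
    simp
  have h2 : (divDegree V (i + 1) b).fderivCompContinuousLinearMap (.id ℝ E) V =
      ∑ q ∈ Finset.range (j + 1), (((i + 1 : ℕ) : ℝ) + (q : ℝ))⁻¹ •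
        (verticalPart V q b).fderivCompContinuousLinearMap (.id ℝ E) V := by
    rw [divDegree_apply]
    change fderivCompContinuousLinearMapCLM ℝ (.id ℝ E) _ V = _
    rw [_root_.map_sum, _root_.sum_apply]
    exact Finset.sum_congr rfl fun q _ => by rw [map_smul]; rfl
  rw [h2, divDegree_apply, Finset.smul_sum, ← Finset.sum_add_distrib]
  conv_rhs => rw [h1]
  refine Finset.sum_congr rfl fun q hq => ?_
  rw [fderivCompContinuousLinearMap_verticalPart hV (by simpa [Nat.lt_succ_iff] using hq),
    smul_smul, smul_smul, ← add_smul]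
  push_cast
  rw [show ((i : ℝ) + 1) * ((i : ℝ) + 1 + q)⁻¹ + ((i : ℝ) + 1 + q)⁻¹ * q = 1 by
    field_simp, one_smul]

/-- Insertion of a vertical vector lowers q by one while the symmetric index rises by one, so the
divisor i + q is unchanged. The possible term with divisor zero does not matter, since its component
has vertical degree zero and is annihilated by the insertion. -/
theorem curryLeft_divDegree {V : E →L[ℝ] E} (i : ℕ) {j : ℕ} (b : E [⋀^Fin (j + 1)]→L[ℝ] ℝ) {X : E}
    (hX : V X = X) :
    (divDegree V i b).curryLeft X = divDegree V (i + 1) (b.curryLeft X) := by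
  obtain ⟨h0, h1⟩ := curryLeft_verticalPart b hX
  rw [divDegree_apply, divDegree_apply, Finset.sum_range_succ']
  rw [← curryLeftAt_apply, _root_.map_add, _root_.map_sum]
  simp only [_root_.map_smul, curryLeftAt_apply, h0, smul_zero, add_zero]
  refine Finset.sum_congr rfl fun q hq => ?_
  rw [h1 q (by simpa [Nat.lt_succ_iff] using hq)]
  push_cast
  rw [add_right_comm, add_assoc]

theorem _root_.ContDiffAt.verticalPart {X : Type*} [NormedAddCommGroup X] [NormedSpace ℝ X]
    {n : WithTop ℕ∞} [FiniteDimensional ℝ E] {j : ℕ} (q : ℕ) {V : X → E →L[ℝ] E}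
    {β : X → E [⋀^Fin j]→L[ℝ] ℝ} {x : X} (hV : ContDiffAt ℝ n V x) (hβ : ContDiffAt ℝ n β x) :
    ContDiffAt ℝ n (fun y => verticalPart (V y) q (β y)) x := by
  refine contDiffAt_continuousAlternatingMap_iff.2 fun v => ?_
  simp only [verticalPart_apply]
  refine contDiffAt_const.mul (ContDiffAt.sum fun σ _ => ?_)
  refine ContDiffAt.const_smul _ ?_
  refine hβ.continuousAlternatingMap_apply (w := fun y s =>
    (if (s : ℕ) < q then V y else ContinuousLinearMap.id ℝ E - V y) (v (σ s))) fun s => ?_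
  split_ifs
  · exact hV.clm_apply contDiffAt_const
  · exact (contDiffAt_const.sub hV).clm_apply contDiffAt_const

theorem _root_.ContDiffAt.divDegree {X : Type*} [NormedAddCommGroup X] [NormedSpace ℝ X]
    {n : WithTop ℕ∞} [FiniteDimensional ℝ E] (i : ℕ) {j : ℕ} {V : X → E →L[ℝ] E}
    {β : X → E [⋀^Fin j]→L[ℝ] ℝ} {x : X} (hV : ContDiffAt ℝ n V x) (hβ : ContDiffAt ℝ n β x) :
    ContDiffAt ℝ n (fun y => divDegree (V y) i (β y)) x := by
  simp only [divDegree_apply]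
  exact ContDiffAt.sum fun q _ => ContDiffAt.const_smul _ (hV.verticalPart q hβ)

end VerticalDegree

/-! ## Tangent maps and charts -/

section Tangent

variable {E E' E'' : Type*} [NormedAddCommGroup E] [NormedSpace ℝ E]
  [NormedAddCommGroup E'] [NormedSpace ℝ E'] [NormedAddCommGroup E''] [NormedSpace ℝ E'']
  {M : Type*} [TopologicalSpace M] [ChartedSpace E M]
  {N : Type*} [TopologicalSpace N] [ChartedSpace E' N]
  {P : Type*} [TopologicalSpace P] [ChartedSpace E'' P]

theorem tmap_comp {g : N → P} {f : M → N} {x : M}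
    (hg : MDifferentiableAt 𝓘(ℝ, E') 𝓘(ℝ, E'') g (f x))
    (hf : MDifferentiableAt 𝓘(ℝ, E) 𝓘(ℝ, E') f x) :
    tmap E E'' (fun y => g (f y)) x = (tmap E' E'' g (f x)).comp (tmap E E' f x) :=
  mfderiv_comp x hg hf

theorem tmap_id (x : M) : tmap E E (fun y : M => y) x = ContinuousLinearMap.id ℝ E :=
  mfderiv_id

theorem tmap_congr {f g : M → N} {x : M} (h : f =ᶠ[𝓝 x] g) : tmap E E' f x = tmap E E' g x :=
  h.mfderiv_eq

theorem tmap_eq_fderiv (f : E → E') (x : E) : tmap E E' f x = fderiv ℝ f x := mfderiv_eq_fderiv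

theorem tmap_const (x : M) (y : N) : tmap E E' (fun _ : M => y) x = 0 := mfderiv_const

theorem contMDiffAt_chart [IsManifold 𝓘(ℝ, E) ∞ M] {x₀ x : M}
    (hx : x ∈ (extChartAt 𝓘(ℝ, E) x₀).source) :
    ContMDiffAt 𝓘(ℝ, E) 𝓘(ℝ, E) ∞ (extChartAt 𝓘(ℝ, E) x₀) x :=
  contMDiffAt_extChartAt' (by rwa [extChartAt_source] at hx)

theorem contMDiffAt_chart_symm [IsManifold 𝓘(ℝ, E) ∞ M] {x₀ : M} {y : E}
    (hy : y ∈ (extChartAt 𝓘(ℝ, E) x₀).target) :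
    ContMDiffAt 𝓘(ℝ, E) 𝓘(ℝ, E) ∞ (extChartAt 𝓘(ℝ, E) x₀).symm y :=
  (contMDiffOn_extChartAt_symm x₀).contMDiffAt (extChartAt_target_mem_nhds' hy)

theorem _root_.ContMDiffAt.mdiff {f : M → N} {x : M}
    (hf : ContMDiffAt 𝓘(ℝ, E) 𝓘(ℝ, E') ∞ f x) : MDifferentiableAt 𝓘(ℝ, E) 𝓘(ℝ, E') f x :=
  hf.mdifferentiableAt (by simp)

theorem _root_.ContMDiffAt.eventually_mdiff [IsManifold 𝓘(ℝ, E) ∞ M] [IsManifold 𝓘(ℝ, E') ∞ N]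
    {f : M → N} {x : M} (hf : ContMDiffAt 𝓘(ℝ, E) 𝓘(ℝ, E') ∞ f x) :
    ∀ᶠ y in 𝓝 x, MDifferentiableAt 𝓘(ℝ, E) 𝓘(ℝ, E') f y := by
  have : IsManifold 𝓘(ℝ, E) 1 M := .of_le (n := ∞) (by simp)
  have : IsManifold 𝓘(ℝ, E') 1 N := .of_le (n := ∞) (by simp)
  have h1 : ContMDiffAt 𝓘(ℝ, E) 𝓘(ℝ, E') 1 f x := hf.of_le (by simp)
  exact ((contMDiffAt_iff_contMDiffAt_nhds (by simp)).1 h1).mono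
    fun y hy => hy.mdifferentiableAt (by simp)

theorem tmap_chart_symm_comp [IsManifold 𝓘(ℝ, E) ∞ M] {x₀ x : M}
    (hx : x ∈ (extChartAt 𝓘(ℝ, E) x₀).source) :
    (tmap E E (extChartAt 𝓘(ℝ, E) x₀).symm (extChartAt 𝓘(ℝ, E) x₀ x)).comp
      (tmap E E (extChartAt 𝓘(ℝ, E) x₀) x) = ContinuousLinearMap.id ℝ E := by
  rw [← tmap_comp (contMDiffAt_chart_symm ((extChartAt 𝓘(ℝ, E) x₀).map_source hx)).mdiff
    (contMDiffAt_chart hx).mdiff, ← tmap_id (E := E) x]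
  refine tmap_congr ?_
  filter_upwards [extChartAt_source_mem_nhds' hx] with y hy
  exact (extChartAt 𝓘(ℝ, E) x₀).left_inv hy

theorem tmap_chart_self [IsManifold 𝓘(ℝ, E) ∞ M] (x : M) :
    tmap E E (extChartAt 𝓘(ℝ, E) x) x = ContinuousLinearMap.id ℝ E := by
  have : IsManifold 𝓘(ℝ, E) 1 M := .of_le (n := ∞) (by simp)
  exact mfderiv_extChartAt_self

theorem tmap_chart_symm_self [IsManifold 𝓘(ℝ, E) ∞ M] (x : M) :
    tmap E E (extChartAt 𝓘(ℝ, E) x).symm (extChartAt 𝓘(ℝ, E) x x) = ContinuousLinearMap.id ℝ E := by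
  have := tmap_chart_symm_comp (mem_extChartAt_source (I := 𝓘(ℝ, E)) x)
  rwa [tmap_chart_self, ContinuousLinearMap.comp_id] at this

/-- The representation of `f` in the preferred charts at `x₀` and `y₀`. -/
noncomputable def localRep (E E' : Type*) [NormedAddCommGroup E] [NormedSpace ℝ E]
    [NormedAddCommGroup E'] [NormedSpace ℝ E']
    {M : Type*} [TopologicalSpace M] [ChartedSpace E M]
    {N : Type*} [TopologicalSpace N] [ChartedSpace E' N] (f : M → N) (x₀ : M) (y₀ : N) : E → E' :=
  fun z => extChartAt 𝓘(ℝ, E') y₀ (f ((extChartAt 𝓘(ℝ, E) x₀).symm z))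

theorem contDiffAt_localRep [IsManifold 𝓘(ℝ, E) ∞ M] [IsManifold 𝓘(ℝ, E') ∞ N] {f : M → N}
    {x₀ : M} {y₀ : N} {z : E} (hz : z ∈ (extChartAt 𝓘(ℝ, E) x₀).target)
    (hy : f ((extChartAt 𝓘(ℝ, E) x₀).symm z) ∈ (extChartAt 𝓘(ℝ, E') y₀).source)
    (hf : ContMDiffAt 𝓘(ℝ, E) 𝓘(ℝ, E') ∞ f ((extChartAt 𝓘(ℝ, E) x₀).symm z)) :
    ContDiffAt ℝ ∞ (localRep E E' f x₀ y₀) z :=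
  contMDiffAt_iff_contDiffAt.1
    (((contMDiffAt_chart hy).comp _ hf).comp z (contMDiffAt_chart_symm hz))

theorem fderiv_localRep [IsManifold 𝓘(ℝ, E) ∞ M] [IsManifold 𝓘(ℝ, E') ∞ N] {f : M → N}
    {x₀ : M} {y₀ : N} {z : E} (hz : z ∈ (extChartAt 𝓘(ℝ, E) x₀).target)
    (hy : f ((extChartAt 𝓘(ℝ, E) x₀).symm z) ∈ (extChartAt 𝓘(ℝ, E') y₀).source)
    (hf : MDifferentiableAt 𝓘(ℝ, E) 𝓘(ℝ, E') f ((extChartAt 𝓘(ℝ, E) x₀).symm z)) :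
    fderiv ℝ (localRep E E' f x₀ y₀) z =
      (tmap E' E' (extChartAt 𝓘(ℝ, E') y₀) (f ((extChartAt 𝓘(ℝ, E) x₀).symm z))).comp
        ((tmap E E' f ((extChartAt 𝓘(ℝ, E) x₀).symm z)).comp
          (tmap E E (extChartAt 𝓘(ℝ, E) x₀).symm z)) := by
  rw [← tmap_comp hf (contMDiffAt_chart_symm hz).mdiff, ← tmap_eq_fderiv,
    ← tmap_comp (f := fun z => f ((extChartAt 𝓘(ℝ, E) x₀).symm z)) (contMDiffAt_chart hy).mdiff
    (hf.comp z (contMDiffAt_chart_symm hz).mdiff)]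
  rfl

end Tangent

/-! ## Smooth forms and the exterior derivative -/

section Forms

variable {E E' E'' : Type*} [NormedAddCommGroup E] [NormedSpace ℝ E] [FiniteDimensional ℝ E]
  [NormedAddCommGroup E'] [NormedSpace ℝ E'] [FiniteDimensional ℝ E']
  [NormedAddCommGroup E''] [NormedSpace ℝ E'']
  {M : Type*} [TopologicalSpace M] [ChartedSpace E M]
  {N : Type*} [TopologicalSpace N] [ChartedSpace E' N]
  {P : Type*} [TopologicalSpace P] [ChartedSpace E'' P]

theorem minSmoothness_two_le : minSmoothness ℝ 2 ≤ (∞ : WithTop ℕ∞) := by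
  simp only [minSmoothness_of_isRCLikeNormedField]
  exact ENat.LEInfty.out

theorem pullback_pullback_apply {g : N → P} {f : M → N} {x : M}
    (hg : MDifferentiableAt 𝓘(ℝ, E') 𝓘(ℝ, E'') g (f x))
    (hf : MDifferentiableAt 𝓘(ℝ, E) 𝓘(ℝ, E') f x) {k : ℕ} (β : FormField E'' P k) :
    pullback (E := E) f (pullback (E := E') g β) x = pullback (fun y => g (f y)) β x := by
  simp only [pullback, tmap_comp hg hf]
  rfl

/-- Near z all the points involved stay inside the two charts, so the transition factors cancel and
pullback on manifolds becomes pullback along the coordinate representation of f. Statements about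
forms thereby reduce to calculus in normed spaces. -/
theorem eventually_chartRep_pullback [IsManifold 𝓘(ℝ, E) ∞ M] [IsManifold 𝓘(ℝ, E') ∞ N]
    {f : M → N} {x₀ : M} {y₀ : N} {z : E} (hz : z ∈ (extChartAt 𝓘(ℝ, E) x₀).target)
    (hy : f ((extChartAt 𝓘(ℝ, E) x₀).symm z) ∈ (extChartAt 𝓘(ℝ, E') y₀).source)
    (hf : ContMDiffAt 𝓘(ℝ, E) 𝓘(ℝ, E') ∞ f ((extChartAt 𝓘(ℝ, E) x₀).symm z)) {k : ℕ}
    (β : FormField E' N k) :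
    chartRep (pullback f β) x₀ =ᶠ[𝓝 z] fun w =>
      (chartRep β y₀ (localRep E E' f x₀ y₀ w)).compContinuousLinearMap
        (fderiv ℝ (localRep E E' f x₀ y₀) w) := by
  have hc := (contMDiffAt_chart_symm hz).continuousAt
  filter_upwards [hc.eventually hf.eventually_mdiff, extChartAt_target_mem_nhds' hz,
    hc.eventually (hf.continuousAt.eventually (extChartAt_source_mem_nhds' hy))] with w h1 h2 h3
  rw [fderiv_localRep h2 h3 h1]
  simp only [chartRep, pullback, localRep]
  rw [(extChartAt 𝓘(ℝ, E') y₀).left_inv h3]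
  ext v
  simp only [compContinuousLinearMap_apply]
  congr 1
  funext i
  have := congrArg (fun T : E' →L[ℝ] E' => T (tmap E E' f ((extChartAt 𝓘(ℝ, E) x₀).symm w)
    (tmap E E (extChartAt 𝓘(ℝ, E) x₀).symm w (v i)))) (tmap_chart_symm_comp h3)
  simpa using this.symm

/-- Smoothness of a form at a point. -/
def IsSmoothFormAt {k : ℕ} (β : FormField E M k) (x : M) : Prop :=
  ContDiffAt ℝ ∞ (chartRep β x) (extChartAt 𝓘(ℝ, E) x x)

theorem contDiffAt_chartRep_pullback [IsManifold 𝓘(ℝ, E) ∞ M] [IsManifold 𝓘(ℝ, E') ∞ N]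
    {f : M → N} {x₀ : M} {y₀ : N} {z : E} (hz : z ∈ (extChartAt 𝓘(ℝ, E) x₀).target)
    (hy : f ((extChartAt 𝓘(ℝ, E) x₀).symm z) ∈ (extChartAt 𝓘(ℝ, E') y₀).source)
    (hf : ContMDiffAt 𝓘(ℝ, E) 𝓘(ℝ, E') ∞ f ((extChartAt 𝓘(ℝ, E) x₀).symm z)) {k : ℕ}
    {β : FormField E' N k} (hβ : ContDiffAt ℝ ∞ (chartRep β y₀) (localRep E E' f x₀ y₀ z)) :
    ContDiffAt ℝ ∞ (chartRep (pullback f β) x₀) z := by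
  refine ContDiffAt.congr_of_eventuallyEq ?_ (eventually_chartRep_pullback hz hy hf β)
  have h := contDiffAt_localRep hz hy hf
  exact (hβ.comp z h).compContinuousAlternatingMap_clm (h.fderiv_right (m := ∞) (by simp))

theorem isSmoothFormAt_pullback [IsManifold 𝓘(ℝ, E) ∞ M] [IsManifold 𝓘(ℝ, E') ∞ N]
    {f : M → N} {x : M} (hf : ContMDiffAt 𝓘(ℝ, E) 𝓘(ℝ, E') ∞ f x) {k : ℕ}
    {β : FormField E' N k} (hβ : IsSmoothFormAt β (f x)) :
    IsSmoothFormAt (E := E) (pullback f β) x := by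
  have hx : (extChartAt 𝓘(ℝ, E) x).symm (extChartAt 𝓘(ℝ, E) x x) = x := extChartAt_to_inv x
  refine contDiffAt_chartRep_pullback (y₀ := f x) (mem_extChartAt_target x) ?_ ?_ ?_
  · rw [hx]; exact mem_extChartAt_source _
  · rwa [hx]
  · rw [localRep, hx]; exact hβ

theorem pullback_id {k : ℕ} (β : FormField E M k) : pullback (fun x : M => x) β = β := by
  funext x
  rw [pullback, tmap_id]
  ext v
  simp

/-- Chart independence of smoothness: β is its own pullback under the identity, read in two
different charts. -/
theorem isSmoothFormAt_iff [IsManifold 𝓘(ℝ, E) ∞ M] {k : ℕ} {β : FormField E M k} {x₀ : M} {z : E}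
    (hz : z ∈ (extChartAt 𝓘(ℝ, E) x₀).target) :
    IsSmoothFormAt β ((extChartAt 𝓘(ℝ, E) x₀).symm z) ↔ ContDiffAt ℝ ∞ (chartRep β x₀) z := by
  set x := (extChartAt 𝓘(ℝ, E) x₀).symm z with hx
  have hxs : x ∈ (extChartAt 𝓘(ℝ, E) x₀).source := (extChartAt 𝓘(ℝ, E) x₀).map_target hz
  constructor
  · intro h
    rw [← pullback_id β]
    refine contDiffAt_chartRep_pullback (y₀ := x) hz (mem_extChartAt_source x) contMDiffAt_id h
  · intro h
    rw [← pullback_id β]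
    have h1 : (extChartAt 𝓘(ℝ, E) x).symm (extChartAt 𝓘(ℝ, E) x x) = x := extChartAt_to_inv x
    refine contDiffAt_chartRep_pullback (y₀ := x₀) (mem_extChartAt_target x) ?_ contMDiffAt_id ?_
    · rwa [h1]
    · rw [localRep, h1, id_eq, hx, (extChartAt 𝓘(ℝ, E) x₀).right_inv hz]
      exact h

theorem isSmoothForm_iff [IsManifold 𝓘(ℝ, E) ∞ M] {k : ℕ} {β : FormField E M k} :
    IsSmoothForm β ↔ ∀ x, IsSmoothFormAt β x := by
  refine ⟨fun h x => (h x).contDiffAt (extChartAt_target_mem_nhds x), fun h x₀ z hz => ?_⟩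
  exact ((isSmoothFormAt_iff hz).1 (h _)).contDiffWithinAt

theorem IsSmoothForm.pullback [IsManifold 𝓘(ℝ, E) ∞ M] [IsManifold 𝓘(ℝ, E') ∞ N]
    {f : M → N} (hf : ContMDiff 𝓘(ℝ, E) 𝓘(ℝ, E') ∞ f) {k : ℕ}
    {β : FormField E' N k} (hβ : IsSmoothForm β) : IsSmoothForm (pullback f β : FormField E M k) :=
  isSmoothForm_iff.2 fun x => isSmoothFormAt_pullback (hf x) (isSmoothForm_iff.1 hβ _)

theorem isSmoothFormAt_congr {k : ℕ} {β γ : FormField E M k} {x : M}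
    (h : ∀ᶠ y in 𝓝 x, β y = γ y) (hβ : IsSmoothFormAt β x) : IsSmoothFormAt γ x := by
  refine ContDiffAt.congr_of_eventuallyEq hβ ?_
  have hc : Filter.Tendsto (extChartAt 𝓘(ℝ, E) x).symm (𝓝 (extChartAt 𝓘(ℝ, E) x x)) (𝓝 x) := by
    have := continuousAt_extChartAt_symm (I := 𝓘(ℝ, E)) x
    rwa [ContinuousAt, extChartAt_to_inv] at this
  filter_upwards [hc.eventually h] with z hz
  simp only [chartRep, Kirwan.pullback, hz]

/-- In charts this is naturality of the exterior derivative in a normed space. The preferred charts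
at x and f x have identity derivative at these points, so no correction remains. -/
theorem extD_pullback [IsManifold 𝓘(ℝ, E) ∞ M] [IsManifold 𝓘(ℝ, E') ∞ N]
    {f : M → N} {x : M} (hf : ContMDiffAt 𝓘(ℝ, E) 𝓘(ℝ, E') ∞ f x) {k : ℕ}
    {β : FormField E' N k} (hβ : IsSmoothFormAt β (f x)) :
    extD (pullback (E := E) f β) x = pullback (E := E) f (extD β) x := by
  have hx : (extChartAt 𝓘(ℝ, E) x).symm (extChartAt 𝓘(ℝ, E) x x) = x := extChartAt_to_inv x
  have hz := mem_extChartAt_target (I := 𝓘(ℝ, E)) x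
  have hy : f ((extChartAt 𝓘(ℝ, E) x).symm (extChartAt 𝓘(ℝ, E) x x)) ∈
      (extChartAt 𝓘(ℝ, E') (f x)).source := by rw [hx]; exact mem_extChartAt_source _
  have hf' : ContMDiffAt 𝓘(ℝ, E) 𝓘(ℝ, E') ∞ f
      ((extChartAt 𝓘(ℝ, E) x).symm (extChartAt 𝓘(ℝ, E) x x)) := by rwa [hx]
  have hF : localRep E E' f x (f x) (extChartAt 𝓘(ℝ, E) x x) = extChartAt 𝓘(ℝ, E') (f x) (f x) := by
    rw [localRep, hx]
  rw [extD, (eventually_chartRep_pullback hz hy hf' β).extDeriv_eq,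
    extDeriv_pullback (r := ∞) (by rw [hF]; exact ContDiffAt.differentiableAt hβ (by simp))
      (contDiffAt_localRep hz hy hf') minSmoothness_two_le, fderiv_localRep hz hy hf'.mdiff, hF, hx,
    tmap_chart_symm_self, tmap_chart_self]
  rfl

/-- `extD` uses a different chart at every point. Naturality along the inverse of one fixed chart
shows that a single chart computes it throughout the chart domain, as differentiating it again
requires. -/
theorem chartRep_extD [IsManifold 𝓘(ℝ, E) ∞ M] {k : ℕ} {β : FormField E M k} (hβ : IsSmoothForm β)
    {x₀ : M} {z : E} (hz : z ∈ (extChartAt 𝓘(ℝ, E) x₀).target) :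
    chartRep (extD β) x₀ z = extDeriv (chartRep β x₀) z := by
  have h := extD_pullback (contMDiffAt_chart_symm hz) (isSmoothForm_iff.1 hβ _)
  rw [chartRep, ← h]
  have h2 : chartRep (chartRep β x₀ : FormField E E k) z = chartRep β x₀ := by
    rw [chartRep]
    exact pullback_id _
  change extDeriv (chartRep (chartRep β x₀ : FormField E E k) z) _ = _
  rw [h2]
  rfl

theorem IsSmoothForm.extD [IsManifold 𝓘(ℝ, E) ∞ M] {k : ℕ} {β : FormField E M k}
    (hβ : IsSmoothForm β) : IsSmoothForm (extD β) := by
  intro x₀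
  refine ContDiffOn.congr (f := extDeriv (chartRep β x₀)) ?_ fun z hz => chartRep_extD hβ hz
  intro z hz
  have h := (hβ x₀).contDiffAt (extChartAt_target_mem_nhds' hz)
  let L : (E →L[ℝ] E [⋀^Fin k]→L[ℝ] ℝ) →L[ℝ] (E [⋀^Fin (k + 1)]→L[ℝ] ℝ) :=
    alternatizeUncurryFinCLM ℝ E ℝ
  have hL : ContDiff ℝ ∞ L := by fun_prop
  exact (hL.contDiffAt.comp z (h.fderiv_right (m := ∞) (by simp))).contDiffWithinAt

theorem extD_extD [IsManifold 𝓘(ℝ, E) ∞ M] {k : ℕ} {β : FormField E M k}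
    (hβ : IsSmoothForm β) : extD (extD β) = 0 := by
  funext x
  have h : chartRep (extD β) x =ᶠ[𝓝 (extChartAt 𝓘(ℝ, E) x x)] extDeriv (chartRep β x) := by
    filter_upwards [extChartAt_target_mem_nhds (I := 𝓘(ℝ, E)) x] with z hz
    exact chartRep_extD hβ hz
  rw [Kirwan.extD, h.extDeriv_eq, extDeriv_extDeriv_apply (r := ∞)
    (isSmoothForm_iff.1 hβ x) minSmoothness_two_le]
  rfl

end Forms

/-! ## Calculus in a normed space -/

section FlatCalculus

variable {E : Type*} [NormedAddCommGroup E] [NormedSpace ℝ E] {W : Type*} [NormedAddCommGroup W]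
  [NormedSpace ℝ W]

theorem isSymmSndFDerivAt_of_contDiffAt_infty {f : W → E} {x : W} (hf : ContDiffAt ℝ ∞ f x) :
    IsSymmSndFDerivAt ℝ f x :=
  hf.isSymmSndFDerivAt minSmoothness_two_le

theorem _root_.ContDiffAt.hasFDerivAt_fderiv {f : W → E} {x : W} (hf : ContDiffAt ℝ ∞ f x) :
    HasFDerivAt (fderiv ℝ f) (fderiv ℝ (fderiv ℝ f) x) x :=
  ((hf.fderiv_right (m := ∞) (by simp)).differentiableAt (by simp)).hasFDerivAt

theorem _root_.ContDiffAt.eventually_differentiableAt {f : W → E} {x : W}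
    (hf : ContDiffAt ℝ ∞ f x) : ∀ᶠ y in 𝓝 x, DifferentiableAt ℝ f y := by
  have h1 : ContDiffAt ℝ 1 f x := hf.of_le (by simp)
  exact (h1.eventually (by simp)).mono fun y hy => hy.differentiableAt (by simp)

/-- If `c (u, v)` is conjugation of `v` by the inverse of `u` for a multiplication `m` with unit
`p`, then the derivative of the linearization of `c (u, ·)` at `p` in the direction `ξ`, applied to
`ξ`, vanishes. -/
theorem hasDerivAt_conj_eq_zero {m c : E × E → E} {p ξ : E} (hm : ContDiffAt ℝ ∞ m (p, p))
    (hc : ContDiffAt ℝ ∞ c (p, p)) (hmc : ∀ᶠ q in 𝓝 (p, p), m (q.1, c q) = m (q.2, q.1))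
    (hm1 : ∀ᶠ v in 𝓝 p, m (p, v) = v) (hc1 : ∀ᶠ u in 𝓝 p, c (u, p) = p)
    (hc2 : ∀ᶠ v in 𝓝 p, c (p, v) = v) :
    HasDerivAt (fun t : ℝ => fderiv ℝ c (p + t • ξ, p) (0, ξ)) 0 0 := by
  have hline : HasDerivAt (fun t : ℝ => p + t • ξ) ξ 0 := by
    simpa using ((hasDerivAt_id (0 : ℝ)).smul_const ξ).const_add p
  have hl0 : p + (0 : ℝ) • ξ = p := by simp
  have ht : Filter.Tendsto (fun t : ℝ => p + t • ξ) (𝓝 0) (𝓝 p) := by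
    have := hline.continuousAt.tendsto
    rwa [hl0] at this
  have ha1 : HasDerivAt (fun t : ℝ => fderiv ℝ c (p + t • ξ, p) (0, ξ))
      (fderiv ℝ (fderiv ℝ c) (p, p) (ξ, 0) (0, ξ)) 0 := by
    have h := (hc.hasFDerivAt_fderiv).comp_hasDerivAt_of_eq (0 : ℝ)
      (hline.prodMk (hasDerivAt_const (0 : ℝ) p)) (by simp)
    simpa using h.clm_apply (hasDerivAt_const (0 : ℝ) ((0 : E), ξ))
  have hP : HasDerivAt (fun t : ℝ => fderiv ℝ m (p + t • ξ, p))
      (fderiv ℝ (fderiv ℝ m) (p, p) (ξ, 0)) 0 :=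
    (hm.hasFDerivAt_fderiv).comp_hasDerivAt_of_eq (0 : ℝ)
      (hline.prodMk (hasDerivAt_const (0 : ℝ) p)) (by simp)
  have hQ : HasDerivAt (fun t : ℝ => fderiv ℝ m (p, p + t • ξ) (ξ, 0))
      (fderiv ℝ (fderiv ℝ m) (p, p) (0, ξ) (ξ, 0)) 0 := by
    have h := (hm.hasFDerivAt_fderiv).comp_hasDerivAt_of_eq (0 : ℝ)
      ((hasDerivAt_const (0 : ℝ) p).prodMk hline) (by simp)
    simpa using h.clm_apply (hasDerivAt_const (0 : ℝ) (ξ, (0 : E)))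
  -- With u = p + tξ, the relation m(u, c(u, v)) = m(v, u) is differentiated in v at p in the
  -- direction ξ.
  have hpp : (fun t : ℝ => fderiv ℝ m (p + t • ξ, p) (0, fderiv ℝ c (p + t • ξ, p) (0, ξ)))
      =ᶠ[𝓝 0] fun t : ℝ => fderiv ℝ m (p, p + t • ξ) (ξ, 0) := by
    have h1 : Filter.Tendsto (fun t : ℝ => (p + t • ξ, p)) (𝓝 0) (𝓝 (p, p)) :=
      ht.prodMk_nhds tendsto_const_nhds
    have h2 : Filter.Tendsto (fun t : ℝ => (p, p + t • ξ)) (𝓝 0) (𝓝 (p, p)) :=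
      tendsto_const_nhds.prodMk_nhds ht
    filter_upwards [h1.eventually hm.eventually_differentiableAt,
      h2.eventually hm.eventually_differentiableAt, h1.eventually hc.eventually_differentiableAt,
      h1.eventually hmc.eventually_nhds, ht.eventually hc1] with t k1 k2 k3 k4 k5
    set u := p + t • ξ
    have hv : HasFDerivAt (fun v : E => (u, v)) (ContinuousLinearMap.inr ℝ E E) p :=
      hasFDerivAt_prodMk_right u p
    have hv' : HasFDerivAt (fun v : E => (v, u)) (ContinuousLinearMap.inl ℝ E E) p :=
      hasFDerivAt_prodMk_left p u
    have hcv : HasFDerivAt (fun v : E => c (u, v))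
        ((fderiv ℝ c (u, p)).comp (ContinuousLinearMap.inr ℝ E E)) p :=
      k3.hasFDerivAt.comp p hv
    have hL : HasFDerivAt (fun v : E => m (u, c (u, v))) ((fderiv ℝ m (u, p)).comp
        ((ContinuousLinearMap.inr ℝ E E).comp
          ((fderiv ℝ c (u, p)).comp (ContinuousLinearMap.inr ℝ E E)))) p := by
      have h3 : HasFDerivAt (fun v : E => (u, c (u, v))) ((ContinuousLinearMap.inr ℝ E E).comp
          ((fderiv ℝ c (u, p)).comp (ContinuousLinearMap.inr ℝ E E))) p :=
        (hasFDerivAt_prodMk_right u (c (u, p))).comp p hcv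
      have h4 : HasFDerivAt m (fderiv ℝ m (u, p)) (u, c (u, p)) := by
        rw [k5]; exact k1.hasFDerivAt
      exact h4.comp p h3
    have hR : HasFDerivAt (fun v : E => m (v, u))
        ((fderiv ℝ m (p, u)).comp (ContinuousLinearMap.inl ℝ E E)) p :=
      k2.hasFDerivAt.comp p hv'
    have heq : (fun v : E => m (u, c (u, v))) =ᶠ[𝓝 p] fun v => m (v, u) :=
      hv.continuousAt.eventually k4
    have := (hL.congr_of_eventuallyEq heq.symm).unique hR
    simpa using congrArg (fun T : E →L[ℝ] E => T ξ) this
  have hL := hP.clm_apply ((hasDerivAt_const (0 : ℝ) (0 : E)).prodMk ha1)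
  have hsum := (hL.congr_of_eventuallyEq hpp.symm).unique hQ
  have hm1' : ∀ w, fderiv ℝ m (p, p) (0, w) = w := by
    intro w
    have h1 : HasFDerivAt (fun v : E => m (p, v))
        ((fderiv ℝ m (p, p)).comp (ContinuousLinearMap.inr ℝ E E)) p :=
      (hm.differentiableAt (by simp)).hasFDerivAt.comp p (hasFDerivAt_prodMk_right p p)
    have := (h1.congr_of_eventuallyEq (f₁ := fun v => v) (hm1.mono fun v hv => hv.symm)).unique
      (hasFDerivAt_id p)
    simpa using congrArg (fun T : E →L[ℝ] E => T w) this
  have hc2' : fderiv ℝ c (p, p) (0, ξ) = ξ := by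
    have h1 : HasFDerivAt (fun v : E => c (p, v))
        ((fderiv ℝ c (p, p)).comp (ContinuousLinearMap.inr ℝ E E)) p :=
      (hc.differentiableAt (by simp)).hasFDerivAt.comp p (hasFDerivAt_prodMk_right p p)
    have := (h1.congr_of_eventuallyEq (f₁ := fun v => v) (hc2.mono fun v hv => hv.symm)).unique
      (hasFDerivAt_id p)
    simpa using congrArg (fun T : E →L[ℝ] E => T ξ) this
  simp only [hl0, hc2', hm1'] at hsum
  -- Differentiating once more in t leaves the mixed second derivative of c plus that of m, equal to
  -- that of m with its arguments exchanged. By symmetry only the term of c survives: this is [ξ, ξ]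
  -- = 0.
  have hsymm := (isSymmSndFDerivAt_of_contDiffAt_infty hm) (ξ, 0) (0, ξ)
  rw [hsymm] at hsum
  have h0 : fderiv ℝ (fderiv ℝ c) (p, p) (ξ, 0) (0, ξ) = 0 := by
    simpa using hsum
  rwa [h0] at ha1

/-- The derivative at `t = 0` of the pullback of `β` under a family of maps `f t` with
`f 0 = id`. -/
theorem hasDerivAt_pullback {k : ℕ} {β : E → E [⋀^Fin k]→L[ℝ] ℝ} {f : ℝ × E → E} {y : E}
    (hβ : ContDiffAt ℝ ∞ β y) (hf : ContDiffAt ℝ ∞ f (0, y)) (h0 : ∀ᶠ z in 𝓝 y, f (0, z) = z) :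
    HasDerivAt (fun t : ℝ => (β (f (t, y))).compContinuousLinearMap
        (fderiv ℝ (fun z => f (t, z)) y))
      (fderiv ℝ β y (fderiv ℝ f (0, y) (1, 0)) + (β y).fderivCompContinuousLinearMap (.id ℝ E)
        (fderiv ℝ (fun z => fderiv ℝ f (0, z) (1, 0)) y)) 0 := by
  have hy0 : f (0, y) = y := h0.self_of_nhds
  have hline : HasDerivAt (fun t : ℝ => (t, y)) ((1 : ℝ), (0 : E)) 0 :=
    (hasDerivAt_id (0 : ℝ)).prodMk (hasDerivAt_const (0 : ℝ) y)
  have h1 : HasDerivAt (fun t : ℝ => f (t, y)) (fderiv ℝ f (0, y) (1, 0)) 0 :=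
    (hf.differentiableAt (by simp)).hasFDerivAt.comp_hasDerivAt (0 : ℝ) hline
  have h2 : HasDerivAt (fun t : ℝ => β (f (t, y)))
      (fderiv ℝ β y (fderiv ℝ f (0, y) (1, 0))) 0 := by
    have := (hβ.differentiableAt (by simp)).hasFDerivAt.comp_hasDerivAt_of_eq (0 : ℝ) h1 hy0.symm
    exact this
  have h3 : HasDerivAt (fun t : ℝ => fderiv ℝ f (t, y)) (fderiv ℝ (fderiv ℝ f) (0, y) (1, 0)) 0 :=
    hf.hasFDerivAt_fderiv.comp_hasDerivAt (0 : ℝ) hline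
  have h4 : HasDerivAt (fun t : ℝ => fderiv ℝ (fun z => f (t, z)) y)
      ((fderiv ℝ (fderiv ℝ f) (0, y) (1, 0)).comp (ContinuousLinearMap.inr ℝ ℝ E)) 0 := by
    have h5 := h3.clm_comp (hasDerivAt_const (0 : ℝ) (ContinuousLinearMap.inr ℝ ℝ E))
    simp only [ContinuousLinearMap.comp_zero, add_zero] at h5
    refine h5.congr_of_eventuallyEq ?_
    filter_upwards [hline.continuousAt.eventually hf.eventually_differentiableAt] with t ht
    exact (ht.hasFDerivAt.comp y (hasFDerivAt_prodMk_right t y)).fderiv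
  -- Symmetry of the second derivative exchanges the time and space derivatives of f, so the
  -- derivative of the Jacobian is the Jacobian of the generating vector field.
  have h6 : (fderiv ℝ (fderiv ℝ f) (0, y) (1, 0)).comp (ContinuousLinearMap.inr ℝ ℝ E) =
      fderiv ℝ (fun z => fderiv ℝ f (0, z) (1, 0)) y := by
    have h7 : HasFDerivAt (fun z => fderiv ℝ f ((0 : ℝ), z))
        ((fderiv ℝ (fderiv ℝ f) (0, y)).comp (ContinuousLinearMap.inr ℝ ℝ E)) y :=
      hf.hasFDerivAt_fderiv.comp y (hasFDerivAt_prodMk_right (0 : ℝ) y)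
    have h8 := h7.clm_apply (hasFDerivAt_const ((1 : ℝ), (0 : E)) y)
    rw [h8.fderiv]
    ext v
    simpa using (isSymmSndFDerivAt_of_contDiffAt_infty hf) (1, 0) (0, v)
  have hid : fderiv ℝ (fun z => f (0, z)) y = .id ℝ E :=
    ((hasFDerivAt_id y).congr_of_eventuallyEq h0).fderiv
  have h9 := (HasFDerivAt.continuousAlternatingMapCompContinuousLinearMap h2.hasFDerivAt
    h4.hasFDerivAt).hasDerivAt
  rw [h6, hid, hy0] at h9
  convert! h9 using 1
  ext v
  simp

theorem hasFDerivAt_curryLeft {k : ℕ} {β : W → E [⋀^Fin (k + 1)]→L[ℝ] ℝ} {X : W → E} {y : W}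
    {β' : W →L[ℝ] E [⋀^Fin (k + 1)]→L[ℝ] ℝ} {X' : W →L[ℝ] E} (hβ : HasFDerivAt β β' y)
    (hX : HasFDerivAt X X' y) :
    HasFDerivAt (fun z => (β z).curryLeft (X z))
      ((curryLeftAt k (X y)).comp β' + (β y).curryLeft.comp X') y := by
  let L : (E [⋀^Fin (k + 1)]→L[ℝ] ℝ) →L[ℝ] (E →L[ℝ] E [⋀^Fin k]→L[ℝ] ℝ) :=
    curryLeftLI.toContinuousLinearMap
  have hL : HasFDerivAt L L (β y) :=
    ContinuousLinearMap.hasFDerivAt (𝕜 := ℝ) (E := E [⋀^Fin (k + 1)]→L[ℝ] ℝ)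
      (F := E →L[ℝ] E [⋀^Fin k]→L[ℝ] ℝ) L
  have h3 : HasFDerivAt (fun z => (β z).curryLeft) (L.comp β') y :=
    HasFDerivAt.comp (𝕜 := ℝ) (E := W) (F := E [⋀^Fin (k + 1)]→L[ℝ] ℝ)
      (G := E →L[ℝ] E [⋀^Fin k]→L[ℝ] ℝ) y hL hβ
  have h2 := HasFDerivAt.clm_apply (G := E) (H := E [⋀^Fin k]→L[ℝ] ℝ) h3 hX
  refine h2.congr_fderiv ?_
  ext v w
  simp [L, curryLeftAt_apply, add_comm]

/-- Cartan's formula in coordinates: the right side is the Lie derivative of β along X, the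
derivative of β in the direction X plus the derivation induced by the Jacobian of X. -/
theorem extDeriv_curryLeft_add {k : ℕ} {β : E → E [⋀^Fin (k + 1)]→L[ℝ] ℝ} {X : E → E} {y : E}
    (hβ : DifferentiableAt ℝ β y) (hX : DifferentiableAt ℝ X y) :
    extDeriv (fun z => (β z).curryLeft (X z)) y + (extDeriv β y).curryLeft (X y) =
      fderiv ℝ β y (X y) + (β y).fderivCompContinuousLinearMap (.id ℝ E) (fderiv ℝ X y) := by
  have h1 := hasFDerivAt_curryLeft hβ.hasFDerivAt hX.hasFDerivAt
  rw [extDeriv, h1.fderiv, extDeriv, curryLeft_alternatizeUncurryFin,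
    alternatizeUncurryFin_add, alternatizeUncurryFin_comp_eq_fderivCompContinuousLinearMap]
  abel

/-- The degree zero case of Cartan's formula. A form without slots receives no contribution from the
derivation, so A is arbitrary. -/
theorem curryLeft_extDeriv_zero {β : E → E [⋀^Fin 0]→L[ℝ] ℝ} {X A} {y : E} :
    (extDeriv β y).curryLeft X =
      fderiv ℝ β y X + (β y).fderivCompContinuousLinearMap (.id ℝ E) A := by
  rw [extDeriv, curryLeft_alternatizeUncurryFin_zero, fderivCompContinuousLinearMap_of_isEmpty]
  simp

end FlatCalculus

/-! ## Smooth actions -/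

section Action

variable {EG E : Type*} [NormedAddCommGroup EG] [NormedSpace ℝ EG] [FiniteDimensional ℝ EG]
  [NormedAddCommGroup E] [NormedSpace ℝ E] [FiniteDimensional ℝ E]
  {G : Type*} [TopologicalSpace G] [ChartedSpace EG G] [Group G] [LieGroup 𝓘(ℝ, EG) ∞ G]
  {M : Type*} [TopologicalSpace M] [ChartedSpace E M] [IsManifold 𝓘(ℝ, E) ∞ M] [MulAction G M]
  [ContMDiffSMul 𝓘(ℝ, EG) 𝓘(ℝ, E) ∞ G M]

theorem contMDiff_smul_left (EG E : Type*) [NormedAddCommGroup EG] [NormedSpace ℝ EG]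
    [NormedAddCommGroup E] [NormedSpace ℝ E]
    {G : Type*} [TopologicalSpace G] [ChartedSpace EG G] [Group G]
    {M : Type*} [TopologicalSpace M] [ChartedSpace E M] [MulAction G M]
    [ContMDiffSMul 𝓘(ℝ, EG) 𝓘(ℝ, E) ∞ G M] (g : G) :
    ContMDiff 𝓘(ℝ, E) 𝓘(ℝ, E) ∞ (fun x : M => g • x) :=
  ContMDiffSMul.contMDiff_const_smul (I := 𝓘(ℝ, EG)) g

variable (EG E G) in
theorem contMDiff_orbit (x : M) : ContMDiff 𝓘(ℝ, EG) 𝓘(ℝ, E) ∞ (fun g : G => g • x) :=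
  contMDiff_id.smul contMDiff_const

variable (EG G) in
theorem contMDiff_conj (g : G) : ContMDiff 𝓘(ℝ, EG) 𝓘(ℝ, EG) ∞ (fun h : G => g * h * g⁻¹) :=
  (contMDiff_const.mul contMDiff_id).mul contMDiff_const

/-- Differentiate (g h g⁻¹) • x = g • (h • (g⁻¹ • x)) in h at 1. -/
theorem fundamental_Ad (g : G) (x : M) :
    (fundamental EG E G x).comp (Ad EG g) =
      (tmap E E (fun y : M => g • y) (g⁻¹ • x)).comp (fundamental EG E G (g⁻¹ • x)) := by
  have h1 := tmap_comp (g := fun h : G => h • x) (f := fun h : G => g * h * g⁻¹) (x := 1)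
    (contMDiff_orbit EG E G x _).mdiff (contMDiff_conj EG G g 1).mdiff
  have h2 := tmap_comp (g := fun y : M => g • y) (f := fun h : G => h • g⁻¹ • x) (x := 1)
    (contMDiff_smul_left EG E g _).mdiff (contMDiff_orbit EG E G (g⁻¹ • x) 1).mdiff
  simp only [mul_one, mul_inv_cancel, one_smul] at h1 h2
  rw [fundamental, Ad, fundamental, ← h1, ← h2]
  congr 1
  funext h
  rw [mul_smul, mul_smul]

theorem fundamental_Ad_apply (g : G) (x : M) (ξ : EG) :
    fundamental EG E G x (Ad EG g ξ) =
      tmap E E (fun y : M => g • y) (g⁻¹ • x) (fundamental EG E G (g⁻¹ • x) ξ) :=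
  congrArg (fun T : EG →L[ℝ] E => T ξ) (fundamental_Ad g x)

/-- The action in the charts at `1` and `x₀`. -/
noncomputable def actionRep (EG E G : Type*) [NormedAddCommGroup EG] [NormedSpace ℝ EG]
    [NormedAddCommGroup E] [NormedSpace ℝ E] [TopologicalSpace G] [ChartedSpace EG G] [Group G]
    {M : Type*} [TopologicalSpace M] [ChartedSpace E M] [MulAction G M] (x₀ : M) : EG × E → E :=
  fun q => extChartAt 𝓘(ℝ, E) x₀
    ((extChartAt 𝓘(ℝ, EG) (1 : G)).symm q.1 • (extChartAt 𝓘(ℝ, E) x₀).symm q.2)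

theorem contDiffAt_actionRep {x₀ : M} {q : EG × E}
    (h1 : q.1 ∈ (extChartAt 𝓘(ℝ, EG) (1 : G)).target) (h2 : q.2 ∈ (extChartAt 𝓘(ℝ, E) x₀).target)
    (h3 : (extChartAt 𝓘(ℝ, EG) (1 : G)).symm q.1 • (extChartAt 𝓘(ℝ, E) x₀).symm q.2 ∈
      (extChartAt 𝓘(ℝ, E) x₀).source) : ContDiffAt ℝ ∞ (actionRep EG E G x₀) q := by
  refine contMDiffAt_iff_contDiffAt.1 ?_
  have k1 : ContMDiffAt 𝓘(ℝ, EG × E) 𝓘(ℝ, EG) ∞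
      (fun q : EG × E => (extChartAt 𝓘(ℝ, EG) (1 : G)).symm q.1) q :=
    (contMDiffAt_chart_symm h1).comp q contDiff_fst.contMDiff.contMDiffAt
  have k2 : ContMDiffAt 𝓘(ℝ, EG × E) 𝓘(ℝ, E) ∞
      (fun q : EG × E => (extChartAt 𝓘(ℝ, E) x₀).symm q.2) q :=
    (contMDiffAt_chart_symm h2).comp q contDiff_snd.contMDiff.contMDiffAt
  exact (contMDiffAt_chart h3).comp q (k1.smul k2)

theorem contDiffAt_actionRep_one {x₀ : M} {z : E} (hz : z ∈ (extChartAt 𝓘(ℝ, E) x₀).target) :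
    ContDiffAt ℝ ∞ (actionRep EG E G x₀) (extChartAt 𝓘(ℝ, EG) (1 : G) 1, z) := by
  refine contDiffAt_actionRep (mem_extChartAt_target 1) hz ?_
  simp only [extChartAt_to_inv, one_smul]
  exact (extChartAt 𝓘(ℝ, E) x₀).map_target hz

/-- The infinitesimal action in the chart at `x₀`. -/
noncomputable def fundamentalRep (EG E G : Type*) [NormedAddCommGroup EG] [NormedSpace ℝ EG]
    [NormedAddCommGroup E] [NormedSpace ℝ E] [TopologicalSpace G] [ChartedSpace EG G] [Group G]
    {M : Type*} [TopologicalSpace M] [ChartedSpace E M] [MulAction G M] (x₀ : M) (z : E) :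
    EG →L[ℝ] E :=
  (tmap E E (extChartAt 𝓘(ℝ, E) x₀) ((extChartAt 𝓘(ℝ, E) x₀).symm z)).comp
    (fundamental EG E G ((extChartAt 𝓘(ℝ, E) x₀).symm z))

/-- Writing the infinitesimal action as a partial derivative of the smooth map `actionRep` makes its
smooth dependence on the base point visible. -/
theorem fundamentalRep_eq {x₀ : M} {z : E} (hz : z ∈ (extChartAt 𝓘(ℝ, E) x₀).target) :
    fundamentalRep EG E G x₀ z =
      (fderiv ℝ (actionRep EG E G x₀) (extChartAt 𝓘(ℝ, EG) (1 : G) 1, z)).comp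
        (ContinuousLinearMap.inl ℝ EG E) := by
  set p := extChartAt 𝓘(ℝ, EG) (1 : G) 1 with hp
  have hp1 : (extChartAt 𝓘(ℝ, EG) (1 : G)).symm p = 1 := extChartAt_to_inv 1
  have h1 : HasFDerivAt (fun u => actionRep EG E G x₀ (u, z))
      ((fderiv ℝ (actionRep EG E G x₀) (p, z)).comp (ContinuousLinearMap.inl ℝ EG E)) p := by
    have hA : HasFDerivAt (actionRep EG E G x₀) (fderiv ℝ (actionRep EG E G x₀) (p, z)) (p, z) :=
      ((contDiffAt_actionRep_one hz).differentiableAt (by simp)).hasFDerivAt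
    have hB : HasFDerivAt (fun u : EG => (u, z)) (ContinuousLinearMap.inl ℝ EG E) p :=
      hasFDerivAt_prodMk_left p z
    exact hA.comp p hB
  rw [← h1.fderiv, ← tmap_eq_fderiv]
  have h2 : ContMDiffAt 𝓘(ℝ, EG) 𝓘(ℝ, EG) ∞ (extChartAt 𝓘(ℝ, EG) (1 : G)).symm p :=
    contMDiffAt_chart_symm (mem_extChartAt_target 1)
  have h3 := contMDiff_orbit EG E G ((extChartAt 𝓘(ℝ, E) x₀).symm z)
  have h4 : ContMDiffAt 𝓘(ℝ, E) 𝓘(ℝ, E) ∞ (extChartAt 𝓘(ℝ, E) x₀)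
      ((extChartAt 𝓘(ℝ, EG) (1 : G)).symm p • (extChartAt 𝓘(ℝ, E) x₀).symm z) := by
    rw [hp1, one_smul]
    exact contMDiffAt_chart ((extChartAt 𝓘(ℝ, E) x₀).map_target hz)
  have h5 : MDifferentiableAt 𝓘(ℝ, EG) 𝓘(ℝ, E) (fun u : EG =>
      (extChartAt 𝓘(ℝ, EG) (1 : G)).symm u • (extChartAt 𝓘(ℝ, E) x₀).symm z) p :=
    ((h3 _).comp p h2).mdiff
  have h6 := tmap_comp (g := extChartAt 𝓘(ℝ, E) x₀) (f := fun u : EG =>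
      (extChartAt 𝓘(ℝ, EG) (1 : G)).symm u • (extChartAt 𝓘(ℝ, E) x₀).symm z) h4.mdiff h5
  have h7 := tmap_comp (g := fun g : G => g • (extChartAt 𝓘(ℝ, E) x₀).symm z)
    (f := (extChartAt 𝓘(ℝ, EG) (1 : G)).symm) (h3 _).mdiff h2.mdiff
  rw [h7, hp, tmap_chart_symm_self, ContinuousLinearMap.comp_id, ← hp, hp1, one_smul] at h6
  exact h6.symm

theorem contDiffAt_fundamentalRep {x₀ : M} {z : E} (hz : z ∈ (extChartAt 𝓘(ℝ, E) x₀).target) :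
    ContDiffAt ℝ ∞ (fundamentalRep EG E G x₀) z := by
  have h1 : ContDiffAt ℝ ∞ (fun w : E => (fderiv ℝ (actionRep EG E G x₀)
      (extChartAt 𝓘(ℝ, EG) (1 : G) 1, w)).comp (ContinuousLinearMap.inl ℝ EG E)) z := by
    refine ContDiffAt.clm_comp ?_ contDiffAt_const
    exact ContDiffAt.comp z ((contDiffAt_actionRep_one hz).fderiv_right (m := ∞) (by simp))
      (contDiffAt_const.prodMk contDiffAt_id)
  refine h1.congr_of_eventuallyEq ?_
  filter_upwards [extChartAt_target_mem_nhds' hz] with w hw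
  exact fundamentalRep_eq hw

theorem fundamentalRep_self (x : M) :
    fundamentalRep EG E G x (extChartAt 𝓘(ℝ, E) x x) = fundamental EG E G x := by
  rw [fundamentalRep, extChartAt_to_inv, tmap_chart_self, ContinuousLinearMap.id_comp]

/-- The derivative of `g ↦ Ad_{g⁻¹} ξ` at `1` in the direction `ξ` vanishes. -/
theorem hasDerivAt_Ad_inv (ξ : EG) :
    HasDerivAt (fun t : ℝ => Ad EG ((extChartAt 𝓘(ℝ, EG) (1 : G)).symm
      (extChartAt 𝓘(ℝ, EG) (1 : G) 1 + t • ξ))⁻¹ ξ) 0 0 := by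
  set e := extChartAt 𝓘(ℝ, EG) (1 : G) with he
  set p := e 1 with hp
  have hp1 : e.symm p = 1 := extChartAt_to_inv 1
  have hpt : p ∈ e.target := mem_extChartAt_target 1
  -- Multiplication and the conjugation u⁻¹ v u are read in the chart at 1. A straight line in this
  -- chart replaces the exponential curve, since only its first-order behaviour is needed.
  let m : EG × EG → EG := fun q => e (e.symm q.1 * e.symm q.2)
  let c : EG × EG → EG := fun q => e ((e.symm q.1)⁻¹ * e.symm q.2 * e.symm q.1)
  have hfst : ∀ q : EG × EG, q.1 ∈ e.target →
      ContMDiffAt 𝓘(ℝ, EG × EG) 𝓘(ℝ, EG) ∞ (fun q : EG × EG => e.symm q.1) q := fun q h =>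
    (contMDiffAt_chart_symm h).comp q contDiff_fst.contMDiff.contMDiffAt
  have hsnd : ∀ q : EG × EG, q.2 ∈ e.target →
      ContMDiffAt 𝓘(ℝ, EG × EG) 𝓘(ℝ, EG) ∞ (fun q : EG × EG => e.symm q.2) q := fun q h =>
    (contMDiffAt_chart_symm h).comp q contDiff_snd.contMDiff.contMDiffAt
  have hm : ContDiffAt ℝ ∞ m (p, p) := by
    refine contMDiffAt_iff_contDiffAt.1 ?_
    refine ContMDiffAt.comp (p, p) (contMDiffAt_chart ?_) ((hfst (p, p) hpt).mul (hsnd (p, p) hpt))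
    simp only [hp1, mul_one]
    exact mem_extChartAt_source 1
  have hc : ∀ u ∈ e.target, ContDiffAt ℝ ∞ c (u, p) := by
    intro u hu
    refine contMDiffAt_iff_contDiffAt.1 ?_
    refine ContMDiffAt.comp (u, p) (contMDiffAt_chart ?_)
      (((hfst (u, p) hu).inv.mul (hsnd (u, p) hpt)).mul (hfst (u, p) hu))
    simp only [hp1, mul_one, inv_mul_cancel]
    exact mem_extChartAt_source 1
  have hcont : ContinuousAt e.symm p := continuousAt_extChartAt_symm 1
  have hcg : ContinuousMul G := continuousMul_of_contMDiffMul 𝓘(ℝ, EG) ∞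
  have hig : IsTopologicalGroup G := topologicalGroup_of_lieGroup 𝓘(ℝ, EG) ∞
  have hsrc : e.source ∈ 𝓝 (1 : G) := extChartAt_source_mem_nhds 1
  have h1 : ∀ᶠ q in 𝓝 (p, p), m (q.1, c q) = m (q.2, q.1) := by
    have k : Filter.Tendsto (fun q : EG × EG => (e.symm q.1)⁻¹ * e.symm q.2 * e.symm q.1)
        (𝓝 (p, p)) (𝓝 1) := by
      have k1 : ContinuousAt (fun q : EG × EG => e.symm q.1) (p, p) :=
        ContinuousAt.comp (x := (p, p)) hcont continuousAt_fst
      have k2 : ContinuousAt (fun q : EG × EG => e.symm q.2) (p, p) :=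
        ContinuousAt.comp (x := (p, p)) hcont continuousAt_snd
      have k3 : Filter.Tendsto (fun q : EG × EG => (e.symm q.1)⁻¹ * e.symm q.2 * e.symm q.1)
        (𝓝 (p, p)) (𝓝 ((e.symm p)⁻¹ * e.symm p * e.symm p)) := ((k1.inv.mul k2).mul k1).tendsto
      simpa only [hp1, mul_one, inv_one] using k3
    filter_upwards [k.eventually hsrc] with q hq
    simp only [m, c]
    rw [e.left_inv hq]
    congr 1
    group
  have h2 : ∀ᶠ v in 𝓝 p, m (p, v) = v := by
    filter_upwards [extChartAt_target_mem_nhds (I := 𝓘(ℝ, EG)) (1 : G)] with v hv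
    simp only [m, hp1, one_mul]
    exact e.right_inv hv
  have h3 : ∀ u, c (u, p) = p := fun u => by
    simp only [c, hp1, mul_one, inv_mul_cancel]
    exact hp.symm
  have h4 : ∀ᶠ v in 𝓝 p, c (p, v) = v := by
    filter_upwards [extChartAt_target_mem_nhds (I := 𝓘(ℝ, EG)) (1 : G)] with v hv
    simp only [c, hp1, one_mul, mul_one, inv_one]
    exact e.right_inv hv
  have h5 := hasDerivAt_conj_eq_zero (ξ := ξ) hm (hc p hpt) h1 h2 (.of_forall h3) h4
  refine h5.congr_of_eventuallyEq ?_
  have ht : Filter.Tendsto (fun t : ℝ => p + t • ξ) (𝓝 0) (𝓝 p) := by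
    have : ContinuousAt (fun t : ℝ => p + t • ξ) 0 := by fun_prop
    simpa using this.tendsto
  filter_upwards [ht.eventually (extChartAt_target_mem_nhds (I := 𝓘(ℝ, EG)) (1 : G))] with t hu
  set u := p + t • ξ
  have k1 : HasFDerivAt (fun v => c (u, v))
      ((fderiv ℝ c (u, p)).comp (ContinuousLinearMap.inr ℝ EG EG)) p :=
    ((hc u hu).differentiableAt (by simp)).hasFDerivAt.comp p (hasFDerivAt_prodMk_right u p)
  have k2 : fderiv ℝ (fun v => c (u, v)) p = Ad EG (e.symm u)⁻¹ := by
    set g := (e.symm u)⁻¹ with hg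
    have hcomp : (fun v => c (u, v)) = fun v => e (g * e.symm v * g⁻¹) := by
      funext v; simp only [c, hg, inv_inv]
    have l1 : ContMDiffAt 𝓘(ℝ, EG) 𝓘(ℝ, EG) ∞ e.symm p := contMDiffAt_chart_symm hpt
    have l2 : ContMDiffAt 𝓘(ℝ, EG) 𝓘(ℝ, EG) ∞ e (g * e.symm p * g⁻¹) := by
      rw [hp1, mul_one, mul_inv_cancel]; exact contMDiffAt_chart (mem_extChartAt_source 1)
    have l3 := contMDiff_conj EG G g
    have l4 := tmap_comp (g := e) (f := fun v => g * e.symm v * g⁻¹) l2.mdiff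
      ((l3 _).comp p l1).mdiff
    have l5 := tmap_comp (g := fun h : G => g * h * g⁻¹) (f := e.symm) (l3 _).mdiff l1.mdiff
    rw [l5, hp1, mul_one, mul_inv_cancel, he, tmap_chart_self, ← he, hp, he, tmap_chart_symm_self,
      ContinuousLinearMap.comp_id, ContinuousLinearMap.id_comp] at l4
    rw [← tmap_eq_fderiv, hcomp]
    exact l4
  rw [← k2, k1.fderiv]
  simp

/-- The left side is the Lie derivative of α(ξ) along X_ξ in a chart. For the curve g_t through 1
with velocity ξ, invariance says α(Ad_{g_t⁻¹} ξ) = g_t^* α(ξ). The left side of this equation has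
zero derivative at t = 0 by `hasDerivAt_Ad_inv`, and the right side has the Lie derivative. -/
theorem infinitesimal_invariance {k : ℕ} {α : EG → FormField E M k}
    (hinv : ∀ (g : G) ξ, α (Ad EG g ξ) = pullback (fun x : M => g⁻¹ • x) (α ξ)) {ξ : EG}
    (hs : IsSmoothForm (α ξ)) {x : M} (hd : DifferentiableAt ℝ (fun η => α η x) ξ) :
    fderiv ℝ (chartRep (α ξ) x) (extChartAt 𝓘(ℝ, E) x x)
        (fundamentalRep EG E G x (extChartAt 𝓘(ℝ, E) x x) ξ) +
      (chartRep (α ξ) x (extChartAt 𝓘(ℝ, E) x x)).fderivCompContinuousLinearMap (.id ℝ E)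
        (fderiv ℝ (fun z => fundamentalRep EG E G x z ξ) (extChartAt 𝓘(ℝ, E) x x)) = 0 := by
  set e := extChartAt 𝓘(ℝ, E) x with he
  set y := e x with hy
  have hyt : y ∈ e.target := mem_extChartAt_target x
  have hex : e.symm y = x := extChartAt_to_inv x
  set eG := extChartAt 𝓘(ℝ, EG) (1 : G) with heG
  set p := eG 1 with hp
  have hp1 : eG.symm p = 1 := extChartAt_to_inv 1
  have htn : e.target ∈ 𝓝 y := extChartAt_target_mem_nhds x
  let l : ℝ × E → EG × E := fun q => (p + q.1 • ξ, q.2)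
  let f : ℝ × E → E := fun q => actionRep EG E G x (l q)
  have hl : ContDiff ℝ ∞ l :=
    (contDiff_const.add (contDiff_fst.smul contDiff_const)).prodMk contDiff_snd
  have hl0 : ∀ z, l (0, z) = (p, z) := fun z => by simp [l]
  have hf : ∀ z ∈ e.target, ContDiffAt ℝ ∞ f (0, z) := by
    intro z hz
    have h1 : ContDiffAt ℝ ∞ (actionRep EG E G x) (l (0, z)) := by
      rw [hl0]; exact contDiffAt_actionRep_one hz
    exact ContDiffAt.comp (g := actionRep EG E G x) (f := l) (0, z) h1 hl.contDiffAt
  have h0 : ∀ᶠ z in 𝓝 y, f (0, z) = z := by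
    filter_upwards [htn] with z hz
    simp only [f, hl0, actionRep]
    rw [← heG, hp1, one_smul]
    exact e.right_inv hz
  have hX : ∀ z ∈ e.target, fderiv ℝ f (0, z) (1, 0) = fundamentalRep EG E G x z ξ := by
    intro z hz
    have h1 : HasFDerivAt (actionRep EG E G x) (fderiv ℝ (actionRep EG E G x) (p, z))
        (l (0, z)) := by
      rw [hl0]
      exact ((contDiffAt_actionRep_one hz).differentiableAt (by simp)).hasFDerivAt
    have h2 : HasFDerivAt l (((ContinuousLinearMap.fst ℝ ℝ E).smulRight ξ).prod
        (ContinuousLinearMap.snd ℝ ℝ E)) (0, z) :=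
      ((hasFDerivAt_fst.smul_const ξ).const_add p).prodMk hasFDerivAt_snd
    have h3 : fderiv ℝ f (0, z) = _ := (h1.comp (0, z) h2).fderiv
    rw [h3, fundamentalRep_eq hz]
    simp [hp, heG]
  have hmain := hasDerivAt_pullback ((hs x).contDiffAt htn) (hf y hyt) h0
  have hXe : (fun z => fderiv ℝ f (0, z) (1, 0)) =ᶠ[𝓝 y]
      fun z => fundamentalRep EG E G x z ξ := by
    filter_upwards [htn] with z hz using hX z hz
  rw [hX y hyt, hXe.fderiv_eq] at hmain
  have hAd := hasDerivAt_Ad_inv (G := G) ξ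
  have hzero : HasDerivAt (fun t : ℝ => α (Ad EG (eG.symm (p + t • ξ))⁻¹ ξ) x) 0 0 := by
    have hAd0 : Ad EG ((eG.symm (p + (0 : ℝ) • ξ))⁻¹ : G) ξ = ξ := by
      rw [zero_smul, add_zero, hp1, inv_one, Ad]
      simp only [one_mul, inv_one, mul_one]
      rw [tmap_id]
      rfl
    have := (hd.hasFDerivAt).comp_hasDerivAt_of_eq (0 : ℝ) hAd hAd0.symm
    exact this.congr_deriv (map_zero (M := EG) _)
  refine (hmain.congr_of_eventuallyEq ?_).unique hzero
  have ht : Filter.Tendsto (fun t : ℝ => p + t • ξ) (𝓝 0) (𝓝 p) := by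
    have : ContinuousAt (fun t : ℝ => p + t • ξ) 0 := by fun_prop
    simpa using this.tendsto
  have hcs : ContinuousSMul G M := ContMDiffSMul.continuousSMul (I := 𝓘(ℝ, EG)) (I' := 𝓘(ℝ, E)) ∞
  have hcont : ContinuousAt eG.symm p := continuousAt_extChartAt_symm 1
  have hsrc : Filter.Tendsto (fun t : ℝ => eG.symm (p + t • ξ) • x) (𝓝 0) (𝓝 x) := by
    have h1 : Filter.Tendsto (fun t : ℝ => eG.symm (p + t • ξ)) (𝓝 0) (𝓝 1) := by
      rw [← hp1]; exact hcont.tendsto.comp ht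
    simpa using h1.smul (tendsto_const_nhds (x := x))
  filter_upwards [hsrc.eventually (extChartAt_source_mem_nhds (I := 𝓘(ℝ, E)) x)] with t ht2
  rw [hinv, inv_inv]
  set g := eG.symm (p + t • ξ) with hg
  have h1 := (eventually_chartRep_pullback (f := fun y : M => g • y) (x₀ := x) (y₀ := x) hyt
    (by rw [← he, hex]; exact ht2) (contMDiff_smul_left EG E g _) (α ξ)).self_of_nhds
  have h2 : chartRep (pullback (fun y : M => g • y) (α ξ)) x y =
      pullback (fun y : M => g • y) (α ξ) x := by
    rw [chartRep, pullback, hy, he, tmap_chart_symm_self, extChartAt_to_inv]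
    ext v
    simp
  rw [h2] at h1
  exact h1

end Action

/-! ## Polynomial maps with values in differential forms -/

section PolyForms

variable {EG E : Type*} [NormedAddCommGroup EG] [NormedSpace ℝ EG]
  [NormedAddCommGroup E] [NormedSpace ℝ E]
  {M : Type*} [TopologicalSpace M] [ChartedSpace E M]

theorem hasFDerivAt_prod_smul {F : Type*} [NormedAddCommGroup F] [NormedSpace ℝ F] {i : ℕ}
    (p : Fin (i + 1) → EG →L[ℝ] ℝ) (b : F) (ξ : EG) :
    HasFDerivAt (fun η => (∏ s, p s η) • b)
      (∑ s, (∏ t, p (s.succAbove t) ξ) • (p s).smulRight b) ξ := by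
  have h : HasFDerivAt (fun η => ∏ s, p s η)
      (∑ s, (∏ t ∈ Finset.univ.erase s, p t ξ) • p s) ξ :=
    HasFDerivAt.finsetProd fun s _ => (p s).hasFDerivAt
  refine (h.smul_const b).congr_fderiv ?_
  ext v
  simp only [ContinuousLinearMap.smulRight_apply, _root_.sum_apply, _root_.smul_apply,
    Finset.sum_smul, smul_eq_mul, mul_smul]
  refine Finset.sum_congr rfl fun s _ => ?_
  congr 1
  have h2 := Fin.image_succAbove_univ s
  have h3 : Finset.univ.erase s = Finset.univ.image s.succAbove := by
    rw [h2, ← Finset.sdiff_singleton_eq_erase]; rfl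
  rw [h3, Finset.prod_image fun _ _ _ _ h => Fin.succAbove_right_injective h]

theorem polyForms.differentiable {i j : ℕ} {f : EG → FormField E M j}
    (hf : f ∈ polyForms EG E M i j) (x : M) : Differentiable ℝ fun η => f η x := by
  induction hf using Submodule.span_induction with
  | mem f h =>
    obtain ⟨p, β, -, rfl⟩ := h
    cases i with
    | zero =>
      have h : (fun η : EG => (∏ s : Fin 0, p s η) • β x) = fun _ => β x := by funext; simp
      change Differentiable ℝ (fun η : EG => (∏ s : Fin 0, p s η) • β x)
      rw [h]
      exact differentiable_const (β x)
    | succ i => exact fun ξ => (hasFDerivAt_prod_smul p (β x) ξ).differentiableAt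
  | zero => exact differentiable_const (0 : E [⋀^Fin j]→L[ℝ] ℝ)
  | add f g _ _ hf hg => exact hf.add hg
  | smul c f _ hf => exact hf.const_smul c

/-- Euler's identity. -/
theorem polyForms.fderiv_self {i j : ℕ} {f : EG → FormField E M j}
    (hf : f ∈ polyForms EG E M i j) (x : M) (ξ : EG) :
    fderiv ℝ (fun η => f η x) ξ ξ = (i : ℝ) • f ξ x := by
  induction hf using Submodule.span_induction with
  | mem f h =>
    obtain ⟨p, β, -, rfl⟩ := h
    cases i with
    | zero =>
      have h : (fun η : EG => (∏ s : Fin 0, p s η) • β x) = fun _ => β x := by funext; simp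
      change fderiv ℝ (fun η : EG => (∏ s : Fin 0, p s η) • β x) ξ ξ = _
      rw [h, (hasFDerivAt_const (β x) ξ).fderiv, Nat.cast_zero, zero_smul]
      rfl
    | succ i =>
      refine (congrArg (fun T : EG →L[ℝ] E [⋀^Fin j]→L[ℝ] ℝ => T ξ)
        (hasFDerivAt_prod_smul p (β x) ξ).fderiv).trans ?_
      have h (s : Fin (i + 1)) : (∏ t, p (s.succAbove t) ξ) • (p s).smulRight (β x) ξ =
          (∏ t, p t ξ) • β x := by
        rw [Fin.prod_univ_succAbove _ s, ContinuousLinearMap.smulRight_apply, smul_smul, mul_comm]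
      simp only [_root_.sum_apply, _root_.smul_apply, h]
      rw [Finset.sum_const, Finset.card_univ, Fintype.card_fin, ← Nat.cast_smul_eq_nsmul ℝ]
      rfl
  | zero =>
    refine (congrArg (fun T : EG →L[ℝ] E [⋀^Fin j]→L[ℝ] ℝ => T ξ)
      (hasFDerivAt_const (0 : E [⋀^Fin j]→L[ℝ] ℝ) ξ).fderiv).trans ?_
    exact (smul_zero _).symm
  | add f g hf' hg' hf hg =>
    have h := (((polyForms.differentiable hf' x) ξ).hasFDerivAt.add
      ((polyForms.differentiable hg' x) ξ).hasFDerivAt).fderiv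
    refine (congrArg (fun T : EG →L[ℝ] E [⋀^Fin j]→L[ℝ] ℝ => T ξ) h).trans ?_
    rw [_root_.add_apply, hf, hg, ← smul_add]
    rfl
  | smul c f hf' hf =>
    have h := (((polyForms.differentiable hf' x) ξ).hasFDerivAt.const_smul c).fderiv
    refine (congrArg (fun T : EG →L[ℝ] E [⋀^Fin j]→L[ℝ] ℝ => T ξ) h).trans ?_
    rw [_root_.smul_apply, hf, smul_comm]
    rfl

theorem polyForms.eq_const {j : ℕ} {f : EG → FormField E M j}
    (hf : f ∈ polyForms EG E M 0 j) (ξ : EG) : f ξ = f 0 := by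
  induction hf using Submodule.span_induction with
  | mem f h => obtain ⟨p, β, -, rfl⟩ := h; simp
  | zero => rfl
  | add f g _ _ hf hg => simp only [Pi.add_apply, hf, hg]
  | smul c f _ hf => simp only [Pi.smul_apply, hf]

theorem polyForms.const_mem {j : ℕ} {β : FormField E M j} (hβ : IsSmoothForm β) :
    (fun _ => β) ∈ polyForms EG E M 0 j :=
  Submodule.subset_span ⟨fun s => s.elim0, β, hβ, by funext; simp⟩

/-- Operators on smooth forms act on polynomial maps. -/
theorem polyForms.map {E' : Type*} [NormedAddCommGroup E'] [NormedSpace ℝ E']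
    {N : Type*} [TopologicalSpace N] [ChartedSpace E' N] {i j j' : ℕ}
    (L : FormField E M j → FormField E' N j')
    (hadd : ∀ a b, IsSmoothForm a → IsSmoothForm b → L (a + b) = L a + L b)
    (hsmul : ∀ (c : ℝ) a, L (c • a) = c • L a)
    (hL : ∀ a, IsSmoothForm a → IsSmoothForm (L a)) {f : EG → FormField E M j}
    (hf : f ∈ polyForms EG E M i j) : (fun ξ => L (f ξ)) ∈ polyForms EG E' N i j' := by
  induction hf using Submodule.span_induction with
  | mem f h =>
    obtain ⟨p, β, hβ, rfl⟩ := h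
    exact Submodule.subset_span ⟨p, L β, hL β hβ, by funext ξ; exact hsmul _ _⟩
  | zero =>
    have h : L 0 = 0 := by simpa using hsmul 0 0
    simp only [Pi.zero_apply, h]
    exact Submodule.zero_mem _
  | add f g hf' hg' hf hg =>
    convert Submodule.add_mem _ hf hg using 1
    funext ξ
    exact hadd _ _ (polyForms.isSmoothForm hf' ξ) (polyForms.isSmoothForm hg' ξ)
  | smul c f _ hf =>
    convert Submodule.smul_mem _ c hf using 1
    funext ξ
    exact hsmul _ _

/-- A linear family of operators on smooth forms raises the polynomial degree by one. -/
theorem polyForms.mul [FiniteDimensional ℝ EG] {i j j' : ℕ}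
    (L : EG → FormField E M j → FormField E M j')
    (hadd : ∀ ξ a b, L ξ (a + b) = L ξ a + L ξ b)
    (hsmul : ∀ ξ (c : ℝ) a, L ξ (c • a) = c • L ξ a)
    (hadd' : ∀ ξ η a, L (ξ + η) a = L ξ a + L η a)
    (hsmul' : ∀ (c : ℝ) ξ a, L (c • ξ) a = c • L ξ a)
    (hL : ∀ ξ a, IsSmoothForm a → IsSmoothForm (L ξ a)) {f : EG → FormField E M j}
    (hf : f ∈ polyForms EG E M i j) : (fun ξ => L ξ (f ξ)) ∈ polyForms EG E M (i + 1) j' := by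
  induction hf using Submodule.span_induction with
  | mem f h =>
    obtain ⟨p, β, hβ, rfl⟩ := h
    let b := Module.finBasis ℝ EG
    let Lβ : EG →ₗ[ℝ] FormField E M j' :=
      { toFun := fun ξ => L ξ β, map_add' := fun ξ η => hadd' ξ η β,
        map_smul' := fun c ξ => hsmul' c ξ β }
    -- Expanding L ξ β in a basis of 𝔤 exhibits each coordinate functional as the additional linear
    -- factor of the polynomial.
    have h : (fun ξ => L ξ ((∏ s, p s ξ) • β)) =
        ∑ a, fun ξ => (∏ s, (Fin.cons (LinearMap.toContinuousLinearMap (b.coord a)) p :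
          Fin (i + 1) → EG →L[ℝ] ℝ) s ξ) • L (b a) β := by
      funext ξ
      rw [Finset.sum_apply, hsmul]
      have h1 : L ξ β = ∑ a, b.coord a ξ • L (b a) β := by
        have : Lβ ξ = Lβ (∑ a, b.coord a ξ • b a) := by
          simp only [Module.Basis.coord_apply, b.sum_repr]
        rw [_root_.map_sum] at this
        simp only [_root_.map_smul] at this
        exact this
      rw [h1, Finset.smul_sum]
      refine Finset.sum_congr rfl fun a _ => ?_
      rw [Fin.prod_univ_succ]
      simp only [Fin.cons_zero, Fin.cons_succ, LinearMap.coe_toContinuousLinearMap']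
      rw [smul_smul, mul_comm]
    rw [h]
    exact Submodule.sum_mem _ fun a _ => Submodule.subset_span ⟨_, _, hL _ _ hβ, rfl⟩
  | zero =>
    have h : ∀ ξ, L ξ 0 = 0 := fun ξ => by simpa using hsmul ξ 0 0
    simp only [Pi.zero_apply, h]
    exact Submodule.zero_mem _
  | add f g hf' hg' hf hg =>
    convert Submodule.add_mem _ hf hg using 1
    funext ξ
    exact hadd _ _ _
  | smul c f _ hf =>
    convert Submodule.smul_mem _ c hf using 1
    funext ξ
    exact hsmul _ _ _

end PolyForms

/-! ## The Cartan differential -/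

section CartanD

variable {EG E : Type*} [NormedAddCommGroup EG] [NormedSpace ℝ EG] [FiniteDimensional ℝ EG]
  [NormedAddCommGroup E] [NormedSpace ℝ E] [FiniteDimensional ℝ E]
  {G : Type*} [TopologicalSpace G] [ChartedSpace EG G] [Group G] [LieGroup 𝓘(ℝ, EG) ∞ G]
  {M : Type*} [TopologicalSpace M] [ChartedSpace E M] [IsManifold 𝓘(ℝ, E) ∞ M] [MulAction G M]
  [ContMDiffSMul 𝓘(ℝ, EG) 𝓘(ℝ, E) ∞ G M]

theorem tmap_chart_symm_tmap_chart {x₀ : M} {z : E} (hz : z ∈ (extChartAt 𝓘(ℝ, E) x₀).target) :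
    (tmap E E (extChartAt 𝓘(ℝ, E) x₀).symm z).comp
      (tmap E E (extChartAt 𝓘(ℝ, E) x₀) ((extChartAt 𝓘(ℝ, E) x₀).symm z)) =
      ContinuousLinearMap.id ℝ E := by
  have h := tmap_chart_symm_comp ((extChartAt 𝓘(ℝ, E) x₀).map_target hz)
  rwa [(extChartAt 𝓘(ℝ, E) x₀).right_inv hz] at h

theorem curryLeft_compContinuousLinearMap_apply {F : Type*} [NormedAddCommGroup F]
    [NormedSpace ℝ F] {k : ℕ} (b : F [⋀^Fin (k + 1)]→L[ℝ] ℝ) (A : E →L[ℝ] F) (X : E) :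
    (b.compContinuousLinearMap A).curryLeft X =
      (b.curryLeft (A X)).compContinuousLinearMap A := by
  ext v
  simp only [curryLeft_apply_apply, compContinuousLinearMap_apply]
  congr 1
  funext s
  refine Fin.cases ?_ (fun s => ?_) s <;> simp

theorem chartRep_insertion_fundamental {k : ℕ} (β : FormField E M (k + 1)) (ξ : EG) {x₀ : M}
    {z : E} (hz : z ∈ (extChartAt 𝓘(ℝ, E) x₀).target) :
    chartRep (insertion (fun x => fundamental EG E G x ξ) β) x₀ z =
      (chartRep β x₀ z).curryLeft (fundamentalRep EG E G x₀ z ξ) := by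
  have h : tmap E E (extChartAt 𝓘(ℝ, E) x₀).symm z (fundamentalRep EG E G x₀ z ξ) =
      fundamental EG E G ((extChartAt 𝓘(ℝ, E) x₀).symm z) ξ :=
    congrArg (fun T : E →L[ℝ] E => T _) (tmap_chart_symm_tmap_chart hz)
  rw [chartRep, chartRep, pullback, pullback, curryLeft_compContinuousLinearMap_apply, h]
  rfl

theorem IsSmoothForm.insertion_fundamental {k : ℕ} {β : FormField E M (k + 1)}
    (hβ : IsSmoothForm β) (ξ : EG) :
    IsSmoothForm (insertion (fun x => fundamental EG E G x ξ) β) := by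
  intro x₀
  refine ContDiffOn.congr (f := fun z => (chartRep β x₀ z).curryLeft
    (fundamentalRep EG E G x₀ z ξ)) ?_ fun z hz => chartRep_insertion_fundamental β ξ hz
  intro z hz
  have h1 := ((hβ x₀).contDiffAt (extChartAt_target_mem_nhds' hz)).curryLeft
  have h2 := (contDiffAt_fundamentalRep (G := G) (EG := EG) hz).clm_apply
    (contDiffAt_const (c := ξ))
  exact (h1.clm_apply h2).contDiffWithinAt

/-- Cartan's formula together with the vanishing Lie derivative of `infinitesimal_invariance`. The
field and the form carry the same ξ, which that vanishing requires. -/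
theorem extD_insertion_add_insertion_extD {k : ℕ} {α : EG → FormField E M (k + 1)}
    (hinv : ∀ (g : G) ξ, α (Ad EG g ξ) = pullback (fun x : M => g⁻¹ • x) (α ξ)) {ξ : EG}
    (hs : IsSmoothForm (α ξ)) (hd : ∀ x, DifferentiableAt ℝ (fun η => α η x) ξ) :
    extD (insertion (fun x => fundamental EG E G x ξ) (α ξ)) +
      insertion (fun x => fundamental EG E G x ξ) (extD (α ξ)) = 0 := by
  funext x
  have hz := mem_extChartAt_target (I := 𝓘(ℝ, E)) x
  have h1 : chartRep (insertion (fun x => fundamental EG E G x ξ) (α ξ)) x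
      =ᶠ[𝓝 (extChartAt 𝓘(ℝ, E) x x)] fun z =>
        (chartRep (α ξ) x z).curryLeft (fundamentalRep EG E G x z ξ) := by
    filter_upwards [extChartAt_target_mem_nhds (I := 𝓘(ℝ, E)) x] with z hz
      using chartRep_insertion_fundamental _ ξ hz
  have h2 := (contDiffAt_fundamentalRep (G := G) (EG := EG) hz).clm_apply
    (contDiffAt_const (c := ξ))
  have h3 := extDeriv_curryLeft_add (hs.differentiableAt x) (h2.differentiableAt (by simp))
  rw [infinitesimal_invariance hinv hs (hd x), fundamentalRep_self] at h3
  rw [FormField.add_apply, extD, h1.extDeriv_eq, FormField.zero_apply]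
  exact h3

theorem insertion_extD_eq_zero {α : EG → FormField E M 0}
    (hinv : ∀ (g : G) ξ, α (Ad EG g ξ) = pullback (fun x : M => g⁻¹ • x) (α ξ)) {ξ : EG}
    (hs : IsSmoothForm (α ξ)) (hd : ∀ x, DifferentiableAt ℝ (fun η => α η x) ξ) :
    insertion (fun x => fundamental EG E G x ξ) (extD (α ξ)) = 0 := by
  funext x
  have h3 := infinitesimal_invariance hinv hs (hd x)
  rw [← curryLeft_extDeriv_zero, fundamentalRep_self] at h3
  exact h3

theorem insertion_insertion (X : M → E) {k : ℕ} (β : FormField E M (k + 2)) :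
    insertion X (insertion X β) = 0 := by
  funext x
  ext v
  rw [insertion, curryLeft_apply_apply, insertion, curryLeft_apply_apply]
  exact (β x).map_eq_zero_of_eq _ (i := 0) (j := 1) (by simp) (by simp)

variable {k : ℕ} {α : CartanField EG E M}

theorem cartanForms.isSmoothForm (hα : α ∈ cartanForms EG E G M k) (i j : ℕ) (ξ : EG) :
    IsSmoothForm (α i j ξ) :=
  polyForms.isSmoothForm (hα.1 i j) ξ

/-- Both d² and i_•² vanish, and the cross terms form the Lie derivative of α(ξ) along X_ξ, which is
zero by invariance. The cases of low degree are separate only because one part of the differential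
is absent there. -/
theorem cartanD_cartanD (hα : α ∈ cartanForms EG E G M k) : cartanD G (cartanD G α) = 0 := by
  have hs := cartanForms.isSmoothForm hα
  have hd : ∀ i j ξ x, DifferentiableAt ℝ (fun η => α i j η x) ξ := fun i j ξ x =>
    polyForms.differentiable (hα.1 i j) x ξ
  have hinv := hα.2.2
  funext i j ξ
  simp only [cartanD, Pi.add_apply, Pi.zero_apply]
  rcases i with _ | i <;> rcases j with _ | _ | j
  · simp [cartanDeRham, cartanInsertion]
  · simp only [cartanDeRham, cartanInsertion, Pi.add_apply, Pi.zero_apply, add_zero, extD_zero]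
  · simp only [cartanDeRham, cartanInsertion, Pi.add_apply, Pi.zero_apply, add_zero]
    exact extD_extD (hs _ _ _)
  · simp only [cartanDeRham, cartanInsertion, Pi.add_apply, Pi.zero_apply, zero_add]
    rcases i with _ | i
    · simp only [Pi.zero_apply, add_zero]
      exact insertion_extD_eq_zero (hinv 0 0) (hs _ _ _) (hd _ _ _)
    · rw [insertion_add, insertion_insertion, add_zero]
      exact insertion_extD_eq_zero (hinv _ 0) (hs _ _ _) (hd _ _ _)
  · simp only [cartanDeRham, cartanInsertion, Pi.add_apply, Pi.zero_apply, zero_add]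
    rcases i with _ | i
    · simp only [Pi.zero_apply, add_zero]
      exact extD_insertion_add_insertion_extD (hinv 0 1) (hs _ _ _) (hd _ _ _)
    · rw [insertion_add, insertion_insertion, add_zero]
      exact extD_insertion_add_insertion_extD (hinv _ 1) (hs _ _ _) (hd _ _ _)
  · simp only [cartanDeRham, cartanInsertion, Pi.add_apply]
    rw [extD_add (hs _ _ _).extD ((hs _ _ _).insertion_fundamental ξ), extD_extD (hs _ _ _),
      zero_add]
    rcases i with _ | i
    · simp only [Pi.zero_apply, add_zero]
      exact extD_insertion_add_insertion_extD (hinv 0 (j + 2)) (hs _ _ _) (hd _ _ _)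
    · rw [insertion_add, insertion_insertion, add_zero]
      exact extD_insertion_add_insertion_extD (hinv _ (j + 2)) (hs _ _ _) (hd _ _ _)

theorem tmap_smul_inv_comp (EG : Type*) {E : Type*} [NormedAddCommGroup EG] [NormedSpace ℝ EG]
    [NormedAddCommGroup E] [NormedSpace ℝ E]
    {G : Type*} [TopologicalSpace G] [ChartedSpace EG G] [Group G]
    {M : Type*} [TopologicalSpace M] [ChartedSpace E M] [MulAction G M]
    [ContMDiffSMul 𝓘(ℝ, EG) 𝓘(ℝ, E) ∞ G M] (g : G) (x : M) :
    (tmap E E (fun y : M => g⁻¹ • y) x).comp (tmap E E (fun y : M => g • y) (g⁻¹ • x)) =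
      ContinuousLinearMap.id ℝ E := by
  have h := tmap_comp (g := fun y : M => g⁻¹ • y) (f := fun y : M => g • y) (x := g⁻¹ • x)
    (contMDiff_smul_left EG E g⁻¹ _).mdiff (contMDiff_smul_left EG E g _).mdiff
  simp only [inv_smul_smul, smul_inv_smul, tmap_id] at h
  exact h.symm

theorem cartanDeRham_mem (hα : α ∈ cartanForms EG E G M k) :
    cartanDeRham α ∈ cartanForms EG E G M (k + 1) := by
  refine ⟨fun i j => ?_, fun i j h => ?_, fun i j g ξ => ?_⟩ <;> rcases j with _ | j
  · exact Submodule.zero_mem _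
  · exact polyForms.map (fun β => extD β) (fun a b ha hb => extD_add ha hb)
      (fun c a => extD_smul c a) (fun a ha => ha.extD) (hα.1 i j)
  · rfl
  · funext ξ
    simp only [cartanDeRham, hα.2.1 i j (by omega)]
    exact extD_zero
  · exact (pullback_zero _).symm
  · funext x
    simp only [cartanDeRham, hα.2.2]
    exact extD_pullback (contMDiff_smul_left EG E g⁻¹ x)
      (isSmoothForm_iff.1 (cartanForms.isSmoothForm hα i j ξ) _)

theorem cartanInsertion_mem (hα : α ∈ cartanForms EG E G M k) :
    cartanInsertion G α ∈ cartanForms EG E G M (k + 1) := by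
  refine ⟨fun i j => ?_, fun i j h => ?_, fun i j g ξ => ?_⟩ <;> rcases i with _ | i
  · exact Submodule.zero_mem _
  · refine polyForms.mul (fun ξ β => insertion (fun x => fundamental EG E G x ξ) β)
      (fun _ _ _ => insertion_add _ _ _) (fun _ _ _ => insertion_smul _ _ _) ?_ ?_
      (fun ξ a ha => ha.insertion_fundamental ξ) (hα.1 i (j + 1))
    · intro ξ η a
      funext x
      simp [insertion, FormField.add_apply]
    · intro c ξ a
      funext x
      simp [insertion, FormField.smul_apply]
  · rfl
  · funext ξ
    simp only [cartanInsertion, hα.2.1 i (j + 1) (by omega)]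
    funext x
    ext v
    simp [insertion, FormField.zero_apply]
  · exact (pullback_zero _).symm
  · funext x
    simp only [cartanInsertion, hα.2.2, insertion, pullback]
    rw [curryLeft_compContinuousLinearMap_apply, fundamental_Ad_apply]
    congr 2
    exact congrArg (fun T : E →L[ℝ] E => T _) (tmap_smul_inv_comp EG g x)

theorem cartanD_mem (hα : α ∈ cartanForms EG E G M k) :
    cartanD G α ∈ cartanForms EG E G M (k + 1) :=
  Submodule.add_mem _ (cartanDeRham_mem hα) (cartanInsertion_mem hα)

end CartanD

/-! ## The vertical homotopy -/

section Homotopy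

variable {EG E : Type*} [NormedAddCommGroup EG] [NormedSpace ℝ EG] [FiniteDimensional ℝ EG]
  [NormedAddCommGroup E] [NormedSpace ℝ E] [FiniteDimensional ℝ E]
  {G : Type*} [TopologicalSpace G] [ChartedSpace EG G] [Group G] [LieGroup 𝓘(ℝ, EG) ∞ G]
  {M : Type*} [TopologicalSpace M] [ChartedSpace E M] [IsManifold 𝓘(ℝ, E) ∞ M] [MulAction G M]
  [ContMDiffSMul 𝓘(ℝ, EG) 𝓘(ℝ, E) ∞ G M] (θ : PrincipalConnection EG E G M)
  {k : ℕ} {α : CartanField EG E M}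

theorem FormField.sum_apply {E : Type*} [NormedAddCommGroup E] [NormedSpace ℝ E] {M : Type*}
    {j : ℕ} {S : Type*} (t : Finset S) (f : S → FormField E M j) (x : M) :
    (∑ s ∈ t, f s) x = ∑ s ∈ t, f s x :=
  Finset.sum_apply (M := fun _ => E [⋀^Fin j]→L[ℝ] ℝ) x t f

namespace PrincipalConnection

/-- The connection form in the chart at `x₀`. -/
noncomputable def formRep (x₀ : M) (z : E) : E →L[ℝ] EG :=
  (θ.form ((extChartAt 𝓘(ℝ, E) x₀).symm z)).comp (tmap E E (extChartAt 𝓘(ℝ, E) x₀).symm z)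

theorem contDiffAt_formRep {x₀ : M} {z : E} (hz : z ∈ (extChartAt 𝓘(ℝ, E) x₀).target) :
    ContDiffAt ℝ ∞ (θ.formRep x₀) z :=
  (θ.smooth x₀).contDiffAt (extChartAt_target_mem_nhds' hz)

theorem normalize_apply (α : CartanField EG E M) (i j : ℕ) (ξ : EG) (x : M) :
    θ.normalize α i j ξ x = divDegree (θ.vert x) i (α i j ξ x) := rfl

theorem vert_fundamental (x : M) (ξ : EG) :
    θ.vert x (fundamental EG E G x ξ) = fundamental EG E G x ξ :=
  congrArg (fundamental EG E G x) (θ.vertical x ξ)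

theorem vert_comp_vert (x : M) : (θ.vert x).comp (θ.vert x) = θ.vert x := by
  ext v
  exact θ.vert_fundamental x (θ.form x v)

theorem vert_comp_tmap_chart_symm {x₀ : M} {z : E}
    (hz : z ∈ (extChartAt 𝓘(ℝ, E) x₀).target) :
    (θ.vert ((extChartAt 𝓘(ℝ, E) x₀).symm z)).comp (tmap E E (extChartAt 𝓘(ℝ, E) x₀).symm z) =
      (tmap E E (extChartAt 𝓘(ℝ, E) x₀).symm z).comp
        ((fundamentalRep EG E G x₀ z).comp (θ.formRep x₀ z)) := by
  ext v
  exact (congrArg (fun T : E →L[ℝ] E => T _) (tmap_chart_symm_tmap_chart hz)).symm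

/-- The connection form and the fundamental fields are both equivariant, and their Ad factors
cancel. Hence the vertical degree is preserved by G and `normalize` respects invariance. -/
theorem vert_comp_tmap_smul (g : G) (x : M) :
    (θ.vert (g⁻¹ • x)).comp (tmap E E (fun y : M => g⁻¹ • y) x) =
      (tmap E E (fun y : M => g⁻¹ • y) x).comp (θ.vert x) := by
  ext v
  have h := congrArg (fun T : E →L[ℝ] EG => T v) (θ.equivariant g x)
  simp only [vert, ContinuousLinearMap.comp_apply] at h ⊢
  rw [← h, fundamental_Ad_apply]
  exact (congrArg (fun T : E →L[ℝ] E => T _) (tmap_smul_inv_comp EG g x)).symm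

theorem isSmoothForm_divDegree (i : ℕ) {j : ℕ} {β : FormField E M j} (hβ : IsSmoothForm β) :
    IsSmoothForm (fun x => divDegree (θ.vert x) i (β x) : FormField E M j) := by
  intro x₀
  refine ContDiffOn.congr (f := fun z => divDegree
    ((fundamentalRep EG E G x₀ z).comp (θ.formRep x₀ z)) i (chartRep β x₀ z)) ?_ fun z hz =>
      divDegree_compContinuousLinearMap _ _ _ (θ.vert_comp_tmap_chart_symm hz) _ _
  intro z hz
  exact (ContDiffAt.divDegree i ((contDiffAt_fundamentalRep hz).clm_comp (θ.contDiffAt_formRep hz))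
    ((hβ x₀).contDiffAt (extChartAt_target_mem_nhds' hz))).contDiffWithinAt

theorem normalize_mem (hα : α ∈ cartanForms EG E G M k) :
    θ.normalize α ∈ cartanForms EG E G M k := by
  refine ⟨fun i j => ?_, fun i j h => ?_, fun i j g ξ => ?_⟩
  · refine polyForms.map (fun β x => divDegree (θ.vert x) i (β x)) ?_ ?_
      (fun a ha => θ.isSmoothForm_divDegree i ha) (hα.1 i j)
    · intro a b _ _
      funext x
      exact _root_.map_add (divDegree (θ.vert x) i) (a x) (b x)
    · intro c a
      funext x
      exact _root_.map_smul (divDegree (θ.vert x) i) c (a x)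
  · funext ξ x
    rw [normalize_apply, hα.2.1 i j h]
    exact _root_.map_zero (divDegree (θ.vert x) i)
  · funext x
    rw [normalize_apply, hα.2.2]
    exact (divDegree_compContinuousLinearMap _ _ _ (θ.vert_comp_tmap_smul g x) _ _).symm

/-- The wedge product `(p ∘ θ) ∧ β`. -/
noncomputable def wedge (p : EG →L[ℝ] ℝ) {j : ℕ} (β : FormField E M j) : FormField E M (j + 1) :=
  fun x => alternatizeUncurryFin ((p.comp (θ.form x)).smulRight (β x))

theorem isSmoothForm_wedge (p : EG →L[ℝ] ℝ) {j : ℕ} {β : FormField E M j} (hβ : IsSmoothForm β) :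
    IsSmoothForm (θ.wedge p β) := by
  intro x₀
  refine ContDiffOn.congr (f := fun z => alternatizeUncurryFin
    ((p.comp (θ.formRep x₀ z)).smulRight (chartRep β x₀ z))) ?_ fun z hz => ?_
  · intro z hz
    let L : (E →L[ℝ] E [⋀^Fin j]→L[ℝ] ℝ) →L[ℝ] (E [⋀^Fin (j + 1)]→L[ℝ] ℝ) :=
      alternatizeUncurryFinCLM ℝ E ℝ
    have hL : ContDiff ℝ ∞ L := by fun_prop
    have h1 : ContDiffAt ℝ ∞ (fun z => (p.comp (θ.formRep x₀ z)).smulRight (chartRep β x₀ z)) z :=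
      ContDiffAt.smulRight (contDiffAt_const.clm_comp (θ.contDiffAt_formRep hz))
        ((hβ x₀).contDiffAt (extChartAt_target_mem_nhds' hz))
    exact (hL.contDiffAt.comp z h1).contDiffWithinAt
  · rw [chartRep, pullback, wedge, alternatizeUncurryFin_compContinuousLinearMap]
    rfl

/-- On a generator the product rule gives the sum over s of the product of the other factors times
p_s(θ) ∧ β, which lies in the span again. The operator is linear only on maps that are
differentiable in ξ, so the induction carries membership in `polyForms` along. -/
theorem rawHomotopy_mem_polyForms {α : CartanField EG E M} {i j : ℕ}
    (h : α (i + 1) j ∈ polyForms EG E M (i + 1) j) :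
    θ.rawHomotopy α i (j + 1) ∈ polyForms EG E M i (j + 1) := by
  let H : (EG → FormField E M j) → EG → FormField E M (j + 1) := fun f ξ x =>
    alternatizeUncurryFin ((fderiv ℝ (fun η : EG => f η x) ξ).comp (θ.form x))
  change H (α (i + 1) j) ∈ _
  generalize α (i + 1) j = f at h
  induction h using Submodule.span_induction with
  | mem f h =>
    obtain ⟨p, β, hβ, rfl⟩ := h
    have h1 : H (fun ξ => (∏ s, p s ξ) • β) =
        ∑ s, fun ξ => (∏ t, p (s.succAbove t) ξ) • θ.wedge (p s) β := by
      funext ξ x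
      have h2 : fderiv ℝ (fun η : EG => ((∏ s, p s η) • β) x) ξ = _ :=
        (hasFDerivAt_prod_smul p (β x) ξ).fderiv
      simp only [H]
      rw [h2]
      let L : (EG →L[ℝ] E [⋀^Fin j]→L[ℝ] ℝ) →ₗ[ℝ] (E [⋀^Fin (j + 1)]→L[ℝ] ℝ) :=
        (alternatizeUncurryFinCLM ℝ E ℝ).toLinearMap ∘ₗ
          ((ContinuousLinearMap.compL ℝ E EG (E [⋀^Fin j]→L[ℝ] ℝ)).flip (θ.form x)).toLinearMap
      have h3 : L (∑ s, (∏ t, p (s.succAbove t) ξ) • (p s).smulRight (β x)) =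
          ∑ s, (∏ t, p (s.succAbove t) ξ) • L ((p s).smulRight (β x)) := by
        rw [_root_.map_sum]
        simp only [_root_.map_smul]
      refine h3.trans ?_
      rw [Finset.sum_apply]
      exact (FormField.sum_apply (E := E) Finset.univ
        (fun s => (∏ t, p (s.succAbove t) ξ) • θ.wedge (p s) β) x).symm
    rw [h1]
    exact Submodule.sum_mem _ fun s _ =>
      Submodule.subset_span ⟨_, _, θ.isSmoothForm_wedge _ hβ, rfl⟩
  | zero =>
    have h1 : H 0 = 0 := by
      funext ξ x
      have h2 : fderiv ℝ (fun η : EG => (0 : EG → FormField E M j) η x) ξ = 0 :=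
        (hasFDerivAt_const (0 : E [⋀^Fin j]→L[ℝ] ℝ) ξ).fderiv
      simp only [H]
      rw [h2, ContinuousLinearMap.zero_comp]
      exact _root_.map_zero (alternatizeUncurryFinCLM ℝ E ℝ)
    rw [h1]
    exact Submodule.zero_mem _
  | add f g hf' hg' hf hg =>
    have h1 : H (f + g) = H f + H g := by
      funext ξ x
      have h2 : fderiv ℝ (fun η : EG => (f + g) η x) ξ = _ :=
        (((polyForms.differentiable hf' x) ξ).hasFDerivAt.add
        ((polyForms.differentiable hg' x) ξ).hasFDerivAt).fderiv
      simp only [H]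
      rw [h2, ContinuousLinearMap.add_comp]
      exact _root_.map_add (alternatizeUncurryFinCLM ℝ E ℝ) _ _
    rw [h1]
    exact Submodule.add_mem _ hf hg
  | smul c f hf' hf =>
    have h1 : H (c • f) = c • H f := by
      funext ξ x
      have h2 : fderiv ℝ (fun η : EG => (c • f) η x) ξ = _ :=
        (((polyForms.differentiable hf' x) ξ).hasFDerivAt.const_smul c).fderiv
      simp only [H]
      rw [h2, ContinuousLinearMap.smul_comp]
      exact _root_.map_smul (alternatizeUncurryFinCLM ℝ E ℝ) _ _
    rw [h1]
    exact Submodule.smul_mem _ c hf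

theorem rawHomotopy_eq_zero {i j : ℕ} (h : α (i + 1) j = 0) :
    θ.rawHomotopy α i (j + 1) = 0 := by
  funext ξ x
  have h2 : fderiv ℝ (fun η : EG => α (i + 1) j η x) ξ = 0 := by
    rw [h]
    exact (hasFDerivAt_const (0 : E [⋀^Fin j]→L[ℝ] ℝ) ξ).fderiv
  simp only [rawHomotopy]
  rw [h2, ContinuousLinearMap.zero_comp]
  exact _root_.map_zero (alternatizeUncurryFinCLM ℝ E ℝ)

theorem rawHomotopy_mem (hα : α ∈ cartanForms EG E G M (k + 1)) :
    θ.rawHomotopy α ∈ cartanForms EG E G M k := by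
  refine ⟨fun i j => ?_, fun i j h => ?_, fun i j g ξ => ?_⟩ <;> rcases j with _ | j
  · exact Submodule.zero_mem _
  · exact θ.rawHomotopy_mem_polyForms (hα.1 (i + 1) j)
  · rfl
  · exact θ.rawHomotopy_eq_zero (hα.2.1 _ _ (by omega))
  · exact (pullback_zero _).symm
  · funext x
    simp only [rawHomotopy, pullback]
    rw [alternatizeUncurryFin_compContinuousLinearMap, ← θ.equivariant g x]
    congr 1
    set T := tmap E E (fun y : M => g⁻¹ • y) x
    have hd := fun y => polyForms.differentiable (hα.1 (i + 1) j) y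
    -- Differentiating both sides of the invariance identity in η yields an equation between Dα ∘
    -- Ad_g and the pullback of Dα. Equivariance of θ supplies the Ad_g.
    have h1 : (fun η => α (i + 1) j (Ad EG g η) x) = fun η =>
        compContinuousLinearMapCLM T (α (i + 1) j η (g⁻¹ • x)) := by
      funext η
      rw [hα.2.2]
      rfl
    have h2 : HasFDerivAt (fun η => α (i + 1) j (Ad EG g η) x)
        ((fderiv ℝ (fun η => α (i + 1) j η x) (Ad EG g ξ)).comp (Ad EG g)) ξ :=
      ((hd x) (Ad EG g ξ)).hasFDerivAt.comp ξ (Ad EG g).hasFDerivAt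
    have h3 : HasFDerivAt (fun η =>
        compContinuousLinearMapCLM T (α (i + 1) j η (g⁻¹ • x)))
        ((compContinuousLinearMapCLM T).comp
          (fderiv ℝ (fun η => α (i + 1) j η (g⁻¹ • x)) ξ)) ξ :=
      HasFDerivAt.comp (𝕜 := ℝ) (E := EG) (F := E [⋀^Fin j]→L[ℝ] ℝ) (G := E [⋀^Fin j]→L[ℝ] ℝ) ξ
        (ContinuousLinearMap.hasFDerivAt (𝕜 := ℝ) (E := E [⋀^Fin j]→L[ℝ] ℝ)
          (F := E [⋀^Fin j]→L[ℝ] ℝ) (compContinuousLinearMapCLM T))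
        ((hd (g⁻¹ • x)) ξ).hasFDerivAt
    rw [h1] at h2
    have h4 := h2.unique h3
    rw [← ContinuousLinearMap.comp_assoc, h4]
    rfl

theorem homotopy_mem (hα : α ∈ cartanForms EG E G M (k + 1)) :
    θ.homotopy α ∈ cartanForms EG E G M k :=
  θ.rawHomotopy_mem (θ.normalize_mem hα)

theorem normalize_eq_zero {i j : ℕ} (h : α i j = 0) : θ.normalize α i j = 0 := by
  funext ξ x
  rw [normalize_apply, h]
  exact _root_.map_zero (divDegree (θ.vert x) i)

theorem homotopy_eq_zero {i j : ℕ} (h : α (i + 1) j = 0) : θ.homotopy α i (j + 1) = 0 :=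
  θ.rawHomotopy_eq_zero (θ.normalize_eq_zero h)

theorem homotopy_eq_zero_of_mem (hα : α ∈ cartanForms EG E G M 0) : θ.homotopy α = 0 := by
  funext i j
  rcases j with _ | j
  · rfl
  · exact θ.homotopy_eq_zero (hα.2.1 _ _ (by omega))

/-- In positive symmetric degree the homotopy inverts insertion of fundamental fields. -/
theorem cartanInsertion_homotopy_add (hα : α ∈ cartanForms EG E G M k) (i j : ℕ) :
    cartanInsertion G (θ.homotopy α) (i + 1) j + θ.homotopy (cartanInsertion G α) (i + 1) j =
      α (i + 1) j := by
  have hN := θ.normalize_mem hα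
  funext ξ x
  have hd : HasFDerivAt (fun η => θ.normalize α (i + 1) j η x) _ ξ :=
    ((polyForms.differentiable (hN.1 (i + 1) j) x) ξ).hasFDerivAt
  -- Euler's identity contributes the factor i + 1, the symmetric degree.
  have he : fderiv ℝ (fun η => θ.normalize α (i + 1) j η x) ξ ξ = ((i : ℝ) + 1) •
      divDegree (θ.vert x) (i + 1) (α (i + 1) j ξ x) := by
    rw [polyForms.fderiv_self (hN.1 (i + 1) j) x ξ, normalize_apply]
    push_cast
    rfl
  have hsplit := smul_add_fderivCompContinuousLinearMap_divDegree (θ.vert_comp_vert x) i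
    (α (i + 1) j ξ x)
  have hX : θ.form x (fundamental EG E G x ξ) = ξ := θ.vertical x ξ
  rw [Pi.add_apply, FormField.add_apply]
  simp only [cartanInsertion, homotopy, insertion, rawHomotopy]
  rcases j with _ | j
  · rw [curryLeft_alternatizeUncurryFin_zero, ContinuousLinearMap.comp_apply, hX, he]
    rw [fderivCompContinuousLinearMap_of_isEmpty] at hsplit
    exact hsplit
  · rw [curryLeft_alternatizeUncurryFin, ContinuousLinearMap.comp_apply, hX, he]
    set F := θ.normalize α (i + 1) (j + 1) with hF
    -- Normalization commutes with insertion because i + q is the same before and after.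
    have h1 : (fun η => θ.normalize (cartanInsertion G α) (i + 1 + 1) j η x) = fun η =>
        (F η x).curryLeft (fundamental EG E G x η) := by
      funext η
      rw [normalize_apply, hF, normalize_apply]
      exact (curryLeft_divDegree (i + 1) _ (θ.vert_fundamental x η)).symm
    -- The argument η occurs both in the form and in the fundamental field. The first term of the
    -- product rule cancels the correction in the Leibniz rule for insertion; the second becomes the
    -- derivation by the vertical projection, which contributes the factor q.
    have h4 : fderiv ℝ (fun η => (F η x).curryLeft (fundamental EG E G x η)) ξ = _ :=
      (hasFDerivAt_curryLeft hd (fundamental EG E G x).hasFDerivAt).fderiv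
    change _ - _ + alternatizeUncurryFin ((fderiv ℝ
      (fun η => θ.normalize (cartanInsertion G α) (i + 1 + 1) j η x) ξ).comp (θ.form x)) = _
    rw [h1, h4]
    rw [ContinuousLinearMap.add_comp]
    have h5 (S T : E →L[ℝ] E [⋀^Fin j]→L[ℝ] ℝ) : alternatizeUncurryFin (S + T) =
      alternatizeUncurryFin S + alternatizeUncurryFin T :=
        _root_.map_add (alternatizeUncurryFinCLM ℝ E ℝ) S T
    rw [h5]
    have h6 : alternatizeUncurryFin (((F ξ x).curryLeft.comp (fundamental EG E G x)).comp
        (θ.form x)) = (F ξ x).fderivCompContinuousLinearMap (.id ℝ E) (θ.vert x) :=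
      alternatizeUncurryFin_comp_eq_fderivCompContinuousLinearMap (F ξ x) (θ.vert x)
    rw [h6, ContinuousLinearMap.comp_assoc]
    have h9 : F ξ x = divDegree (θ.vert x) (i + 1) (α (i + 1) (j + 1) ξ x) := rfl
    rw [h9]
    refine Eq.trans ?_ hsplit
    abel

/-! ### The map φ and its iterates. -/

theorem phi_mem (hα : α ∈ cartanForms EG E G M k) : θ.phi α ∈ cartanForms EG E G M k := by
  rcases k with _ | k
  · rw [phi, θ.homotopy_eq_zero_of_mem hα, cartanD_zero, sub_zero]
    exact hα
  · exact Submodule.sub_mem _ hα (cartanD_mem (θ.homotopy_mem hα))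

theorem sub_phi_mem_exactCartan (hα : α ∈ cartanForms EG E G M k) :
    α - θ.phi α ∈ exactCartan EG E G M k := by
  rw [phi, sub_sub_cancel]
  rcases k with _ | k
  · rw [θ.homotopy_eq_zero_of_mem hα, cartanD_zero]
    exact Submodule.zero_mem _
  · exact ⟨θ.homotopy α, θ.homotopy_mem hα, rfl⟩

theorem _root_.Kirwan.cartanD_of_mem_exactCartan (hα : α ∈ exactCartan EG E G M k) :
    cartanD G α = 0 := by
  rcases k with _ | k
  · rw [(Submodule.mem_bot ℝ).1 hα, cartanD_zero]
  · obtain ⟨γ, hγ, rfl⟩ := hα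
    exact cartanD_cartanD hγ

theorem _root_.Kirwan.mem_cartanForms_of_mem_exactCartan (hα : α ∈ exactCartan EG E G M k) :
    α ∈ cartanForms EG E G M k := by
  rcases k with _ | k
  · rw [(Submodule.mem_bot ℝ).1 hα]
    exact Submodule.zero_mem _
  · obtain ⟨γ, hγ, rfl⟩ := hα
    exact cartanD_mem hγ

theorem cartanD_phi (hα : α ∈ cartanForms EG E G M k) : cartanD G (θ.phi α) = cartanD G α := by
  have h1 := θ.sub_phi_mem_exactCartan hα
  have h2 := cartanD_add (mem_cartanForms_of_mem_exactCartan h1) (θ.phi_mem hα)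
  rw [sub_add_cancel, cartanD_of_mem_exactCartan h1, zero_add] at h2
  exact h2.symm

/-- `φ` lowers the symmetric degree of an equivariant form whose differential has symmetric degree
zero. -/
theorem phi_apply_eq_zero (hα : α ∈ cartanForms EG E G M k)
    (hd : ∀ i j, cartanD G α (i + 1) j = 0) {m : ℕ} (hm : ∀ i j, m < i + 1 → α (i + 1) j = 0)
    (i j : ℕ) (hi : m ≤ i + 1) : θ.phi α (i + 1) j = 0 := by
  have h1 := θ.cartanInsertion_homotopy_add hα i j
  -- The components of α in symmetric degree i + 2 vanish, so i_• applied to the part of degree i +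
  -- 1 is the whole component of d_𝔤α in symmetric degree i + 2, which is zero by `hd`.
  have h2 : θ.homotopy (cartanInsertion G α) (i + 1) j = 0 := by
    rcases j with _ | j
    · rfl
    · refine θ.homotopy_eq_zero ?_
      have h3 := hd (i + 1) j
      rw [cartanD, Pi.add_apply, Pi.add_apply] at h3
      have h4 : cartanDeRham α (i + 1 + 1) j = 0 := by
        rcases j with _ | j
        · rfl
        · funext ξ
          simp only [cartanDeRham, hm (i + 1) j (by omega)]
          exact extD_zero
      rwa [h4, zero_add] at h3
  rw [h2, add_zero] at h1
  -- The part of hα in symmetric degree i + 1 comes from α in symmetric degree i + 2 and so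
  -- vanishes: d contributes nothing at the top.
  have h5 : cartanDeRham (θ.homotopy α) (i + 1) j = 0 := by
    rcases j with _ | _ | j
    · rfl
    · funext ξ
      exact extD_zero
    · funext ξ
      simp only [cartanDeRham]
      rw [θ.homotopy_eq_zero (hm (i + 1) j (by omega))]
      exact extD_zero
  rw [phi, Pi.sub_apply, Pi.sub_apply, cartanD, Pi.add_apply, Pi.add_apply, h1, h5, zero_add,
    sub_self]

theorem iterate_phi (hα : α ∈ cartanForms EG E G M k) (n : ℕ) :
    θ.phi^[n] α ∈ cartanForms EG E G M k ∧ cartanD G (θ.phi^[n] α) = cartanD G α ∧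
      α - θ.phi^[n] α ∈ exactCartan EG E G M k := by
  induction n with
  | zero => exact ⟨hα, rfl, by simp⟩
  | succ n ih =>
    rw [Function.iterate_succ_apply']
    refine ⟨θ.phi_mem ih.1, (θ.cartanD_phi ih.1).trans ih.2.1, ?_⟩
    have := Submodule.add_mem _ ih.2.2 (θ.sub_phi_mem_exactCartan ih.1)
    rwa [sub_add_sub_cancel] at this

/-- Total degree k forces symmetric degree at most k/2, and each application of φ lowers this bound
by one while keeping the differential. -/
theorem iterate_phi_apply_eq_zero (hα : α ∈ cartanForms EG E G M k)
    (hd : ∀ i j, cartanD G α (i + 1) j = 0) {n : ℕ} (hn : k / 2 ≤ n) (i j : ℕ) :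
    θ.phi^[n] α (i + 1) j = 0 := by
  suffices h : ∀ n i j, k / 2 < i + 1 + n → θ.phi^[n] α (i + 1) j = 0 from h n i j (by omega)
  intro n
  induction n with
  | zero => exact fun i j h => hα.2.1 _ _ (by omega)
  | succ n ih =>
    intro i j h
    rw [Function.iterate_succ_apply']
    have h1 := θ.iterate_phi hα n
    exact θ.phi_apply_eq_zero h1.1 (fun i j => by rw [h1.2.1, hd])
      (m := k / 2 - n) (fun i j h => ih i j (by omega)) i j (by omega)

end PrincipalConnection

/-- Equivariant forms of symmetric degree zero are ordinary invariant forms. -/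
theorem eq_ofForm (hα : α ∈ cartanForms EG E G M k) (h : ∀ i j, α (i + 1) j = 0) :
    α = ofForm EG (α 0 k 0) := by
  funext i j ξ
  rcases i with _ | i
  · by_cases hj : j = k
    · subst hj
      simp only [ofForm, if_true, Pi.single_eq_same]
      exact polyForms.eq_const (hα.1 0 j) ξ
    · simp only [ofForm, if_true, Pi.single_eq_of_ne hj]
      rw [hα.2.1 0 j (by omega)]
      rfl
  · rw [h]
    simp [ofForm]

theorem pullback_smul_of_ofForm_mem {β : FormField E M k}
    (h : ofForm EG β ∈ cartanForms EG E G M k) (g : G) :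
    pullback (fun x : M => g • x) β = β := by
  have := h.2.2 0 k g⁻¹ 0
  simp only [ofForm, if_true, Pi.single_eq_same, inv_inv] at this
  exact this.symm

theorem isSmoothForm_of_ofForm_mem {β : FormField E M k}
    (h : ofForm EG β ∈ cartanForms EG E G M k) : IsSmoothForm β := by
  have := cartanForms.isSmoothForm h 0 k 0
  simpa [ofForm] using this

theorem ofForm_mem {β : FormField E M k} (hs : IsSmoothForm β)
    (hinv : ∀ g : G, pullback (fun x : M => g • x) β = β) :
    ofForm EG β ∈ cartanForms EG E G M k := by
  refine ⟨fun i j => ?_, fun i j h => ?_, fun i j g ξ => ?_⟩ <;> rcases i with _ | i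
  · by_cases hj : j = k
    · subst hj
      convert polyForms.const_mem (EG := EG) hs using 1
      funext ξ
      simp [ofForm]
    · convert Submodule.zero_mem _ using 1
      funext ξ
      simp [ofForm, Pi.single_eq_of_ne hj]
  · convert Submodule.zero_mem _ using 1
    funext ξ
    simp [ofForm]
  · funext ξ
    have hj : j ≠ k := by omega
    simp [ofForm, Pi.single_eq_of_ne hj]
  · funext ξ
    simp [ofForm]
  · by_cases hj : j = k
    · subst hj
      simp only [ofForm, if_true, Pi.single_eq_same, hinv]
    · simp only [ofForm, if_true, Pi.single_eq_of_ne hj, pullback_zero]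
  · simp [ofForm, pullback_zero]

/-- For a horizontal form i_• contributes nothing, so the Cartan differential reduces to d. -/
theorem cartanD_ofForm {β : FormField E M k}
    (hX : ∀ (x : M) (ξ : EG) (v : Fin k → E) (i : Fin k),
      v i = fundamental EG E G x ξ → β x v = 0) :
    cartanD G (ofForm EG β) = ofForm EG (extD β) := by
  funext i j ξ
  rw [cartanD, Pi.add_apply, Pi.add_apply, Pi.add_apply]
  rcases i with _ | i
  · rcases j with _ | j
    · simp [cartanDeRham, cartanInsertion, ofForm]
    · simp only [cartanDeRham, cartanInsertion, ofForm, if_true, Pi.zero_apply, add_zero]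
      by_cases hj : j = k
      · subst hj; simp
      · rw [Pi.single_eq_of_ne hj, Pi.single_eq_of_ne (by omega), extD_zero]
  · have h1 : cartanDeRham (ofForm EG β) (i + 1) j ξ = 0 := by
      rcases j with _ | j
      · rfl
      · simp [cartanDeRham, ofForm, extD_zero]
    have h2 : cartanInsertion G (ofForm EG β) (i + 1) j ξ = 0 := by
      funext x
      ext v
      simp only [cartanInsertion, insertion, curryLeft_apply_apply, ofForm]
      split_ifs with hi
      · by_cases hj : j + 1 = k
        · subst hj
          rw [Pi.single_eq_same, hX x ξ _ 0 (by simp)]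
          rfl
        · rw [Pi.single_eq_of_ne hj]; rfl
      · rfl
    rw [h1, h2]
    simp [ofForm]

theorem insertion_eq_zero_of_cartanD_ofForm {β : FormField E M (k + 1)}
    (h : ∀ i j, cartanD G (ofForm EG β) (i + 1) j = 0) (x : M) (ξ : EG) :
    (β x).curryLeft (fundamental EG E G x ξ) = 0 := by
  have h1 := congrFun (congrFun (h 0 k) ξ) x
  rw [cartanD, Pi.add_apply, Pi.add_apply, Pi.add_apply, FormField.add_apply] at h1
  have h2 : cartanDeRham (ofForm EG β) (0 + 1) k ξ = 0 := by
    rcases k with _ | k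
    · rfl
    · simp [cartanDeRham, ofForm, extD_zero]
  rw [h2] at h1
  have h3 : cartanInsertion G (ofForm EG β) (0 + 1) k ξ x =
      (β x).curryLeft (fundamental EG E G x ξ) := by
    simp [cartanInsertion, insertion, ofForm]
  rw [h3, FormField.zero_apply, zero_add] at h1
  exact h1

/-- In total degree at most two, the division by the total polynomial degree is trivial. -/
theorem PrincipalConnection.homotopy_eq_rawHomotopy (hk : k ≤ 2)
    (hα : α ∈ cartanForms EG E G M k) : θ.homotopy α = θ.rawHomotopy α := by
  funext i j
  rcases j with _ | j
  · rfl
  · by_cases h : α (i + 1) j = 0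
    · rw [θ.homotopy_eq_zero h, θ.rawHomotopy_eq_zero h]
    · have hij : i = 0 ∧ j = 0 := by
        by_contra h2
        exact h (hα.2.1 _ _ (by omega))
      obtain ⟨rfl, rfl⟩ := hij
      have h1 : θ.normalize α (0 + 1) 0 = α (0 + 1) 0 := by
        funext ξ x
        have h2 := smul_add_fderivCompContinuousLinearMap_divDegree (θ.vert_comp_vert x) 0
          (α (0 + 1) 0 ξ x)
        rw [fderivCompContinuousLinearMap_of_isEmpty, Nat.cast_zero, zero_add, one_smul] at h2
        exact (add_zero _).symm.trans h2
      funext ξ x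
      simp only [homotopy, rawHomotopy, h1]

end Homotopy

/-! ## Submersions -/

section Submersion

variable {E E' : Type*} [NormedAddCommGroup E] [NormedSpace ℝ E]
  [NormedAddCommGroup E'] [NormedSpace ℝ E']
  {M : Type*} [TopologicalSpace M] [ChartedSpace E M] [IsManifold 𝓘(ℝ, E) ∞ M]
  {N : Type*} [TopologicalSpace N] [ChartedSpace E' N] [IsManifold 𝓘(ℝ, E') ∞ N]
  {f : M → N} {x : M}

/-- In adapted charts a submersion is a linear projection P; a linear right inverse S is all that is
kept of the splitting. -/
theorem exists_normal_form (h : Manifold.IsSubmersionAt 𝓘(ℝ, E) 𝓘(ℝ, E') ∞ f x) :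
    ∃ (e : OpenPartialHomeomorph M E) (e' : OpenPartialHomeomorph N E') (P : E →L[ℝ] E')
      (S : E' →L[ℝ] E), x ∈ e.source ∧ e ∈ IsManifold.maximalAtlas 𝓘(ℝ, E) ∞ M ∧
      e' ∈ IsManifold.maximalAtlas 𝓘(ℝ, E') ∞ N ∧ Set.MapsTo f e.source e'.source ∧
      (∀ y ∈ e.source, e' (f y) = P (e y)) ∧ ∀ u, P (S u) = u := by
  refine ⟨h.domChart, h.codChart,
    (ContinuousLinearMap.fst ℝ E' h.complement).comp h.equiv.toContinuousLinearMap,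
    h.equiv.symm.toContinuousLinearMap.comp (ContinuousLinearMap.inl ℝ E' h.complement),
    h.mem_domChart_source, h.domChart_mem_maximalAtlas, h.codChart_mem_maximalAtlas,
    h.source_subset_preimage_source, fun y hy => ?_, fun u => by simp⟩
  have h0 : h.domChart y ∈ (h.domChart.extend 𝓘(ℝ, E)).target := by
    simpa using h.domChart.map_source hy
  have h1 := h.writtenInCharts h0
  simpa [h.domChart.left_inv hy] using h1

theorem exists_section (h : Manifold.IsSubmersionAt 𝓘(ℝ, E) 𝓘(ℝ, E') ∞ f x) :
    ∃ s : N → M, ContMDiffAt 𝓘(ℝ, E') 𝓘(ℝ, E) ∞ s (f x) ∧ s (f x) = x ∧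
      ∀ᶠ r in 𝓝 (f x), f (s r) = r := by
  obtain ⟨e, e', P, S, hx, he, he', hf, hP, hS⟩ := exists_normal_form h
  -- The affine slice through e x in the direction of S is a section of P, and the chart carries it
  -- to a section of f.
  let c : E' → E := fun u => e x + S (u - e' (f x))
  have hc0 : c (e' (f x)) = e x := by simp [c]
  have hc : ContDiff ℝ ∞ c := by fun_prop
  have h1 : ContMDiffAt 𝓘(ℝ, E') 𝓘(ℝ, E) ∞ (fun r => c (e' r)) (f x) :=
    hc.contMDiff.contMDiffAt.comp (f x) (contMDiffAt_of_mem_maximalAtlas he' (hf hx))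
  have h2 : ContMDiffAt 𝓘(ℝ, E) 𝓘(ℝ, E) ∞ e.symm (c (e' (f x))) := by
    rw [hc0]
    exact contMDiffAt_symm_of_mem_maximalAtlas he (e.map_source hx)
  refine ⟨fun r => e.symm (c (e' r)), h2.comp (f x) h1, ?_, ?_⟩
  · simp only [hc0]
    exact e.left_inv hx
  · have h3 : ∀ᶠ r in 𝓝 (f x), c (e' r) ∈ e.target :=
      h1.continuousAt.eventually_mem (by
        rw [hc0]; exact e.open_target.mem_nhds (e.map_source hx))
    filter_upwards [h3, e'.open_source.mem_nhds (hf hx)] with r hr hr'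
    have hs := e.map_target hr
    refine e'.injOn (hf hs) hr' ?_
    rw [hP _ hs, e.right_inv hr]
    simp only [c, _root_.map_add, hS, ← hP x hx]
    abel

theorem exists_curve (h : Manifold.IsSubmersionAt 𝓘(ℝ, E) 𝓘(ℝ, E') ∞ f x) {v : E}
    (hv : tmap E E' f x v = 0) :
    ∃ γ : ℝ → M, ContMDiffAt 𝓘(ℝ, ℝ) 𝓘(ℝ, E) ∞ γ 0 ∧ γ 0 = x ∧ tmap ℝ E γ 0 1 = v ∧
      ∀ᶠ t in 𝓝 0, f (γ t) = f x := by
  obtain ⟨e, e', P, S, hx, he, he', hf, hP, hS⟩ := exists_normal_form h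
  set w := tmap E E e x v with hw
  have hce := contMDiffAt_of_mem_maximalAtlas he hx
  have hce' := contMDiffAt_of_mem_maximalAtlas he' (hf hx)
  have hces := contMDiffAt_symm_of_mem_maximalAtlas he (e.map_source hx)
  have hPw : P w = 0 := by
    have h1 := tmap_comp (g := P) (f := e) (x := x) P.contMDiff.contMDiffAt.mdiff hce.mdiff
    have h2 := tmap_comp (g := e') (f := f) (x := x) hce'.mdiff h.contMDiffAt.mdiff
    have h3 : tmap E E' (fun y => P (e y)) x = tmap E E' (fun y => e' (f y)) x := by
      refine tmap_congr ?_
      filter_upwards [e.open_source.mem_nhds hx] with y hy using (hP y hy).symm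
    rw [h1, h2, tmap_eq_fderiv, P.fderiv] at h3
    have h4 := congrArg (fun T : E →L[ℝ] E' => T v) h3
    simp only [ContinuousLinearMap.comp_apply, hv, _root_.map_zero] at h4
    exact h4
  -- A straight line in the chart in a direction of ker P stays in one fibre of f.
  let c : ℝ → E := fun t => e x + t • w
  have hc0 : c 0 = e x := by simp [c]
  have hc : ContDiff ℝ ∞ c := by fun_prop
  have hcd : HasFDerivAt c ((ContinuousLinearMap.id ℝ ℝ).smulRight w) 0 :=
    ((hasFDerivAt_id (0 : ℝ)).smul_const w).const_add _
  have hces' : ContMDiffAt 𝓘(ℝ, E) 𝓘(ℝ, E) ∞ e.symm (c 0) := by rwa [hc0]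
  refine ⟨fun t => e.symm (c t), hces'.comp 0 hc.contMDiff.contMDiffAt, ?_, ?_, ?_⟩
  · simp only [hc0]
    exact e.left_inv hx
  · rw [tmap_comp hces'.mdiff hc.contMDiff.contMDiffAt.mdiff, tmap_eq_fderiv c, hcd.fderiv, hc0]
    have h1 := tmap_comp (g := e.symm) (f := e) (x := x) hces.mdiff hce.mdiff
    have h2 : tmap E E (fun y => e.symm (e y)) x = ContinuousLinearMap.id ℝ E := by
      rw [← tmap_id (E := E) x]
      refine tmap_congr ?_
      filter_upwards [e.open_source.mem_nhds hx] with y hy using e.left_inv hy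
    rw [h2] at h1
    have h3 := congrArg (fun T : E →L[ℝ] E => T v) h1
    simpa [hw] using h3.symm
  · have h3 : ∀ᶠ t in 𝓝 (0 : ℝ), c t ∈ e.target :=
      hc.continuous.continuousAt.eventually_mem (by
        rw [hc0]; exact e.open_target.mem_nhds (e.map_source hx))
    filter_upwards [h3] with t ht
    have hs := e.map_target ht
    refine e'.injOn (hf hs) (hf hx) ?_
    rw [hP _ hs, e.right_inv ht, hP _ hx]
    simp [c, hPw]

end Submersion

/-- A curve which factors through a map with injective differential `A` has its velocity in the
range of `A`. -/
theorem apply_leftInverse_of_hasDerivAt {F E : Type*} [NormedAddCommGroup F] [NormedSpace ℝ F]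
    [NormedAddCommGroup E] [NormedSpace ℝ E] {f : F → E} {A : F →L[ℝ] E} {B : E →L[ℝ] F} {p : F}
    (hf : HasFDerivAt f A p) (hBA : ∀ u, B (A u) = u) {z : ℝ → F} {c : ℝ → E} {v : E}
    (hz : Filter.Tendsto z (𝓝 0) (𝓝 p)) (hc : HasDerivAt c v 0)
    (hcz : ∀ᶠ t in 𝓝 0, c t = f (z t)) (hc0 : c 0 = f p) : A (B v) = v := by
  have h1 : (fun t => c t - c 0 - A (z t - p)) =o[𝓝 0] fun t => z t - p := by
    refine (hf.isLittleO.comp_tendsto hz).congr' ?_ (.refl _ _)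
    filter_upwards [hcz] with t ht
    simp [ht, hc0]
  have h2 : (fun t => B (c t - c 0) - (z t - p)) =o[𝓝 0] fun t => z t - p := by
    refine ((B.isBigO_comp _ _).trans_isLittleO h1).congr_left fun t => ?_
    rw [_root_.map_sub, hBA]
  -- The curve z is only assumed to converge, not to be differentiable. The left inverse B compares
  -- z t - p with c t - c 0, and differentiability of c then gives z t - p = O(t).
  have h3 : (fun t => z t - p) =O[𝓝 0] fun t => B (c t - c 0) := by
    simpa using h2.right_isBigO_add
  have h4 : (fun t => z t - p) =O[𝓝 0] fun t : ℝ => t - 0 :=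
    (h3.trans (B.isBigO_comp _ _)).trans hc.isBigO_sub
  have h5 := h1.trans_isBigO h4
  have h6 : (fun t => (c t - c 0) - A (B (c t - c 0))) =o[𝓝 0] fun t : ℝ => t - 0 := by
    refine (h5.sub (((A.comp B).isBigO_comp _ _).trans_isLittleO h5)).congr_left fun t => ?_
    simp only [ContinuousLinearMap.comp_apply, _root_.map_sub, hBA]
    abel
  have h7 : HasDerivAt (fun t => c t - A (B (c t))) 0 0 := by
    rw [hasDerivAt_iff_isLittleO]
    refine h6.congr_left fun t => ?_
    simp only [_root_.map_sub, smul_zero]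
    abel
  have h8 : HasDerivAt (fun t => c t - A (B (c t))) (v - A (B v)) 0 :=
    hc.sub ((A.comp B).hasFDerivAt.comp_hasDerivAt (0 : ℝ) hc)
  exact (sub_eq_zero.1 (h8.unique h7)).symm

/-- The orbit maps of a free proper action are closed embeddings. -/
theorem isClosedEmbedding_orbit_prod {G C : Type*} [TopologicalSpace G] [TopologicalSpace C]
    [T1Space C] [Group G] [MulAction G C] [ProperSMul G C]
    (hfree : ∀ (g : G) (c : C), g • c = c → g = 1) (x : C) :
    Topology.IsClosedEmbedding fun g : G => (g • x, x) := by
  have h1 : Topology.IsClosedEmbedding fun g : G => (g, x) := by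
    refine ⟨isEmbedding_prodMkLeft x, ?_⟩
    have : Set.range (fun g : G => (g, x)) = Prod.snd ⁻¹' {x} := by
      ext ⟨g, y⟩
      simp [eq_comm]
    rw [this]
    exact isClosed_singleton.preimage continuous_snd
  have h2 : IsProperMap fun g : G => (g • x, x) :=
    (ProperSMul.isProperMap_smul_pair (G := G) (X := C)).comp h1.isProperMap
  refine .of_continuous_injective_isClosedMap h2.continuous ?_ h2.isClosedMap
  intro g h hgh
  have h3 : g • x = h • x := (Prod.ext_iff.1 hgh).1
  have h4 := hfree (h⁻¹ * g) x (by rw [mul_smul, h3, inv_smul_smul])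
  exact (inv_mul_eq_one.1 h4).symm

/-! ## Basic forms on the total space of a principal bundle -/

section Quotient

variable {EG E ER : Type*} [NormedAddCommGroup EG] [NormedSpace ℝ EG] [FiniteDimensional ℝ EG]
  [NormedAddCommGroup E] [NormedSpace ℝ E] [FiniteDimensional ℝ E]
  [NormedAddCommGroup ER] [NormedSpace ℝ ER] [FiniteDimensional ℝ ER]
  {G : Type*} [TopologicalSpace G] [ChartedSpace EG G] [Group G] [LieGroup 𝓘(ℝ, EG) ∞ G]
  {C : Type*} [TopologicalSpace C] [ChartedSpace E C] [IsManifold 𝓘(ℝ, E) ∞ C] [MulAction G C]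
  [ContMDiffSMul 𝓘(ℝ, EG) 𝓘(ℝ, E) ∞ G C]
  {R : Type*} [TopologicalSpace R] [ChartedSpace ER R] [IsManifold 𝓘(ℝ, ER) ∞ R]
  {π : C → R} (θ : PrincipalConnection EG E G C)

theorem tmap_fundamental (hπ : ContMDiff 𝓘(ℝ, E) 𝓘(ℝ, ER) ∞ π)
    (horb : ∀ (g : G) c, π (g • c) = π c) (x : C) (ξ : EG) :
    tmap E ER π x (fundamental EG E G x ξ) = 0 := by
  have h := tmap_comp (g := π) (f := fun g : G => g • x) (x := 1) (hπ _).mdiff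
    (contMDiff_orbit EG E G x 1).mdiff
  simp only [horb, tmap_const, one_smul] at h
  exact (congrArg (fun T : EG →L[ℝ] ER => T ξ) h).symm

/-- A vector in the kernel of Tπ is the velocity of a curve inside a fibre, hence inside an orbit,
and this curve lifts to G. The lift tends to 1 because the orbit map is an embedding. As the
differential of the orbit map has θ as left inverse, the velocity lies in its range. -/
theorem vert_eq_of_tmap_eq_zero [T1Space C] [ProperSMul G C]
    (hfree : ∀ (g : G) (c : C), g • c = c → g = 1) {x : C}
    (hπ : Manifold.IsSubmersionAt 𝓘(ℝ, E) 𝓘(ℝ, ER) ∞ π x)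
    (horb : ∀ c c' : C, π c = π c' → ∃ g : G, g • c = c') {v : E} (hv : tmap E ER π x v = 0) :
    θ.vert x v = v := by
  obtain ⟨γ, hγ, hγ0, hγv, hγπ⟩ := exists_curve hπ hv
  have hg : ∀ t, ∃ g : G, π (γ t) = π x → g • x = γ t := fun t => by
    by_cases h : π (γ t) = π x
    · obtain ⟨g, hg⟩ := horb x (γ t) h.symm
      exact ⟨g, fun _ => hg⟩
    · exact ⟨1, fun h' => absurd h' h⟩
  choose g hg using hg
  have hgt : Filter.Tendsto g (𝓝 0) (𝓝 1) := by
    rw [(isClosedEmbedding_orbit_prod hfree x).isInducing.tendsto_nhds_iff, one_smul]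
    have h1 : Filter.Tendsto γ (𝓝 0) (𝓝 x) := by
      have := hγ.continuousAt.tendsto
      rwa [hγ0] at this
    refine Filter.Tendsto.congr' ?_ (h1.prodMk_nhds tendsto_const_nhds)
    filter_upwards [hγπ] with t ht
    simp [hg t ht]
  set e := extChartAt 𝓘(ℝ, E) x with he
  set eG := extChartAt 𝓘(ℝ, EG) (1 : G) with heG
  have hA : HasFDerivAt (fun u => e (eG.symm u • x)) (fundamental EG E G x) (eG 1) := by
    have h1 : eG.symm (eG 1) = 1 := extChartAt_to_inv 1
    have k1 : ContMDiffAt 𝓘(ℝ, EG) 𝓘(ℝ, EG) ∞ eG.symm (eG 1) :=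
      contMDiffAt_chart_symm (mem_extChartAt_target 1)
    have k2 : ContMDiffAt 𝓘(ℝ, E) 𝓘(ℝ, E) ∞ e (eG.symm (eG 1) • x) := by
      rw [h1, one_smul]
      exact contMDiffAt_chart (mem_extChartAt_source x)
    have k3 := contMDiff_orbit EG E G x
    have k4 : ContMDiffAt 𝓘(ℝ, EG) 𝓘(ℝ, E) ∞ (fun u => eG.symm u • x) (eG 1) :=
      (k3 _).comp (eG 1) k1
    have k5 := tmap_comp (g := e) (f := fun u => eG.symm u • x) k2.mdiff k4.mdiff
    have k6 := tmap_comp (g := fun g : G => g • x) (f := eG.symm) (k3 _).mdiff k1.mdiff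
    rw [k6, heG, tmap_chart_symm_self, ← heG, h1, one_smul, he, tmap_chart_self,
      ContinuousLinearMap.comp_id, ContinuousLinearMap.id_comp, tmap_eq_fderiv] at k5
    have k7 : ContDiffAt ℝ ∞ (fun u => e (eG.symm u • x)) (eG 1) :=
      contMDiffAt_iff_contDiffAt.1 (k2.comp (eG 1) k4)
    rw [fundamental, ← k5]
    exact (k7.differentiableAt (by simp)).hasFDerivAt
  have hc : HasDerivAt (fun t => e (γ t)) v 0 := by
    have k1 : ContMDiffAt 𝓘(ℝ, E) 𝓘(ℝ, E) ∞ e (γ 0) := by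
      rw [hγ0]
      exact contMDiffAt_chart (mem_extChartAt_source x)
    have k2 := tmap_comp (g := e) (f := γ) k1.mdiff hγ.mdiff
    rw [hγ0, he, tmap_chart_self, ContinuousLinearMap.id_comp, tmap_eq_fderiv] at k2
    have k3 : ContDiffAt ℝ ∞ (fun t => e (γ t)) 0 := contMDiffAt_iff_contDiffAt.1 (k1.comp 0 hγ)
    have k4 := (k3.differentiableAt (by simp)).hasFDerivAt.hasDerivAt
    rwa [k2, hγv] at k4
  have hz : Filter.Tendsto (fun t => eG (g t)) (𝓝 0) (𝓝 (eG 1)) :=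
    (continuousAt_extChartAt (I := 𝓘(ℝ, EG)) (1 : G)).tendsto.comp hgt
  refine apply_leftInverse_of_hasDerivAt (B := θ.form x) hA (θ.vertical x) hz hc ?_ ?_
  · filter_upwards [hγπ, hgt.eventually (extChartAt_source_mem_nhds (I := 𝓘(ℝ, EG)) (1 : G))]
      with t ht ht'
    rw [eG.left_inv ht', hg t ht]
  · rw [hγ0, heG, extChartAt_to_inv, one_smul]

/-- The slots are changed one at a time, and each change costs a value of b with an argument in K,
which is zero. -/
theorem apply_eq_of_horizontal {k : ℕ} (b : E [⋀^Fin k]→L[ℝ] ℝ) {K : Set E}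
    (hb : ∀ v i, v i ∈ K → b v = 0) {v w : Fin k → E} (h : ∀ i, w i - v i ∈ K) : b w = b v := by
  classical
  suffices h : ∀ s : Finset (Fin k), b (s.piecewise w v) = b v by
    simpa using h Finset.univ
  intro s
  induction s using Finset.induction_on with
  | empty => simp
  | insert i s his ih =>
    have h1 := b.map_update_sub (s.piecewise w v) i (w i) (v i)
    rw [hb _ i (by simpa using h i), ← Finset.piecewise_insert] at h1
    have h2 : Function.update (s.piecewise w v) i (v i) = s.piecewise w v := by
      rw [Function.update_eq_self_iff, Finset.piecewise_eq_of_notMem _ _ _ his]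
    rw [h2, ih] at h1
    exact sub_eq_zero.1 h1.symm

theorem apply_eq_zero_of_curryLeft {k : ℕ} {b : E [⋀^Fin (k + 1)]→L[ℝ] ℝ} {X : E}
    (hb : b.curryLeft X = 0) {v : Fin (k + 1) → E} {i : Fin (k + 1)} (hv : v i = X) : b v = 0 := by
  have h0 : ∀ w : Fin (k + 1) → E, w 0 = X → b w = 0 := fun w hw => by
    have h1 : b.curryLeft X (Fin.tail w) = b w := by
      rw [curryLeft_apply_apply, ← hw, ← Fin.cons_self_tail w]
      rfl
    rw [← h1, hb]
    rfl
  by_cases hi : i = 0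
  · exact h0 v (hi ▸ hv)
  · have h1 := b.toAlternatingMap.map_swap v hi
    have h2 : b (v ∘ Equiv.swap i 0) = 0 := h0 _ (by simpa using hv)
    have h3 : b (v ∘ Equiv.swap i 0) = -b v := h1
    linarith

/-- A local section s through each point gives s^* π^* = id there. -/
theorem pullback_injective (hπ : Manifold.IsSubmersion 𝓘(ℝ, E) 𝓘(ℝ, ER) ∞ π)
    (hsurj : Function.Surjective π) {k : ℕ} {a b : FormField ER R k}
    (h : pullback (E := E) π a = pullback π b) : a = b := by
  funext r
  obtain ⟨c, rfl⟩ := hsurj r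
  obtain ⟨s, hs, hsc, hss⟩ := exists_section (hπ.isSubmersionAt c)
  have h1 := tmap_comp (g := π) (f := s) (x := π c) (by rw [hsc]; exact (hπ.contMDiff c).mdiff)
    hs.mdiff
  have h2 : tmap ER ER (fun r => π (s r)) (π c) = ContinuousLinearMap.id ℝ ER := by
    rw [← tmap_id (E := ER) (π c)]
    exact tmap_congr hss
  rw [h2, hsc] at h1
  have h3 := congrFun h c
  ext v
  have h4 := congrArg (fun T : E [⋀^Fin k]→L[ℝ] ℝ => T fun i => tmap ER E s (π c) (v i)) h3
  have h5 : ∀ u, tmap E ER π c (tmap ER E s (π c) u) = u := fun u =>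
    (congrArg (fun T : ER →L[ℝ] ER => T u) h1).symm
  simpa only [pullback, compContinuousLinearMap_apply, Function.comp_def, h5] using h4

/-- Basic forms descend to the quotient. -/
theorem exists_pullback_eq (θ : PrincipalConnection EG E G C)
    (hπ : Manifold.IsSubmersion 𝓘(ℝ, E) 𝓘(ℝ, ER) ∞ π) (hsurj : Function.Surjective π)
    [T1Space C] [ProperSMul G C] (hfree : ∀ (g : G) (c : C), g • c = c → g = 1)
    (horb : ∀ c c' : C, π c = π c' ↔ ∃ g : G, g • c = c') {k : ℕ} {β : FormField E C k}
    (hs : IsSmoothForm β) (hinv : ∀ g : G, pullback (fun x : C => g • x) β = β)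
    (hhor : ∀ (x : C) (ξ : EG) (v : Fin k → E) (i : Fin k),
      v i = fundamental EG E G x ξ → β x v = 0) :
    ∃ β' : FormField ER R k, IsSmoothForm β' ∧ pullback π β' = β := by
  have hπg : ∀ (g : G) c, π (g • c) = π c := fun g c => ((horb c (g • c)).2 ⟨g, rfl⟩).symm
  have hπs := hπ.contMDiff
  choose c hc using hsurj
  choose s hs1 hs2 hs3 using fun r => exists_section (hπ.isSubmersionAt (c r))
  have hsec : ∀ r u, tmap E ER π (c r) (tmap ER E (s r) r u) = u := fun r u => by
    have k1 := hs1 r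
    have k2 := hs2 r
    have k3 := hs3 r
    rw [hc r] at k1 k2 k3
    have h1 := tmap_comp (g := π) (f := s r) (x := r) (hπs _).mdiff k1.mdiff
    have h2 : tmap ER ER (fun y => π (s r y)) r = ContinuousLinearMap.id ℝ ER := by
      rw [← tmap_id (E := ER) r]
      exact tmap_congr k3
    rw [h2, k2] at h1
    exact (congrArg (fun T : ER →L[ℝ] ER => T u) h1).symm
  -- The value at r is read off along a section through a chosen point of the fibre. Invariance of β
  -- makes the choice of point irrelevant and horizontality the choice of lift.
  let β' : FormField ER R k := fun r => (β (c r)).compContinuousLinearMap (tmap ER E (s r) r)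
  have hpull : pullback π β' = β := by
    funext x
    obtain ⟨g, hg⟩ := (horb x (c (π x))).1 (hc (π x)).symm
    ext v
    have h1 := congrArg (fun T : E [⋀^Fin k]→L[ℝ] ℝ => T v) (congrFun (hinv g) x)
    simp only [pullback, compContinuousLinearMap_apply, hg] at h1
    rw [← h1]
    have hT : ∀ u, tmap E ER π x u = tmap E ER π (c (π x)) (tmap E E (fun y : C => g • y) x u) := by
      intro u
      have h2 := tmap_comp (g := π) (f := fun y : C => g • y) (x := x) (hπs _).mdiff
        (contMDiff_smul_left EG E g x).mdiff
      simp only [hπg] at h2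
      rw [hg] at h2
      exact congrArg (fun T : E →L[ℝ] ER => T u) h2
    change β (c (π x)) (fun i => tmap ER E (s (π x)) (π x) (tmap E ER π x (v i))) = _
    refine apply_eq_of_horizontal (β (c (π x)))
      (K := Set.range (fundamental EG E G (c (π x)))) ?_ fun i => ?_
    · rintro v i ⟨ξ, hξ⟩
      exact hhor _ ξ v i hξ.symm
    -- The two lifts of the same tangent vector of R differ by an element of ker Tπ, hence by a
    -- vertical vector.
    · have h3 := vert_eq_of_tmap_eq_zero θ hfree (hπ.isSubmersionAt (c (π x)))
        (fun c c' h => (horb c c').1 h) (v := tmap ER E (s (π x)) (π x) (tmap E ER π x (v i)) -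
          tmap E E (fun y : C => g • y) x (v i)) (by
            rw [_root_.map_sub, hsec, hT, sub_self])
      exact ⟨_, h3⟩
  refine ⟨β', isSmoothForm_iff.2 fun r => ?_, hpull⟩
  have k1 := hs1 r
  have k2 := hs2 r
  have k3 := hs3 r
  rw [hc r] at k1 k2 k3
  -- The sections in the definition of β' vary with r without any regularity. Since π^*β' = β, near
  -- r the form β' also equals the pullback of β along the single section chosen at r, which is
  -- smooth.
  refine isSmoothFormAt_congr ?_ (isSmoothFormAt_pullback k1 (isSmoothForm_iff.1 hs _))
  filter_upwards [k3.eventually_nhds, k1.eventually_mdiff] with y hy hy'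
  rw [← hpull, pullback_pullback_apply (hπs _).mdiff hy', pullback, hy.self_of_nhds,
    tmap_congr hy, tmap_id]
  ext v
  simp

theorem pullback_smul_pullback (EG : Type*) {E ER : Type*} [NormedAddCommGroup EG]
    [NormedSpace ℝ EG] [NormedAddCommGroup E] [NormedSpace ℝ E] [NormedAddCommGroup ER]
    [NormedSpace ℝ ER] {G : Type*} [TopologicalSpace G] [ChartedSpace EG G] [Group G]
    {C : Type*} [TopologicalSpace C] [ChartedSpace E C] [MulAction G C]
    [FiniteDimensional ℝ E] [FiniteDimensional ℝ ER] [ContMDiffSMul 𝓘(ℝ, EG) 𝓘(ℝ, E) ∞ G C]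
    {R : Type*} [TopologicalSpace R] [ChartedSpace ER R] {π : C → R}
    (hπ : ContMDiff 𝓘(ℝ, E) 𝓘(ℝ, ER) ∞ π) (horb : ∀ (g : G) c, π (g • c) = π c) {k : ℕ}
    (β : FormField ER R k) (g : G) : pullback (E := E) (fun x : C => g • x) (pullback (E := E) π β) = pullback π β := by
  funext x
  rw [pullback_pullback_apply (hπ _).mdiff (contMDiff_smul_left EG E g x).mdiff]
  simp only [horb]

theorem pullback_apply_eq_zero (hπ : ContMDiff 𝓘(ℝ, E) 𝓘(ℝ, ER) ∞ π)
    (horb : ∀ (g : G) c, π (g • c) = π c) {k : ℕ} (β : FormField ER R k) (x : C) (ξ : EG)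
    (v : Fin k → E) (i : Fin k) (hv : v i = fundamental EG E G x ξ) :
    pullback (E := E) π β x v = 0 := by
  rw [pullback, compContinuousLinearMap_apply]
  refine (β (π x)).map_coord_zero i ?_
  rw [Function.comp_apply, hv, tmap_fundamental hπ horb]

end Quotient

/-! ## Pullback of equivariant forms along equivariant maps -/

section Pullback

variable {EG E E' : Type*} [NormedAddCommGroup EG] [NormedSpace ℝ EG] [FiniteDimensional ℝ EG]
  [NormedAddCommGroup E] [NormedSpace ℝ E] [FiniteDimensional ℝ E]
  [NormedAddCommGroup E'] [NormedSpace ℝ E'] [FiniteDimensional ℝ E']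
  {G : Type*} [TopologicalSpace G] [ChartedSpace EG G] [Group G] [LieGroup 𝓘(ℝ, EG) ∞ G]
  {M : Type*} [TopologicalSpace M] [ChartedSpace E M] [IsManifold 𝓘(ℝ, E) ∞ M] [MulAction G M]
  [ContMDiffSMul 𝓘(ℝ, EG) 𝓘(ℝ, E) ∞ G M]
  {N : Type*} [TopologicalSpace N] [ChartedSpace E' N] [IsManifold 𝓘(ℝ, E') ∞ N] [MulAction G N]
  [ContMDiffSMul 𝓘(ℝ, EG) 𝓘(ℝ, E') ∞ G N] {f : N → M} {k : ℕ} {α : CartanField EG E M}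

theorem cartanPullback_mem (hf : ContMDiff 𝓘(ℝ, E') 𝓘(ℝ, E) ∞ f)
    (hG : ∀ (g : G) x, f (g • x) = g • f x) (hα : α ∈ cartanForms EG E G M k) :
    (cartanPullback f α : CartanField EG E' N) ∈ cartanForms EG E' G N k := by
  refine ⟨fun i j => ?_, fun i j h => ?_, fun i j g ξ => ?_⟩
  · exact polyForms.map (fun β => pullback f β) (fun a b _ _ => pullback_add f a b)
      (fun c a => pullback_smul f c a) (fun a ha => ha.pullback hf) (hα.1 i j)
  · funext ξ
    simp only [cartanPullback, hα.2.1 i j h]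
    exact pullback_zero f
  · funext x
    simp only [cartanPullback, hα.2.2]
    rw [pullback_pullback_apply (contMDiff_smul_left EG E g⁻¹ _).mdiff (hf _).mdiff,
      pullback_pullback_apply (hf _).mdiff (contMDiff_smul_left EG E' g⁻¹ _).mdiff]
    simp only [hG]

theorem tmap_fundamental_equivariant (hf : ContMDiff 𝓘(ℝ, E') 𝓘(ℝ, E) ∞ f)
    (hG : ∀ (g : G) x, f (g • x) = g • f x) (x : N) (ξ : EG) :
    tmap E' E f x (fundamental EG E' G x ξ) = fundamental EG E G (f x) ξ := by
  have h := tmap_comp (g := f) (f := fun g : G => g • x) (x := 1) (hf _).mdiff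
    (contMDiff_orbit EG E' G x 1).mdiff
  simp only [hG, one_smul] at h
  exact (congrArg (fun T : EG →L[ℝ] E => T ξ) h).symm

/-- Pullback commutes with d, and it commutes with i_• because an equivariant map relates the
fundamental fields of N and M. -/
theorem cartanD_cartanPullback (hf : ContMDiff 𝓘(ℝ, E') 𝓘(ℝ, E) ∞ f)
    (hG : ∀ (g : G) x, f (g • x) = g • f x) (hα : α ∈ cartanForms EG E G M k) :
    cartanD G (cartanPullback f α : CartanField EG E' N) = cartanPullback f (cartanD G α) := by
  have h1 : cartanDeRham (cartanPullback f α : CartanField EG E' N) =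
      cartanPullback f (cartanDeRham α) := by
    funext i j ξ
    rcases j with _ | j
    · exact (pullback_zero f).symm
    · funext x
      exact extD_pullback (hf x) (isSmoothForm_iff.1 (cartanForms.isSmoothForm hα i j ξ) _)
  have h2 : cartanInsertion G (cartanPullback f α : CartanField EG E' N) =
      cartanPullback f (cartanInsertion G α) := by
    funext i j ξ
    rcases i with _ | i
    · exact (pullback_zero f).symm
    · funext x
      simp only [cartanInsertion, cartanPullback, insertion, pullback]
      rw [curryLeft_compContinuousLinearMap_apply, tmap_fundamental_equivariant hf hG]
  rw [cartanD, h1, h2]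
  funext i j ξ
  exact (pullback_add f _ _).symm

variable (EG E E') in
/-- Pullback of equivariant forms as a linear map. -/
noncomputable def cartanPullbackLinear (f : N → M) :
    CartanField EG E M →ₗ[ℝ] CartanField EG E' N where
  toFun α := cartanPullback f α
  map_add' a b := by funext i j ξ; exact pullback_add f _ _
  map_smul' c a := by funext i j ξ; exact pullback_smul f _ _

end Pullback

/-! ## Linearity of `φ` -/

section Linearity

variable {EG E : Type*} [NormedAddCommGroup EG] [NormedSpace ℝ EG] [FiniteDimensional ℝ EG]
  [NormedAddCommGroup E] [NormedSpace ℝ E] [FiniteDimensional ℝ E]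
  {G : Type*} [TopologicalSpace G] [ChartedSpace EG G] [Group G] [LieGroup 𝓘(ℝ, EG) ∞ G]
  {M : Type*} [TopologicalSpace M] [ChartedSpace E M] [IsManifold 𝓘(ℝ, E) ∞ M] [MulAction G M]
  [ContMDiffSMul 𝓘(ℝ, EG) 𝓘(ℝ, E) ∞ G M] (θ : PrincipalConnection EG E G M)
  {k : ℕ} {a b : CartanField EG E M}

namespace PrincipalConnection

theorem normalize_add (a b : CartanField EG E M) :
    θ.normalize (a + b) = θ.normalize a + θ.normalize b := by
  funext i j ξ x
  exact _root_.map_add (divDegree (θ.vert x) i) (a i j ξ x) (b i j ξ x)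

theorem normalize_smul (c : ℝ) (a : CartanField EG E M) :
    θ.normalize (c • a) = c • θ.normalize a := by
  funext i j ξ x
  exact _root_.map_smul (divDegree (θ.vert x) i) c (a i j ξ x)

theorem rawHomotopy_add (ha : a ∈ cartanForms EG E G M k) (hb : b ∈ cartanForms EG E G M k) :
    θ.rawHomotopy (a + b) = θ.rawHomotopy a + θ.rawHomotopy b := by
  funext i j
  rcases j with _ | j
  · exact (add_zero _).symm
  · funext ξ x
    have h : fderiv ℝ (fun η : EG => (a + b) (i + 1) j η x) ξ = _ :=
      (((polyForms.differentiable (ha.1 (i + 1) j) x) ξ).hasFDerivAt.add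
        ((polyForms.differentiable (hb.1 (i + 1) j) x) ξ).hasFDerivAt).fderiv
    simp only [rawHomotopy]
    rw [h, ContinuousLinearMap.add_comp]
    exact _root_.map_add (alternatizeUncurryFinCLM ℝ E ℝ) _ _

theorem rawHomotopy_smul (c : ℝ) (ha : a ∈ cartanForms EG E G M k) :
    θ.rawHomotopy (c • a) = c • θ.rawHomotopy a := by
  funext i j
  rcases j with _ | j
  · exact (smul_zero (A := EG → FormField E M 0) c).symm
  · funext ξ x
    have h : fderiv ℝ (fun η : EG => (c • a) (i + 1) j η x) ξ = _ :=
      (((polyForms.differentiable (ha.1 (i + 1) j) x) ξ).hasFDerivAt.const_smul c).fderiv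
    simp only [rawHomotopy]
    rw [h, ContinuousLinearMap.smul_comp]
    exact _root_.map_smul (alternatizeUncurryFinCLM ℝ E ℝ) _ _

theorem phi_add (ha : a ∈ cartanForms EG E G M k) (hb : b ∈ cartanForms EG E G M k) :
    θ.phi (a + b) = θ.phi a + θ.phi b := by
  have h1 : θ.homotopy (a + b) = θ.homotopy a + θ.homotopy b := by
    rw [homotopy, normalize_add, θ.rawHomotopy_add (θ.normalize_mem ha) (θ.normalize_mem hb)]
    rfl
  rcases k with _ | k
  · simp only [phi, h1, θ.homotopy_eq_zero_of_mem ha, θ.homotopy_eq_zero_of_mem hb, add_zero,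
      cartanD_zero, sub_zero]
  · rw [phi, h1, cartanD_add (θ.homotopy_mem ha) (θ.homotopy_mem hb), phi, phi]
    abel

theorem phi_smul (c : ℝ) (ha : a ∈ cartanForms EG E G M k) : θ.phi (c • a) = c • θ.phi a := by
  rw [phi, homotopy, normalize_smul, θ.rawHomotopy_smul c (θ.normalize_mem ha), cartanD_smul, phi,
    smul_sub]
  rfl

theorem phi_eq_self (h : ∀ i j, a (i + 1) j = 0) : θ.phi a = a := by
  have h1 : θ.homotopy a = 0 := by
    funext i j
    rcases j with _ | j
    · rfl
    · exact θ.homotopy_eq_zero (h i j)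
  rw [phi, h1, cartanD_zero, sub_zero]

/-- `φ` on closed equivariant forms. -/
noncomputable def phiClosed (k : ℕ) : closedCartan EG E G M k →ₗ[ℝ] closedCartan EG E G M k where
  toFun α := ⟨θ.phi α, θ.phi_mem α.2.1, (θ.cartanD_phi α.2.1).trans α.2.2⟩
  map_add' a b := Subtype.ext (θ.phi_add a.2.1 b.2.1)
  map_smul' c a := Subtype.ext (θ.phi_smul c a.2.1)

theorem coe_phiClosed_pow (n : ℕ) (α : closedCartan EG E G M k) :
    ((θ.phiClosed k ^ n) α : CartanField EG E M) = θ.phi^[n] α := by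
  induction n with
  | zero => rfl
  | succ n ih =>
    rw [pow_succ', Module.End.mul_apply, Function.iterate_succ_apply', ← ih]
    rfl

end PrincipalConnection

theorem ofForm_apply_zero (k : ℕ) (β : FormField E M k) (ξ : EG) : ofForm EG β 0 k ξ = β := by
  simp [ofForm]

theorem ofForm_apply_succ {k : ℕ} (β : FormField E M k) (i j : ℕ) :
    ofForm EG β (i + 1) j = 0 := by
  funext ξ
  simp [ofForm]

end Linearity

/-! ## The quotient by a free proper action -/

section Quotient

variable {EG E ER : Type*} [NormedAddCommGroup EG] [NormedSpace ℝ EG] [FiniteDimensional ℝ EG]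
  [NormedAddCommGroup E] [NormedSpace ℝ E] [FiniteDimensional ℝ E]
  [NormedAddCommGroup ER] [NormedSpace ℝ ER] [FiniteDimensional ℝ ER]
  {G : Type*} [TopologicalSpace G] [ChartedSpace EG G] [Group G] [LieGroup 𝓘(ℝ, EG) ∞ G]
  {C : Type*} [TopologicalSpace C] [ChartedSpace E C] [IsManifold 𝓘(ℝ, E) ∞ C] [MulAction G C]
  [ContMDiffSMul 𝓘(ℝ, EG) 𝓘(ℝ, E) ∞ G C]
  {R : Type*} [TopologicalSpace R] [ChartedSpace ER R] [IsManifold 𝓘(ℝ, ER) ∞ R]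
  {π : C → R} {k : ℕ}

theorem ofForm_pullback_mem (hπ : ContMDiff 𝓘(ℝ, E) 𝓘(ℝ, ER) ∞ π)
    (horb : ∀ (g : G) c, π (g • c) = π c) {β : FormField ER R k} (hβ : IsSmoothForm β) :
    ofForm EG (pullback (E := E) π β) ∈ cartanForms EG E G C k :=
  ofForm_mem (hβ.pullback hπ) (pullback_smul_pullback EG hπ horb β)

theorem cartanD_ofForm_pullback (hπ : ContMDiff 𝓘(ℝ, E) 𝓘(ℝ, ER) ∞ π)
    (horb : ∀ (g : G) c, π (g • c) = π c) {β : FormField ER R k} (hβ : IsSmoothForm β) :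
    cartanD G (ofForm EG (pullback (E := E) π β)) = ofForm EG (pullback (E := E) π (extD β)) := by
  rw [cartanD_ofForm (pullback_apply_eq_zero hπ horb β)]
  congr 1
  funext x
  exact extD_pullback (hπ x) (isSmoothForm_iff.1 hβ _)

variable (EG E G) in
/-- Pullback of closed forms from the quotient. -/
noncomputable def quotientPullback (hπ : ContMDiff 𝓘(ℝ, E) 𝓘(ℝ, ER) ∞ π)
    (horb : ∀ (g : G) c, π (g • c) = π c) (k : ℕ) :
    closedForms ER R k →ₗ[ℝ] closedCartan EG E G C k where
  toFun β := ⟨ofForm EG (pullback π (β : FormField ER R k)), ofForm_pullback_mem hπ horb β.2.1, by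
    rw [cartanD_ofForm_pullback hπ horb β.2.1, β.2.2, pullback_zero]
    funext i j ξ
    rcases i with _ | i <;> simp [ofForm]⟩
  map_add' a b := by
    refine Subtype.ext ?_
    funext i j ξ
    change ofForm EG (pullback π ((a : FormField ER R k) + (b : FormField ER R k))) i j ξ = _
    rw [pullback_add]
    rcases i with _ | i
    · simp only [ofForm, if_true, Pi.single_add]
      rfl
    · exact (add_zero _).symm
  map_smul' c a := by
    refine Subtype.ext ?_
    funext i j ξ
    change ofForm EG (pullback π (c • (a : FormField ER R k))) i j ξ = _
    rw [pullback_smul]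
    rcases i with _ | i
    · simp only [ofForm, if_true, Pi.single_smul]
      rfl
    · exact (smul_zero (A := FormField E C j) c).symm

theorem quotientPullback_injective (hπ : Manifold.IsSubmersion 𝓘(ℝ, E) 𝓘(ℝ, ER) ∞ π)
    (hsurj : Function.Surjective π) (horb : ∀ (g : G) c, π (g • c) = π c) :
    Function.Injective (quotientPullback EG E G hπ.contMDiff horb k) := by
  intro a b h
  refine Subtype.ext (pullback_injective (E := E) hπ hsurj ?_)
  have := congrFun (congrFun (congrFun (congrArg Subtype.val h) 0) k) 0
  simpa only [quotientPullback, LinearMap.coe_mk, AddHom.coe_mk, ofForm_apply_zero] using this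

variable (θ : PrincipalConnection EG E G C) (hπ : Manifold.IsSubmersion 𝓘(ℝ, E) 𝓘(ℝ, ER) ∞ π)
  (hsurj : Function.Surjective π) [T1Space C] [ProperSMul G C]
  (hfree : ∀ (g : G) (c : C), g • c = c → g = 1)
  (horb : ∀ c c' : C, π c = π c' ↔ ∃ g : G, g • c = c')

include θ hπ hsurj hfree horb

/-- Once α has symmetric degree zero, the part of its differential in symmetric degree one is i_• α.
Its vanishing makes α horizontal, and with invariance α is basic. -/
theorem exists_eq_ofForm_pullback {α : CartanField EG E C} (hα : α ∈ cartanForms EG E G C k)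
    (h0 : ∀ i j, α (i + 1) j = 0) (hd : ∀ i j, cartanD G α (i + 1) j = 0) :
    ∃ β : FormField ER R k, IsSmoothForm β ∧ α = ofForm EG (pullback π β) := by
  have h1 := eq_ofForm hα h0
  rw [h1] at hα hd
  obtain ⟨β, hβ, hβ'⟩ := exists_pullback_eq θ hπ hsurj hfree horb (isSmoothForm_of_ofForm_mem hα)
    (pullback_smul_of_ofForm_mem hα) (by
      intro x ξ v i hv
      rcases k with _ | k
      · exact i.elim0
      · exact apply_eq_zero_of_curryLeft (insertion_eq_zero_of_cartanD_ofForm hd x ξ) hv)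
  exact ⟨β, hβ, by rw [hβ']; exact h1⟩

theorem exists_iterate_phi_eq (hG : ∀ (g : G) c, π (g • c) = π c)
    (α : closedCartan EG E G C k) :
    ∃ β, quotientPullback EG E G hπ.contMDiff hG k β = (θ.phiClosed k ^ (k / 2)) α := by
  have hd : ∀ i j, cartanD G (α : CartanField EG E C) (i + 1) j = 0 := fun i j => by
    rw [α.2.2]; rfl
  have h1 := θ.iterate_phi α.2.1 (k / 2)
  obtain ⟨β, hβ, hβ'⟩ := exists_eq_ofForm_pullback θ hπ hsurj hfree horb h1.1
    (θ.iterate_phi_apply_eq_zero α.2.1 hd le_rfl) (by rw [h1.2.1]; exact hd)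
  -- φ preserves the differential, so the pullback of dβ is zero, and pullback of forms along π is
  -- injective.
  have h2 : extD β = 0 := by
    refine pullback_injective (E := E) hπ hsurj ?_
    rw [pullback_zero]
    have h3 := h1.2.1
    rw [hβ', cartanD_ofForm_pullback hπ.contMDiff hG hβ, α.2.2] at h3
    have h4 := congrFun (congrFun (congrFun h3 0) (k + 1)) 0
    rwa [ofForm_apply_zero] at h4
  refine ⟨⟨β, hβ, h2⟩, Subtype.ext ?_⟩
  rw [θ.coe_phiClosed_pow, hβ']
  rfl

/-- A primitive γ of π^*β need not be closed, but its differential has symmetric degree zero, and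
the iteration needs no more. It turns γ into π^*δ with the same differential, so dδ = β. -/
theorem mem_exactForms_of_ofForm_mem (hG : ∀ (g : G) c, π (g • c) = π c) {β : FormField ER R k}
    (h : ofForm EG (pullback (E := E) π β) ∈ exactCartan EG E G C k) : β ∈ exactForms ER R k := by
  rcases k with _ | k
  · have h1 := congrFun (congrFun (congrFun ((Submodule.mem_bot ℝ).1 h) 0) 0) 0
    rw [ofForm_apply_zero] at h1
    refine (Submodule.mem_bot ℝ).2 (pullback_injective (E := E) hπ hsurj ?_)
    rw [pullback_zero]
    exact h1
  · obtain ⟨γ, hγ, hγd⟩ := h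
    have hd : ∀ i j, cartanD G γ (i + 1) j = 0 := fun i j => by
      rw [hγd, ofForm_apply_succ]
    have h1 := θ.iterate_phi hγ (k / 2)
    obtain ⟨δ, hδ, hδ'⟩ := exists_eq_ofForm_pullback θ hπ hsurj hfree horb h1.1
      (θ.iterate_phi_apply_eq_zero hγ hd le_rfl) (by rw [h1.2.1]; exact hd)
    refine ⟨δ, hδ, pullback_injective (E := E) hπ hsurj ?_⟩
    have h3 := h1.2.1
    rw [hδ', cartanD_ofForm_pullback hπ.contMDiff hG hδ, hγd] at h3
    have h4 := congrFun (congrFun (congrFun h3 0) (k + 1)) 0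
    rwa [ofForm_apply_zero, ofForm_apply_zero] at h4

end Quotient

theorem ofForm_pullback_mem_exactCartan {EG E ER : Type*} [NormedAddCommGroup EG]
    [NormedSpace ℝ EG] [FiniteDimensional ℝ EG] [NormedAddCommGroup E] [NormedSpace ℝ E]
    [FiniteDimensional ℝ E] [NormedAddCommGroup ER] [NormedSpace ℝ ER] [FiniteDimensional ℝ ER]
    {G : Type*} [TopologicalSpace G] [ChartedSpace EG G] [Group G] [LieGroup 𝓘(ℝ, EG) ∞ G]
    {C : Type*} [TopologicalSpace C] [ChartedSpace E C] [IsManifold 𝓘(ℝ, E) ∞ C] [MulAction G C]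
    [ContMDiffSMul 𝓘(ℝ, EG) 𝓘(ℝ, E) ∞ G C]
    {R : Type*} [TopologicalSpace R] [ChartedSpace ER R] [IsManifold 𝓘(ℝ, ER) ∞ R]
    {π : C → R} {k : ℕ} (hπ : ContMDiff 𝓘(ℝ, E) 𝓘(ℝ, ER) ∞ π)
    (hG : ∀ (g : G) c, π (g • c) = π c) {β : FormField ER R k} (h : β ∈ exactForms ER R k) :
    ofForm EG (pullback (E := E) π β) ∈ exactCartan EG E G C k := by
  rcases k with _ | k
  · rw [(Submodule.mem_bot ℝ).1 h, pullback_zero]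
    refine (Submodule.mem_bot ℝ).2 ?_
    funext i j ξ
    rcases i with _ | i <;> simp [ofForm]
  · obtain ⟨γ, hγ, rfl⟩ := h
    exact ⟨_, ofForm_pullback_mem hπ hG hγ, cartanD_ofForm_pullback hπ hG hγ⟩

/-- The action on the zero level of the momentum map is smooth. -/
theorem IsReduction.contMDiffSMul {EG E EC ER : Type*} [NormedAddCommGroup EG] [NormedSpace ℝ EG]
    [NormedAddCommGroup E] [NormedSpace ℝ E] [NormedAddCommGroup EC] [NormedSpace ℝ EC]
    [NormedAddCommGroup ER] [NormedSpace ℝ ER]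
    {G : Type*} [TopologicalSpace G] [ChartedSpace EG G] [Group G] [LieGroup 𝓘(ℝ, EG) ∞ G]
    {M : Type*} [TopologicalSpace M] [ChartedSpace E M] [IsManifold 𝓘(ℝ, E) ∞ M]
    [MulAction G M] [ContMDiffSMul 𝓘(ℝ, EG) 𝓘(ℝ, E) ∞ G M] {J : M → EG →L[ℝ] ℝ}
    {C : Type*} [TopologicalSpace C] [ChartedSpace EC C] [IsManifold 𝓘(ℝ, EC) ∞ C] [MulAction G C]
    {R : Type*} [TopologicalSpace R] [ChartedSpace ER R] {ι : C → M} {π : C → R}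
    (hred : IsReduction E EC ER G J ι π) : ContMDiffSMul 𝓘(ℝ, EG) 𝓘(ℝ, EC) ∞ G C := by
  -- Smoothness into C is tested after the immersion ι once continuity is known; properness of the
  -- action on C provides the continuity.
  refine ⟨(ContMDiff.iff_comp_isImmersion hred.embedding.isImmersion).2 ⟨?_, ?_⟩⟩
  · have := hred.proper
    exact continuous_fst.smul continuous_snd
  · have h : (ι ∘ fun p : G × C => p.1 • p.2) = fun p => p.1 • ι p.2 := by
      funext p
      exact hred.equivariant _ _
    rw [h]
    exact contMDiff_fst.smul (hred.embedding.contMDiff.comp contMDiff_snd)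

end Kirwan

/-! ### The map K on closed forms and on cohomology. -/

open Kirwan in
theorem mainTheorem3
    {EG E EC ER : Type*} [NormedAddCommGroup EG] [NormedSpace ℝ EG] [FiniteDimensional ℝ EG]
    [NormedAddCommGroup E] [NormedSpace ℝ E] [FiniteDimensional ℝ E]
    [NormedAddCommGroup EC] [NormedSpace ℝ EC] [FiniteDimensional ℝ EC]
    [NormedAddCommGroup ER] [NormedSpace ℝ ER] [FiniteDimensional ℝ ER]
    {G : Type*} [TopologicalSpace G] [ChartedSpace EG G] [Group G] [LieGroup 𝓘(ℝ, EG) ∞ G]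
    [ConnectedSpace G]
    {M : Type*} [TopologicalSpace M] [T2Space M] [SecondCountableTopology M] [ConnectedSpace M]
    [ChartedSpace E M] [IsManifold 𝓘(ℝ, E) ∞ M]
    [MulAction G M] [ContMDiffSMul 𝓘(ℝ, EG) 𝓘(ℝ, E) ∞ G M] [ProperSMul G M]
    (σ : FormField E M 2) (hσ : IsSymplectic σ)
    (J : M → EG →L[ℝ] ℝ) (hJ : IsMomentumMap G σ J)
    {C : Type*} [TopologicalSpace C] [ChartedSpace EC C] [IsManifold 𝓘(ℝ, EC) ∞ C] [MulAction G C]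
    {R : Type*} [TopologicalSpace R] [ChartedSpace ER R] [IsManifold 𝓘(ℝ, ER) ∞ R]
    (ι : C → M) (π : C → R) (hred : IsReduction E EC ER G J ι π)
    (θ : PrincipalConnection EG EC G C) :
    (∀ k : ℕ,
      ∃ (ιZ : closedCartan EG E G M k →ₗ[ℝ] closedCartan EG EC G C k)
        (πZ : closedForms ER R k →ₗ[ℝ] closedCartan EG EC G C k)
        (K : closedCartan EG E G M k →ₗ[ℝ] closedForms ER R k)
        (ιH : EquivariantCohomology EG E G M k →ₗ[ℝ] EquivariantCohomology EG EC G C k)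
        (πH : DeRham ER R k ≃ₗ[ℝ] EquivariantCohomology EG EC G C k)
        (KH : EquivariantCohomology EG E G M k →ₗ[ℝ] DeRham ER R k),
        (∀ α, (ιZ α : CartanField EG EC C) = cartanPullback ι (α : CartanField EG E M)) ∧
        (∀ β, (πZ β : CartanField EG EC C) = ofForm EG (pullback π (β : FormField ER R k))) ∧
        Function.Injective πZ ∧
        (∀ α, ∀ n ≥ k / 2, (θ.phi)^[n] (ιZ α) = πZ (K α)) ∧
        (∀ α, ιH (Submodule.Quotient.mk α) = Submodule.Quotient.mk (ιZ α)) ∧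
        (∀ β, πH (Submodule.Quotient.mk β) = Submodule.Quotient.mk (πZ β)) ∧
        (∀ α, KH (Submodule.Quotient.mk α) = Submodule.Quotient.mk (K α)) ∧
        KH = πH.symm.toLinearMap ∘ₗ ιH) ∧
    (∀ k ≤ 2, ∀ α ∈ cartanForms EG EC G C k, θ.homotopy α = θ.rawHomotopy α) := by
  have hC : ContMDiffSMul 𝓘(ℝ, EG) 𝓘(ℝ, EC) ∞ G C := hred.contMDiffSMul
  have hT : T2Space C := hred.embedding.isEmbedding.t2Space
  have hP : ProperSMul G C := hred.proper
  have hιs : ContMDiff 𝓘(ℝ, EC) 𝓘(ℝ, E) ∞ ι := hred.embedding.contMDiff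
  have hπ := hred.submersion
  have hG : ∀ (g : G) c, π (g • c) = π c := fun g c => ((hred.orbits c (g • c)).2 ⟨g, rfl⟩).symm
  refine ⟨fun k => ?_, fun k hk α hα => θ.homotopy_eq_rawHomotopy hk hα⟩
  let ιZ : closedCartan EG E G M k →ₗ[ℝ] closedCartan EG EC G C k :=
    (cartanPullbackLinear EG E EC ι).restrict fun α hα =>
      ⟨cartanPullback_mem hιs hred.equivariant hα.1, by
        refine (cartanD_cartanPullback hιs hred.equivariant hα.1).trans ?_
        rw [hα.2]
        exact (cartanPullbackLinear EG E EC ι).map_zero⟩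
  have hιZ : (exactCartan EG E G M k).comap (closedCartan EG E G M k).subtype ≤
      ((exactCartan EG EC G C k).comap (closedCartan EG EC G C k).subtype).comap ιZ := by
    intro α hα
    rcases k with _ | k
    · have h0 : α = 0 := Subtype.ext ((Submodule.mem_bot ℝ).1 hα)
      rw [h0]
      exact Submodule.zero_mem _
    · obtain ⟨γ, hγ, hγα⟩ := hα
      refine ⟨cartanPullback ι γ, cartanPullback_mem hιs hred.equivariant hγ, ?_⟩
      rw [cartanD_cartanPullback hιs hred.equivariant hγ, hγα]
      rfl
  let πZ : closedForms ER R k →ₗ[ℝ] closedCartan EG EC G C k :=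
    quotientPullback EG EC G hπ.contMDiff hG k
  have hinj : Function.Injective πZ := quotientPullback_injective hπ hred.surjective hG
  have hmem : ∀ α, ((θ.phiClosed k ^ (k / 2)) ∘ₗ ιZ) α ∈ LinearMap.range πZ := fun α =>
    exists_iterate_phi_eq θ hπ hred.surjective hred.free hred.orbits hG (ιZ α)
  -- K takes exactly k/2 steps of φ, after which the result lies in the range of the injective map
  -- π^*, and inverts π^* there.
  let K : closedCartan EG E G M k →ₗ[ℝ] closedForms ER R k :=
    (LinearEquiv.ofInjective πZ hinj).symm.toLinearMap ∘ₗ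
      ((θ.phiClosed k ^ (k / 2)) ∘ₗ ιZ).codRestrict (LinearMap.range πZ) hmem
  have hK : ∀ α, πZ (K α) = (θ.phiClosed k ^ (k / 2)) (ιZ α) := fun α =>
    congrArg Subtype.val ((LinearEquiv.ofInjective πZ hinj).apply_symm_apply
      (((θ.phiClosed k ^ (k / 2)) ∘ₗ ιZ).codRestrict (LinearMap.range πZ) hmem α))
  -- The iterates of φ change a form by an exact one and so do nothing in cohomology.
  have hexact : ∀ α : closedCartan EG EC G C k, (Submodule.Quotient.mk
      ((θ.phiClosed k ^ (k / 2)) α) : EquivariantCohomology EG EC G C k) =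
        Submodule.Quotient.mk α := by
    intro α
    refine ((Submodule.Quotient.eq _).2 ?_).symm
    have h := (θ.iterate_phi α.2.1 (k / 2)).2.2
    rw [← θ.coe_phiClosed_pow] at h
    exact h
  let ιH := Submodule.mapQ _ _ ιZ hιZ
  let πH₀ : DeRham ER R k →ₗ[ℝ] EquivariantCohomology EG EC G C k :=
    Submodule.mapQ _ _ πZ fun β hβ => ofForm_pullback_mem_exactCartan hπ.contMDiff hG hβ
  have hbij : Function.Bijective πH₀ := by
    constructor
    · refine (injective_iff_map_eq_zero πH₀).2 fun β => ?_
      induction β using Submodule.Quotient.induction_on with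
      | H β =>
        intro h
        have h1 : πZ β ∈ (exactCartan EG EC G C k).comap (closedCartan EG EC G C k).subtype :=
          (Submodule.Quotient.mk_eq_zero _).1 h
        exact (Submodule.Quotient.mk_eq_zero _).2 (mem_exactForms_of_ofForm_mem θ hπ
          hred.surjective hred.free hred.orbits hG h1)
    · intro α
      induction α using Submodule.Quotient.induction_on with
      | H α =>
        obtain ⟨β, hβ⟩ := exists_iterate_phi_eq θ hπ hred.surjective hred.free hred.orbits hG α
        refine ⟨Submodule.Quotient.mk β, Eq.trans ?_ (hexact α)⟩
        rw [← hβ]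
        rfl
  let πH := LinearEquiv.ofBijective πH₀ hbij
  refine ⟨ιZ, πZ, K, ιH, πH, πH.symm.toLinearMap ∘ₗ ιH, fun _ => rfl, fun _ => rfl, hinj,
    fun α n hn => ?_, fun _ => rfl, fun _ => rfl, fun α => ?_, rfl⟩
  -- The m surplus iterations act on a form of symmetric degree zero, which φ fixes.
  · obtain ⟨m, rfl⟩ := Nat.exists_eq_add_of_le' hn
    rw [Function.iterate_add_apply, ← θ.coe_phiClosed_pow, ← hK]
    exact Function.iterate_fixed (θ.phi_eq_self fun i j => ofForm_apply_succ _ i j) m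
  -- It suffices to compare after applying π^*: by `hexact`, the class of π^*(Kα) is that of ι^*α.
  · refine (LinearEquiv.symm_apply_eq πH).2 ((hexact (ιZ α)).symm.trans ?_)
    rw [← hK]
    rfl
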